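/- Let $X$ be a countable set and $m$ a measure on all subsets of $X$ with $0<m(x):=m(\{x\})<\infty$ for all $x\in X$. All functions are real-valued; $C_c(X)$ denotes the finitely supported functions. **Forms.** A form $Q$ on a real Hilbert space $\mathcal H$ is a symmetric positive semidefinite bilinear map on a subspace $D(Q)$; write $Q(f)=Q(f,f)$ for $f\in D(Q)$, $Q(f)=\infty$ otherwise, $Q_1(f)=Q(f)+\|f\|^2$, and $Q\le Q'$ if $Q(f)\le Q'(f)$ for all $f\in\mathcal H$. $Q$ is closed if $D(Q)$ is complete for $Q_1^{1/2}$. On an $L^2$-space, a functional $\Phi$ on a subspace $D$ is Markovian if $C\circ f\in D$ and $\Phi(C\circ f)\le\Phi(f)$ for all $f\in D$ and all $C:\mathbb R\to\mathbb R$ with $C(0)=0$ and $|C(s)-C(t)|\le|s-t|$. A Dirichlet form in the wide sense is a closed Markovian form; it is a Dirichlet form if moreover it is densely defined. The operator $L$ of a densely defined closed form $Q$ is the self-adjoint operator with $Q(f,g)=\langle f,Lg\rangle$ for $f\in D(Q)$, $g\in D(L)\subset D(Q)$. Let $\mathfrak D$ be the set of Dirichlet forms $Q$ on $\ell^2(X,m)$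 with $C_c(X)\subset D(Q)$. **Graphs.** A graph $(b,c)$ over $X$ consists of a symmetric $b:X\times X\to[0,\infty)$ with $b(x,x)=0$ and $\sum_y b(x,y)<\infty$ for all $x$, and of $c:X\to[0,\infty)$. Put $$\mathcal Q_{b,c}(f)=\tfrac12\sum_{x,y}b(x,y)(f(x)-f(y))^2+\sum_x c(x)f(x)^2,\qquad \mathcal L_{b,c}f(x)=\frac1{m(x)}\sum_y b(x,y)(f(x)-f(y))+\frac{c(x)}{m(x)}f(x),$$ where $\mathcal L_{b,c}$ is defined on $\mathcal F_b=\{f:\sum_y b(x,y)|f(y)|<\infty\text{ for all }x\}$. $Q^{(N)}=Q^{(N)}_{b,c}$ is the restriction of $\mathcal Q_{b,c}$ to $D(Q^{(N)})=\{f\in\ell^2(X,m):\mathcal Q_{b,c}(f)<\infty\}$, and $Q^{(D)}=Q^{(D)}_{b,c}$ is the restriction of $Q^{(N)}$ to the closure of $C_c(X)$ with respect to $(Q^{(N)}_1)^{1/2}$. $\mathfrak D(b,c)$ is the set of Dirichlet forms $Q$ on $\ell^2(X,m)$ with $Q^{(N)}\le Q\le Q^{(D)}$. A function $u\in\mathcal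 F_b$ is $1$-harmonic if $(\mathcal L_{b,c}+1)u=0$. **Boundary.** Let $\hat X$ be the compact Hausdorff space, unique up to homeomorphism, containing $X$ as a dense subset with all $\{x\}$, $x\in X$, open, such that each bounded $f\in D(Q^{(N)})$ extends continuously to $\hat X$ and these extensions separate the points of $\hat X$. The $1$-harmonic boundary $\partial X$ of $(b,c)$ is the set of points of $\hat X\setminus X$ at which the extensions of all bounded $f\in D(Q^{(D)})$ vanish. Every $f\in D(Q^{(N)})$ has a unique continuous extension $\hat X\to[-\infty,\infty]$; $\gamma f$ is its restriction to $\partial X$. For $x\in X$ the $1$-harmonic measure $\mu_x$ is the Radon measure on $\partial X$ with $\mu_x(\partial X)\le1$ such that $h(x)=\int_{\partial X}\gamma f\,d\mu_x$ whenever $f\in D(Q^{(N)})$ is bounded and $h\in D(Q^{(N)})$ is $1$-harmonic with $\gamma h=\gamma f$; if $1\notin D(Q^{(N)})$, it is also required that $\mu_x$ has no mass at the unique point of $\partial X$ where $\gamma f$ vanishes for all bounded $f\in D(Q^{(N)})$. Fix for each graph $(b,c)$ a reference measure $\mu=\sum_{x}w(x)\mu_x$ on $\partial X$, where $w:X\to[0,\infty)$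 satisfies $\sum_x w(x)<\infty$, $\sum_x w(x)/m(x)<\infty$, and $w$ is positive at some point of each connected component of $(b,c)$. (If $(b,c)$ is connected, $\mu$ can be any $1$-harmonic measure $\mu_o$.) Let $L^2(\partial X)=L^2(\partial X,\mu)$; then $\gamma$ maps $D(Q^{(N)})$ to $L^2(\partial X)$, and for $\varphi\in\gamma D(Q^{(N)})$ let $H\varphi$ be the unique $1$-harmonic function in $D(Q^{(N)})$ with $\gamma H\varphi=\varphi$ in $L^2(\partial X)$. **Trace forms.** For $Q\in\mathfrak D(b,c)$ let $\operatorname{Tr}Q$ be the form on $L^2(\partial X)$ with $D(\operatorname{Tr}Q)=\gamma D(Q)$ and $\operatorname{Tr}Q(\varphi)=Q_1(H\varphi)$. Let $q^{DN}=q^{DN}_{b,c}=\operatorname{Tr}Q^{(N)}$, and let $\operatorname{Tr}\mathfrak D(b,c)$ be the set of Dirichlet forms in the wide sense $q$ on $L^2(\partial X)$ with $q\ge q^{DN}$ for which $q-q^{DN}$ is Markovian on $D(q)$. **Statement.** For $Q\in\mathfrak D$ the following assertions are equivalent. (i) There is a graph $(b_Q,c_Q)$ over $X$ such that the self-adjoint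 operator of $Q$ is a restriction of $\mathcal L_{b_Q,c_Q}$. (ii) There is a graph $(b_Q,c_Q)$ over $X$ with $D(Q)\subset D(Q^{(N)}_{b_Q,c_Q})$ and a form $q\in\operatorname{Tr}\mathfrak D(b_Q,c_Q)$ such that for all $f\in D(Q)$ one has $\gamma f\in D(q)$ and $$Q(f)=Q^{(N)}_{b_Q,c_Q}(f)+q(\gamma f)-q^{DN}_{b_Q,c_Q}(\gamma f).$$ More precisely, (i) or (ii) determine the same unique graph $(b_Q,c_Q)$; moreover $Q\in\mathfrak D(b_Q,c_Q)$, and in (ii) one can choose $q=\operatorname{Tr}Q$ (the trace being taken with respect to the $1$-harmonic boundary of $(b_Q,c_Q)$). If $\mathfrak D_g$ denotes the set of all $Q\in\mathfrak D$ satisfying (i) and (ii), then the map $$\mathfrak D_g\to\bigsqcup_{(b,c)\text{ graph}}\operatorname{Tr}\mathfrak D(b,c),\qquad Q\mapsto\big((b_Q,c_Q),\operatorname{Tr}Q\big)$$ is a bijection. -/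

import Mathlib

open MeasureTheory Filter Topology Set
open scoped NNReal ENNReal

noncomputable section

/-! ## Symmetric positive forms on a real Hilbert space -/

/-- A symmetric positive form `Q` on a real Hilbert space: a subspace (its domain) together with a
symmetric positive semidefinite bilinear map on it. -/
structure SymmForm (H : Type*) [NormedAddCommGroup H] [InnerProductSpace ℝ H] where
  dom : Submodule ℝ H
  form : dom →ₗ[ℝ] dom →ₗ[ℝ] ℝ
  symm : ∀ f g, form f g = form g f
  nonneg : ∀ f, 0 ≤ form f f

namespace SymmForm

variable {H : Type*} [NormedAddCommGroup H] [InnerProductSpace ℝ H]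

open Classical in
/-- The quadratic functional `Q(f) = Q(f,f)` for `f ∈ D(Q)`, and `Q(f) = ∞` otherwise. -/
def val (Q : SymmForm H) (f : H) : ℝ≥0∞ :=
  if h : f ∈ Q.dom then ENNReal.ofReal (Q.form ⟨f, h⟩ ⟨f, h⟩) else ∞

/-- The squared form norm `Q₁(f) = Q(f) + ‖f‖²`. -/
def val₁ (Q : SymmForm H) (f : H) : ℝ≥0∞ := Q.val f + ENNReal.ofReal (‖f‖ ^ 2)

/-- The order on forms: `Q ≤ Q'` if `Q(f) ≤ Q'(f)` for all `f` in the Hilbert space. -/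
instance : LE (SymmForm H) := ⟨fun Q Q' => ∀ f, Q.val f ≤ Q'.val f⟩

/-- A form is closed if its domain is complete with respect to the form norm. -/
def IsClosedForm (Q : SymmForm H) : Prop :=
  ∀ u : ℕ → H, (∀ n, u n ∈ Q.dom) →
    (∀ ε : ℝ≥0∞, 0 < ε → ∃ N, ∀ n ≥ N, ∀ k ≥ N, Q.val₁ (u n - u k) < ε) →
    ∃ f ∈ Q.dom, Tendsto (fun n => Q.val₁ (u n - f)) atTop (𝓝 0)

/-- The graph of the operator of a form: the pairs `(g, h)` with `g ∈ D(Q)` and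
`Q(f, g) = ⟨f, h⟩` for all `f ∈ D(Q)`. -/
def generatorGraph (Q : SymmForm H) : Submodule ℝ (H × H) where
  carrier := {p | ∃ hg : p.1 ∈ Q.dom, ∀ f : Q.dom, Q.form f ⟨p.1, hg⟩ = inner ℝ (f : H) p.2}
  add_mem' := by
    rintro ⟨g, h⟩ ⟨g', h'⟩ ⟨hg, e⟩ ⟨hg', e'⟩
    refine ⟨Q.dom.add_mem hg hg', fun f => ?_⟩
    have : Q.form f ⟨g + g', Q.dom.add_mem hg hg'⟩ = Q.form f ⟨g, hg⟩ + Q.form f ⟨g', hg'⟩ := by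
      rw [← map_add]; rfl
    simpa [inner_add_right, e f, e' f] using this
  zero_mem' := by
    refine ⟨Q.dom.zero_mem, fun f => ?_⟩
    have : Q.form f ⟨0, Q.dom.zero_mem⟩ = 0 := (Q.form f).map_zero
    simpa using this
  smul_mem' := by
    rintro a ⟨g, h⟩ ⟨hg, e⟩
    refine ⟨Q.dom.smul_mem a hg, fun f => ?_⟩
    have : Q.form f ⟨a • g, Q.dom.smul_mem a hg⟩ = a • Q.form f ⟨g, hg⟩ := by
      rw [← map_smul]; rfl
    simpa [inner_smul_right, e f] using this

/-- The operator `L` of a densely defined closed form `Q`, i.e. the self-adjoint operator with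
`Q(f, g) = ⟨f, L g⟩` for all `f ∈ D(Q)` and `g ∈ D(L)`: its domain consists of all `g ∈ D(Q)` for
which there is `h` with `Q(f, g) = ⟨f, h⟩` for all `f ∈ D(Q)`, and then `L g = h`. -/
def generator (Q : SymmForm H) : H →ₗ.[ℝ] H := Q.generatorGraph.toLinearPMap

theorem val_of_mem (Q : SymmForm H) {f : H} (h : f ∈ Q.dom) :
    Q.val f = ENNReal.ofReal (Q.form ⟨f, h⟩ ⟨f, h⟩) := by
  simp [val, h]

theorem val_ne_top_iff (Q : SymmForm H) (f : H) : Q.val f ≠ ∞ ↔ f ∈ Q.dom := by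
  by_cases h : f ∈ Q.dom <;> simp [val, h]

theorem val₁_ne_top_iff (Q : SymmForm H) (f : H) : Q.val₁ f ≠ ∞ ↔ f ∈ Q.dom := by
  rw [← val_ne_top_iff]; simp [val₁]

theorem val_add_le (Q : SymmForm H) (f g : H) :
    Q.val (f + g) ≤ 2 * Q.val f + 2 * Q.val g := by
  by_cases hf : f ∈ Q.dom
  · by_cases hg : g ∈ Q.dom
    · rw [Q.val_of_mem hf, Q.val_of_mem hg, Q.val_of_mem (Q.dom.add_mem hf hg)]
      set F : Q.dom := ⟨f, hf⟩
      set G : Q.dom := ⟨g, hg⟩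
      have e : (⟨f + g, Q.dom.add_mem hf hg⟩ : Q.dom) = F + G := rfl
      have h2 : (2 : ℝ≥0∞) = ENNReal.ofReal 2 := by simp
      rw [e, h2, ← ENNReal.ofReal_mul (by norm_num), ← ENNReal.ofReal_mul (by norm_num),
        ← ENNReal.ofReal_add (mul_nonneg (by norm_num) (Q.nonneg _))
          (mul_nonneg (by norm_num) (Q.nonneg _))]
      apply ENNReal.ofReal_le_ofReal
      have h := Q.nonneg (F - G)
      have hs := Q.symm F G
      simp only [map_sub, map_add, LinearMap.sub_apply, LinearMap.add_apply] at h ⊢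
      linarith
    · simp [val, hg, ENNReal.mul_top]
  · simp [val, hf, ENNReal.mul_top]

theorem val₁_add_le (Q : SymmForm H) (f g : H) :
    Q.val₁ (f + g) ≤ 2 * Q.val₁ f + 2 * Q.val₁ g := by
  have h : ENNReal.ofReal (‖f + g‖ ^ 2)
      ≤ 2 * ENNReal.ofReal (‖f‖ ^ 2) + 2 * ENNReal.ofReal (‖g‖ ^ 2) := by
    have h2 : (2 : ℝ≥0∞) = ENNReal.ofReal 2 := by simp
    rw [h2, ← ENNReal.ofReal_mul (by norm_num), ← ENNReal.ofReal_mul (by norm_num),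
      ← ENNReal.ofReal_add (by positivity) (by positivity)]
    apply ENNReal.ofReal_le_ofReal
    have h3 := norm_add_le f g
    have h4 : ‖f + g‖ ^ 2 ≤ (‖f‖ + ‖g‖) ^ 2 := by gcongr
    nlinarith [sq_nonneg (‖f‖ - ‖g‖)]
  calc Q.val₁ (f + g) ≤ (2 * Q.val f + 2 * Q.val g)
        + (2 * ENNReal.ofReal (‖f‖ ^ 2) + 2 * ENNReal.ofReal (‖g‖ ^ 2)) :=
        add_le_add (Q.val_add_le f g) h
    _ = _ := by simp only [val₁]; ring

theorem val₁_smul_le (Q : SymmForm H) (a : ℝ) {f : H} (hf : f ∈ Q.dom) :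
    Q.val₁ (a • f) ≤ ENNReal.ofReal (a ^ 2) * Q.val₁ f := by
  have e : (⟨a • f, Q.dom.smul_mem a hf⟩ : Q.dom) = a • ⟨f, hf⟩ := rfl
  rw [val₁, val₁, Q.val_of_mem hf, Q.val_of_mem (Q.dom.smul_mem a hf), e, mul_add,
    ← ENNReal.ofReal_mul (sq_nonneg a), ← ENNReal.ofReal_mul (sq_nonneg a)]
  refine le_of_eq ?_
  congr 2
  · simp only [map_smul, LinearMap.smul_apply, smul_eq_mul]; ring
  · rw [norm_smul, mul_pow, Real.norm_eq_abs, sq_abs]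

/-- The restriction of a form `Q` to the closure of `D(Q) ∩ V` with respect to the form norm. -/
def closureOn (Q : SymmForm H) (V : Submodule ℝ H) : SymmForm H where
  dom :=
    { carrier := {f | f ∈ Q.dom ∧ ∀ ε : ℝ≥0∞, 0 < ε → ∃ g ∈ V, Q.val₁ (f - g) < ε}
      add_mem' := by
        rintro f f' ⟨hf, h⟩ ⟨hf', h'⟩
        refine ⟨Q.dom.add_mem hf hf', fun ε hε => ?_⟩
        have hε' : 0 < ε / 4 := ENNReal.div_pos hε.ne' (by norm_num)
        obtain ⟨g, hg, e⟩ := h (ε / 4) hε'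
        obtain ⟨g', hg', e'⟩ := h' (ε / 4) hε'
        refine ⟨g + g', V.add_mem hg hg', ?_⟩
        have e0 : f + f' - (g + g') = (f - g) + (f' - g') := by abel
        rw [e0]
        refine (Q.val₁_add_le _ _).trans_lt ?_
        rw [← mul_add]
        calc 2 * (Q.val₁ (f - g) + Q.val₁ (f' - g')) < 2 * (ε / 4 + ε / 4) :=
              (ENNReal.mul_lt_mul_iff_right (by norm_num) (by norm_num)).2 (ENNReal.add_lt_add e e')
          _ = ε := by
              rw [← two_mul, ← mul_assoc, show (2 : ℝ≥0∞) * 2 = 4 by norm_num]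
              exact ENNReal.mul_div_cancel (by norm_num) (by norm_num)
      zero_mem' := ⟨Q.dom.zero_mem, fun ε hε => ⟨0, V.zero_mem, by
        have h0 : Q.form ⟨0, Q.dom.zero_mem⟩ ⟨0, Q.dom.zero_mem⟩ = 0 :=
          (Q.form ⟨0, Q.dom.zero_mem⟩).map_zero
        simpa [val₁, Q.val_of_mem Q.dom.zero_mem, h0] using hε⟩⟩
      smul_mem' := by
        rintro a f ⟨hf, h⟩
        refine ⟨Q.dom.smul_mem a hf, fun ε hε => ?_⟩
        have hC : ENNReal.ofReal (a ^ 2) + 1 ≠ ∞ := by simp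
        obtain ⟨g, hg, e⟩ := h (ε / (ENNReal.ofReal (a ^ 2) + 1)) (ENNReal.div_pos hε.ne' hC)
        refine ⟨a • g, V.smul_mem a hg, ?_⟩
        rw [← smul_sub]
        have hd : f - g ∈ Q.dom := (Q.val₁_ne_top_iff _).1 (ne_top_of_lt e)
        refine (Q.val₁_smul_le a hd).trans_lt ?_
        rw [ENNReal.lt_div_iff_mul_lt (by simp) (by simp), mul_comm] at e
        exact (mul_le_mul_left le_self_add _).trans_lt e }
  form := Q.form.compl₁₂ (Submodule.inclusion fun _ h => h.1) (Submodule.inclusion fun _ h => h.1)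
  symm _ _ := Q.symm _ _
  nonneg _ := Q.nonneg _

end SymmForm

/-! ## Dirichlet forms on `L²` -/

section Dirichlet

variable {Y : Type*} [MeasurableSpace Y] {μ : Measure Y}

/-- A functional `Φ` is Markovian on `D ⊆ L²(μ)` if it is compatible with normal contractions:
for all `f ∈ D` and all `C : ℝ → ℝ` with `C 0 = 0` and `|C s - C t| ≤ |s - t|`, one has `C ∘ f ∈ D`
and `Φ (C ∘ f) ≤ Φ f`. -/
def MarkovianOn (D : Submodule ℝ (Lp ℝ 2 μ)) (Φ : Lp ℝ 2 μ → ℝ) : Prop :=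
  ∀ (C : ℝ → ℝ) (hC : LipschitzWith 1 C) (h0 : C 0 = 0), ∀ f ∈ D,
    hC.compLp h0 f ∈ D ∧ Φ (hC.compLp h0 f) ≤ Φ f

/-- A Dirichlet form in the wide sense: a closed Markovian form, not necessarily densely defined. -/
structure IsWideDirichletForm (Q : SymmForm (Lp ℝ 2 μ)) : Prop where
  closed : Q.IsClosedForm
  markovian : MarkovianOn Q.dom fun f => (Q.val f).toReal

/-- A Dirichlet form: a closed, densely defined, Markovian form. -/
structure IsDirichletForm (Q : SymmForm (Lp ℝ 2 μ)) : Prop extends IsWideDirichletForm Q where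
  dense : Dense (Q.dom : Set (Lp ℝ 2 μ))

end Dirichlet

/-! ## Weighted graphs, the energy form and the formal Laplacian -/

/-- A graph `(b, c)` over `X`: a symmetric edge weight `b` with zero diagonal and summable rows, and
a killing term `c`. -/
@[ext]
structure WGraph (X : Type*) where
  b : X → X → ℝ≥0
  c : X → ℝ≥0
  symm : ∀ x y, b x y = b y x
  diag : ∀ x, b x x = 0
  summable : ∀ x, Summable (b x)

namespace WGraph

variable {X : Type*} (G : WGraph X)

/-- `x` and `y` lie in the same connected component. -/
def Connected (x y : X) : Prop := Relation.ReflTransGen (fun u v => 0 < G.b u v) x y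

/-- The energy `𝒬(f) = ½ ∑ b(x,y) (f(x) - f(y))² + ∑ c(x) f(x)² ∈ [0, ∞]`. -/
def energy (f : X → ℝ) : ℝ≥0∞ :=
  (∑' p : X × X, ENNReal.ofReal (G.b p.1 p.2 * (f p.1 - f p.2) ^ 2)) / 2
    + ∑' x, ENNReal.ofReal (G.c x * f x ^ 2)

theorem tsum_ofReal_ne_top_iff {ι : Type*} {a : ι → ℝ} (ha : ∀ i, 0 ≤ a i) :
    (∑' i, ENNReal.ofReal (a i)) ≠ ∞ ↔ Summable a := by
  have : a = fun i => ((a i).toNNReal : ℝ) := by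
    funext i; rw [Real.coe_toNNReal _ (ha i)]
  conv_rhs => rw [this]
  rw [NNReal.summable_coe, ← ENNReal.tsum_coe_ne_top_iff_summable]
  rfl

theorem energy_ne_top_iff (f : X → ℝ) : G.energy f ≠ ∞ ↔
    Summable (fun p : X × X => (G.b p.1 p.2 : ℝ) * (f p.1 - f p.2) ^ 2) ∧
      Summable fun x => (G.c x : ℝ) * f x ^ 2 := by
  rw [← tsum_ofReal_ne_top_iff (fun p => by positivity),
    ← tsum_ofReal_ne_top_iff (fun x => by positivity), energy, ENNReal.add_ne_top]
  refine and_congr_left fun _ => ?_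
  simp [ENNReal.div_eq_top]

/-- The space `𝒟` of functions of finite energy. -/
def finiteEnergy : Submodule ℝ (X → ℝ) where
  carrier := {f | G.energy f ≠ ∞}
  add_mem' := by
    intro f g hf hg
    rw [mem_ofPred_eq, energy_ne_top_iff] at *
    constructor
    · refine Summable.of_nonneg_of_le (fun p => by positivity) (fun p => ?_)
        ((hf.1.mul_left 2).add (hg.1.mul_left 2))
      have := mul_nonneg (G.b p.1 p.2).coe_nonneg
        (sq_nonneg ((f p.1 - f p.2) - (g p.1 - g p.2)))
      simp only [Pi.add_apply]
      nlinarith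
    · refine Summable.of_nonneg_of_le (fun p => by positivity) (fun x => ?_)
        ((hf.2.mul_left 2).add (hg.2.mul_left 2))
      have := mul_nonneg (G.c x).coe_nonneg (sq_nonneg (f x - g x))
      simp only [Pi.add_apply]
      nlinarith
  zero_mem' := by simp [energy]
  smul_mem' := by
    intro a f hf
    rw [mem_ofPred_eq, energy_ne_top_iff] at *
    constructor
    · refine (hf.1.mul_left (a ^ 2)).congr fun p => ?_
      simp only [Pi.smul_apply, smul_eq_mul]; ring
    · refine (hf.2.mul_left (a ^ 2)).congr fun x => ?_
      simp only [Pi.smul_apply, smul_eq_mul]; ring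

theorem summable_edge (f g : G.finiteEnergy) : Summable fun p : X × X =>
    (G.b p.1 p.2 : ℝ) * (f.1 p.1 - f.1 p.2) * (g.1 p.1 - g.1 p.2) := by
  refine Summable.of_norm_bounded ((((G.energy_ne_top_iff _).1 f.2).1).add
    (((G.energy_ne_top_iff _).1 g.2).1)) fun p => ?_
  have h1 := mul_nonneg (G.b p.1 p.2).coe_nonneg
    (sq_nonneg ((f.1 p.1 - f.1 p.2) - (g.1 p.1 - g.1 p.2)))
  have h2 := mul_nonneg (G.b p.1 p.2).coe_nonneg
    (sq_nonneg ((f.1 p.1 - f.1 p.2) + (g.1 p.1 - g.1 p.2)))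
  have h3 := mul_nonneg (G.b p.1 p.2).coe_nonneg (sq_nonneg (f.1 p.1 - f.1 p.2))
  have h4 := mul_nonneg (G.b p.1 p.2).coe_nonneg (sq_nonneg (g.1 p.1 - g.1 p.2))
  rw [Real.norm_eq_abs, abs_le]
  constructor <;> nlinarith

theorem summable_vertex (f g : G.finiteEnergy) :
    Summable fun x : X => (G.c x : ℝ) * f.1 x * g.1 x := by
  refine Summable.of_norm_bounded ((((G.energy_ne_top_iff _).1 f.2).2).add
    (((G.energy_ne_top_iff _).1 g.2).2)) fun x => ?_
  have h1 := mul_nonneg (G.c x).coe_nonneg (sq_nonneg (f.1 x - g.1 x))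
  have h2 := mul_nonneg (G.c x).coe_nonneg (sq_nonneg (f.1 x + g.1 x))
  have h3 := mul_nonneg (G.c x).coe_nonneg (sq_nonneg (f.1 x))
  have h4 := mul_nonneg (G.c x).coe_nonneg (sq_nonneg (g.1 x))
  rw [Real.norm_eq_abs, abs_le]
  constructor <;> nlinarith

/-- The bilinear energy form
`𝒬(f,g) = ½ ∑ b(x,y) (f(x) - f(y)) (g(x) - g(y)) + ∑ c(x) f(x) g(x)` on `𝒟`. -/
def energyForm : G.finiteEnergy →ₗ[ℝ] G.finiteEnergy →ₗ[ℝ] ℝ :=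
  LinearMap.mk₂ ℝ
    (fun f g => 1 / 2 * ∑' p : X × X,
        (G.b p.1 p.2 : ℝ) * (f.1 p.1 - f.1 p.2) * (g.1 p.1 - g.1 p.2)
      + ∑' x, (G.c x : ℝ) * f.1 x * g.1 x)
    (by
      intro f f' g
      have h1 := (G.summable_edge f g).tsum_add (G.summable_edge f' g)
      have h2 := (G.summable_vertex f g).tsum_add (G.summable_vertex f' g)
      rw [show ∀ a b c d : ℝ, 1 / 2 * a + b + (1 / 2 * c + d) = 1 / 2 * (a + c) + (b + d) by
        intros; ring, ← h1, ← h2]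
      refine congrArg₂ (fun s t : ℝ => 1 / 2 * s + t) (tsum_congr fun p => ?_)
        (tsum_congr fun x => ?_) <;>
      · simp only [Submodule.coe_add, Pi.add_apply]; ring)
    (by
      intro a f g
      rw [show ∀ s t : ℝ, a • (1 / 2 * s + t) = 1 / 2 * (a * s) + a * t by
        intros; rw [smul_eq_mul]; ring]
      refine congrArg₂ (fun s t : ℝ => 1 / 2 * s + t)
        (Eq.trans (tsum_congr fun p => ?_) tsum_mul_left)
        (Eq.trans (tsum_congr fun x => ?_) tsum_mul_left) <;>
      · simp only [Submodule.coe_smul, Pi.smul_apply, smul_eq_mul]; ring)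
    (by
      intro f g g'
      have h1 := (G.summable_edge f g).tsum_add (G.summable_edge f g')
      have h2 := (G.summable_vertex f g).tsum_add (G.summable_vertex f g')
      rw [show ∀ a b c d : ℝ, 1 / 2 * a + b + (1 / 2 * c + d) = 1 / 2 * (a + c) + (b + d) by
        intros; ring, ← h1, ← h2]
      refine congrArg₂ (fun s t : ℝ => 1 / 2 * s + t) (tsum_congr fun p => ?_)
        (tsum_congr fun x => ?_) <;>
      · simp only [Submodule.coe_add, Pi.add_apply]; ring)
    (by
      intro a f g
      rw [show ∀ s t : ℝ, a • (1 / 2 * s + t) = 1 / 2 * (a * s) + a * t by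
        intros; rw [smul_eq_mul]; ring]
      refine congrArg₂ (fun s t : ℝ => 1 / 2 * s + t)
        (Eq.trans (tsum_congr fun p => ?_) tsum_mul_left)
        (Eq.trans (tsum_congr fun x => ?_) tsum_mul_left) <;>
      · simp only [Submodule.coe_smul, Pi.smul_apply, smul_eq_mul]; ring)

/-- The domain `ℱ` of the formal Laplacian: all `f` with `∑_y b(x,y) |f(y)| < ∞` for all `x`. -/
def laplacianDomain : Set (X → ℝ) := {f | ∀ x, Summable fun y => (G.b x y : ℝ) * |f y|}

/-- The formal Laplacian
`ℒ f(x) = (1/m(x)) ∑_y b(x,y) (f(x) - f(y)) + (c(x)/m(x)) f(x)`. -/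
def laplacian [MeasurableSpace X] (m : Measure X) (f : X → ℝ) (x : X) : ℝ :=
  1 / m.real {x} * ∑' y, (G.b x y : ℝ) * (f x - f y) + G.c x / m.real {x} * f x

end WGraph

/-! ## Forms on a discrete measure space -/

/-- `(X, m)` is a discrete measure space: `0 < m({x}) < ∞` for all `x`. -/
class IsDiscreteMeasure {X : Type*} [MeasurableSpace X] (m : Measure X) : Prop where
  pos : ∀ x, 0 < m {x}
  lt_top : ∀ x, m {x} < ∞

section Discrete

variable {X : Type*} [MeasurableSpace X] (m : Measure X) [IsDiscreteMeasure m]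

theorem forall_of_ae {p : X → Prop} (h : ∀ᵐ x ∂m, p x) (x : X) : p x := by
  by_contra hx
  have : m {x} ≤ m {y | ¬ p y} := measure_mono (by simpa using hx)
  rw [ae_iff.1 h] at this
  exact absurd this (not_le.2 (IsDiscreteMeasure.pos x))

/-- Elements of `ℓ²(X, m)` as functions on `X` (all points have positive mass). -/
def toFunₗ : Lp ℝ 2 m →ₗ[ℝ] X → ℝ where
  toFun f := f
  map_add' f g := funext fun x => forall_of_ae m (Lp.coeFn_add f g) x
  map_smul' a f := funext fun x => forall_of_ae m (Lp.coeFn_smul a f) x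

/-- The subspace `C_c(X)` of `ℓ²(X, m)` of finitely supported functions. -/
def finSupp : Submodule ℝ (Lp ℝ 2 m) where
  carrier := {f | (Function.support (toFunₗ m f)).Finite}
  add_mem' := by
    intro f g hf hg
    refine (hf.union hg).subset ?_
    rw [map_add]
    exact Function.support_add _ _
  zero_mem' := by simp
  smul_mem' := by
    intro a f hf
    refine hf.subset ?_
    rw [map_smul]
    exact Function.support_const_smul_subset _ _

/-- The collection `𝔇` of all Dirichlet forms `Q` on `ℓ²(X, m)` with `C_c(X) ⊆ D(Q)`. -/
def dirichletForms : Set (SymmForm (Lp ℝ 2 m)) := {Q | IsDirichletForm Q ∧ finSupp m ≤ Q.dom}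

namespace WGraph

variable (G : WGraph X)

/-- The Neumann form `Q^(N)`: the restriction of `𝒬` to `𝒟 ∩ ℓ²(X, m)`. -/
def neumann : SymmForm (Lp ℝ 2 m) where
  dom := G.finiteEnergy.comap (toFunₗ m)
  form := G.energyForm.compl₁₂ ((toFunₗ m).restrict fun _ h => h) ((toFunₗ m).restrict fun _ h => h)
  symm f g := by
    simp only [energyForm, LinearMap.compl₁₂_apply, LinearMap.mk₂_apply]
    exact congrArg₂ (fun s t : ℝ => 1 / 2 * s + t) (tsum_congr fun p => by ring)
      (tsum_congr fun x => by ring)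
  nonneg f := by
    simp only [energyForm, LinearMap.compl₁₂_apply, LinearMap.mk₂_apply]
    refine add_nonneg (mul_nonneg (by norm_num) (tsum_nonneg fun p => ?_)) (tsum_nonneg fun x => ?_)
    · rw [mul_assoc]; exact mul_nonneg (NNReal.coe_nonneg _) (mul_self_nonneg _)
    · rw [mul_assoc]; exact mul_nonneg (NNReal.coe_nonneg _) (mul_self_nonneg _)

/-- The Dirichlet form `Q^(D)`: the restriction of `Q^(N)` to the form norm closure of `C_c(X)`. -/
def dirichlet : SymmForm (Lp ℝ 2 m) := (G.neumann m).closureOn (finSupp m)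

/-- The set `𝔇(b, c)` of all Dirichlet forms `Q` with `Q^(N) ≤ Q ≤ Q^(D)`. -/
def intermediateForms : Set (SymmForm (Lp ℝ 2 m)) :=
  {Q | IsDirichletForm Q ∧ G.neumann m ≤ Q ∧ Q ≤ G.dirichlet m}

/-- `u` is `1`-harmonic: `u ∈ ℱ` and `(ℒ + 1) u = 0`. -/
def IsOneHarmonic (u : X → ℝ) : Prop :=
  u ∈ G.laplacianDomain ∧ ∀ x, G.laplacian m u x + u x = 0

/-- The self-adjoint operator of `Q` is a restriction of the formal Laplacian of `G`. -/
def GeneratorIsRestriction (Q : SymmForm (Lp ℝ 2 m)) : Prop :=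
  ∀ f : Q.generator.domain, ⇑(f : Lp ℝ 2 m) ∈ G.laplacianDomain ∧
    ∀ x, (Q.generator f : Lp ℝ 2 m) x = G.laplacian m (f : Lp ℝ 2 m) x

/-! ## The `1`-harmonic boundary -/

/-- The bounded functions in `D(Q^(N))`. -/
def BoundedNeumann : Type _ :=
  {f : Lp ℝ 2 m // f ∈ (G.neumann m).dom ∧ ∃ B : ℝ, ∀ x, |f x| ≤ B}

/-- The evaluation map `X → ℝ^A`, where `A` is the set of bounded functions in `D(Q^(N))`. The
closure of its range (in the product topology) is the Royden compactification of `X`: a compact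
Hausdorff space in which `X` is dense and discrete, to which all elements of `A` extend
continuously (as the coordinate functions), and whose points are separated by these extensions. -/
def evalMap (x : X) : G.BoundedNeumann m → ℝ := fun f => f.1 x

/-- The `1`-harmonic boundary `∂X`: the points of the compactification, not in `X`, at which the
continuous extensions of all bounded `f ∈ D(Q^(D))` vanish. -/
def Boundary : Type _ :=
  {z : G.BoundedNeumann m → ℝ // z ∈ closure (range (G.evalMap m)) ∧ z ∉ range (G.evalMap m) ∧
    ∀ f, f.1 ∈ (G.dirichlet m).dom → z f = 0}

instance : TopologicalSpace (G.Boundary m) := instTopologicalSpaceSubtype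

instance : MeasurableSpace (G.Boundary m) := borel _

instance : BorelSpace (G.Boundary m) := ⟨rfl⟩

/-- The preliminary trace map `γ₀`: the boundary values of bounded functions in `D(Q^(N))`. -/
def trace₀ (f : G.BoundedNeumann m) : G.Boundary m → ℝ := fun z => z.1 f

/-- The trace map `γ`: for `f ∈ D(Q^(N))` the value at `z ∈ ∂X` of the continuous extension of `f`
to a function on the compactification with values in `[-∞, ∞]`, i.e. `lim f(x)` as `x ∈ X`
tends to `z`. -/
def trace (f : Lp ℝ 2 m) : G.Boundary m → EReal := fun z =>
  limUnder (comap (G.evalMap m) (𝓝 z.1)) fun x => ((f x : ℝ) : EReal)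

/-- `h` is the `1`-harmonic extension of the function `φ` on `∂X`: it belongs to `D(Q^(N))`, is
`1`-harmonic and has boundary values `φ`. -/
def IsHarmonicExtension (φ : G.Boundary m → EReal) (h : Lp ℝ 2 m) : Prop :=
  h ∈ (G.neumann m).dom ∧ G.IsOneHarmonic m h ∧ G.trace m h = φ

/-- `μ` is the `1`-harmonic measure of the point `x`: a Radon measure on `∂X` with `μ(∂X) ≤ 1` and
`Hφ(x) = ∫ φ dμ` for all `φ` in the range of `γ₀`, without mass at the point (if there is one, which
happens exactly if `1 ∉ D(Q^(N))`) where all functions in the range of `γ₀` vanish. -/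
structure IsHarmonicMeasure (x : X) (μ : Measure (G.Boundary m)) : Prop where
  regular : μ.Regular
  le_one : μ univ ≤ 1
  eq_integral : ∀ (f : G.BoundedNeumann m) (h : Lp ℝ 2 m),
    G.IsHarmonicExtension m (G.trace m f.1) h → h x = ∫ z, G.trace₀ m f z ∂μ
  no_mass : ∀ z, (∀ f, G.trace₀ m f z = 0) → μ {z} = 0

open Classical in
/-- The `1`-harmonic measure `μ_x` (which exists and is unique). -/
def harmonicMeasure (x : X) : Measure (G.Boundary m) :=
  if h : ∃ μ, G.IsHarmonicMeasure m x μ then h.choose else 0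

/-- Admissible weights for a mixture of `1`-harmonic measures: `∑ w(x) < ∞`, `∑ w(x)/m(x) < ∞`, and
every connected component contains a point of positive weight. If the graph is connected, the point
masses `w = 1_{o}` are admissible. -/
structure IsAdmissibleWeight (w : X → ℝ≥0) : Prop where
  sum_lt_top : (∑' x, (w x : ℝ≥0∞)) < ∞
  sum_div_lt_top : (∑' x, (w x : ℝ≥0∞) / m {x}) < ∞
  exists_pos : ∀ x, ∃ y, G.Connected x y ∧ 0 < w y

/-- The reference measure `μ = ∑ w(x) μ_x` on `∂X`. For `w = 1_{o}` this is the `1`-harmonic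
measure of the point `o`. -/
def refMeasure (w : X → ℝ≥0) : Measure (G.Boundary m) :=
  Measure.sum fun x => w x • G.harmonicMeasure m x

/-! ## Trace forms -/

section TraceForms

variable {m} {G} {μ : Measure (G.Boundary m)}

/-- `γ f = φ` in `L²(∂X, μ)`. -/
def HasTrace (f : Lp ℝ 2 m) (φ : Lp ℝ 2 μ) : Prop :=
  ∀ᵐ z ∂μ, G.trace m f z = ((φ z : ℝ) : EReal)

open Classical in
/-- The `1`-harmonic extension `Hφ` of `φ ∈ γ D(Q^(N)) ⊆ L²(∂X, μ)`. -/
def harmonicExtension (φ : Lp ℝ 2 μ) : Lp ℝ 2 m :=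
  if h : ∃ h, h ∈ (G.neumann m).dom ∧ G.IsOneHarmonic m h ∧ HasTrace h φ then h.choose else 0

open Classical in
/-- The quadratic functional of the trace form `Tr Q`: it is `Q₁(Hφ)` on its domain `γ D(Q)` and `∞`
elsewhere. -/
def traceVal (Q : SymmForm (Lp ℝ 2 m)) (φ : Lp ℝ 2 μ) : ℝ≥0∞ :=
  if ∃ f ∈ Q.dom, HasTrace f φ then Q.val₁ (harmonicExtension φ) else ∞

/-- The quadratic functional of the Dirichlet-to-Neumann form `q^DN = Tr Q^(N)`. -/
def dnVal (φ : Lp ℝ 2 μ) : ℝ≥0∞ := traceVal (G.neumann m) φ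

/-- `q` is the trace form `Tr Q` of the form `Q ∈ 𝔇(b, c)`. -/
structure IsTraceForm (Q : SymmForm (Lp ℝ 2 m)) (q : SymmForm (Lp ℝ 2 μ)) : Prop where
  mem : Q ∈ G.intermediateForms m
  val_eq : ∀ φ, q.val φ = traceVal Q φ

variable (μ) in
/-- The set `Tr 𝔇(b, c)` of all Dirichlet forms in the wide sense `q` on `L²(∂X, μ)` such that
`q ≥ q^DN` and such that `q - q^DN` is Markovian on `D(q)`. -/
def traceForms : Set (SymmForm (Lp ℝ 2 μ)) :=
  {q | IsWideDirichletForm q ∧ (∀ φ, dnVal φ ≤ q.val φ) ∧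
    MarkovianOn q.dom fun φ => (q.val φ).toReal - (dnVal φ).toReal}

/-- `D(Q) ⊆ D(Q^(N))` and `Q(f) = Q^(N)(f) + q(γ f) - q^DN(γ f)` for all `f ∈ D(Q)`. -/
def IsRepresentedBy (Q : SymmForm (Lp ℝ 2 m)) (q : SymmForm (Lp ℝ 2 μ)) : Prop :=
  Q.dom ≤ (G.neumann m).dom ∧ ∀ f ∈ Q.dom, ∃ φ ∈ q.dom, HasTrace f φ ∧
    (Q.val f).toReal = ((G.neumann m).val f).toReal + (q.val φ).toReal - (dnVal φ).toReal

end TraceForms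

/-- `Q` is given by the Neumann form of the graph plus a boundary term: there is `q ∈ Tr 𝔇(b, c)`
with `Q = Q^(N) + q ∘ γ - q^DN ∘ γ` on `D(Q) ⊆ D(Q^(N))`. -/
def HasBoundaryRepresentation (w : X → ℝ≥0) (Q : SymmForm (Lp ℝ 2 m)) : Prop :=
  ∃ q ∈ traceForms (G.refMeasure m w), IsRepresentedBy Q q

end WGraph

end Discrete

end

/-! The graph side rests on one equivalence, `generatorIsRestriction_iff_intermediate`: the operator
of `Q` is a restriction of `ℒ_{b,c}` iff `Q^(N) ≤ Q ≤ Q^(D)`. If `Q` lies in between, then `Q -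
Q^(N)` is a nonnegative form vanishing on `D(Q^(D))`, so `Q(f,g) = Q^(N)(f,g)` once `f ∈ D(Q^(D))`
(`fm_eq_of_mem_dirichlet`); with `f` an indicator, Green's formula identifies the operator.

Conversely, let `J = (εL + 1)⁻¹`. On finite sets the approximating form `ε⁻¹⟨f - J f, f⟩` is a graph
form with nonnegative edge weights and killing (`approx_cut`). If `L` is a restriction of `ℒ_{b,c}`,
these weights converge to `b` and `c` as `ε → 0`. Hence, for every normal contraction `C`, the
decrease from `f` to `C ∘ f` of any finite part of the energy of `(b,c)` is at most the decrease of
`Q` (`sum_weight_le`). With `C = 0` this gives `Q^(N) ≤ Q`; for general `C` it says that `Q - Q^(N)`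
is Markovian (`sub_neumann_contr_le`). Since `Q = Q^(N)` on `C_c(X)`, also `Q ≤ Q^(D)`. The graph is
unique because the numbers `Q(1_x, 1_y)` recover `b` and `c`.

The boundary side is an orthogonal decomposition. In the form inner product `Q^(N)(f,g) + ⟨f,g⟩` the
complement of `D(Q^(D))` consists of the `1`-harmonic functions (`isOneHarmonic_iff`), and
`D(Q^(D))` is the kernel of the trace (`tr_eq_zero_iff`). Existence of harmonic measures follows
from the maximum principle, Hahn–Banach and the Riesz theorem. The trace is bounded into `L²`
because the harmonic extension of the square of a bounded harmonic function `h` is at most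
`3‖h‖²/m(x)` at `x` (`harm_sq_le`).

For `Q ∈ 𝔇(b,c)` the same decomposition is orthogonal for `Q₁`, and the `D(Q^(D))` part has the same
norm in `Q` and `Q^(N)`. Therefore `Q - Q^(N) = (Tr Q - q^DN) ∘ γ`, which gives (ii), membership of
`Tr Q` in `Tr 𝔇(b,c)` and injectivity. For surjectivity, `Q^(N) + q ∘ γ - q^DN ∘ γ` (`extForm`) is
shown to be an intermediate Dirichlet form with trace `q`. -/

noncomputable section

set_option linter.unusedSectionVars false

/-! ## The Hilbert space of a form -/

namespace SymmForm

variable {H : Type*} [NormedAddCommGroup H] [InnerProductSpace ℝ H]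

/-- The domain of a form, to be equipped with the inner product `Q(f,g) + ⟨f,g⟩`. -/
def FormSpace (Q : SymmForm H) : Type _ := Q.dom

variable (Q : SymmForm H)

instance : AddCommGroup Q.FormSpace := inferInstanceAs (AddCommGroup Q.dom)

instance : Module ℝ Q.FormSpace := inferInstanceAs (Module ℝ Q.dom)

/-- The identity map from the form space to the domain. -/
def toDom : Q.FormSpace ≃ₗ[ℝ] Q.dom := LinearEquiv.refl ℝ Q.dom

/-- The inner product `Q(f,g) + ⟨f,g⟩` on the form space. -/
@[reducible] def formCore : InnerProductSpace.Core ℝ Q.FormSpace where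
  inner f g := Q.form (Q.toDom f) (Q.toDom g) + inner ℝ (Q.toDom f : H) (Q.toDom g : H)
  conj_inner_symm f g := by
    simp only [conj_trivial]
    rw [Q.symm, real_inner_comm]
  re_inner_nonneg f := by
    simpa using add_nonneg (Q.nonneg (Q.toDom f)) real_inner_self_nonneg
  add_left f g h := by
    simp only [map_add, LinearMap.add_apply, Submodule.coe_add, inner_add_left]
    ring
  smul_left f g r := by
    simp only [map_smul, LinearMap.smul_apply, Submodule.coe_smul, inner_smul_left, smul_eq_mul,
      conj_trivial]
    ring
  definite f h := by
    have h1 := Q.nonneg (Q.toDom f)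
    have h2 : 0 ≤ inner ℝ (Q.toDom f : H) (Q.toDom f : H) := real_inner_self_nonneg
    have h3 : inner ℝ (Q.toDom f : H) (Q.toDom f : H) = 0 := by
      change Q.form (Q.toDom f) (Q.toDom f) + inner ℝ (Q.toDom f : H) (Q.toDom f : H) = 0 at h
      linarith
    have h4 : (Q.toDom f : H) = 0 := inner_self_eq_zero.1 h3
    have h5 : Q.toDom f = 0 := Subtype.ext h4
    simpa using h5

instance : NormedAddCommGroup Q.FormSpace := Q.formCore.toNormedAddCommGroup

instance : InnerProductSpace ℝ Q.FormSpace := InnerProductSpace.ofCore Q.formCore.toCore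

theorem inner_def (f g : Q.FormSpace) :
    inner ℝ f g = Q.form (Q.toDom f) (Q.toDom g) + inner ℝ (Q.toDom f : H) (Q.toDom g : H) := rfl

theorem norm_sq_def (f : Q.FormSpace) :
    ‖f‖ ^ 2 = Q.form (Q.toDom f) (Q.toDom f) + ‖(Q.toDom f : H)‖ ^ 2 := by
  rw [← real_inner_self_eq_norm_sq, inner_def, real_inner_self_eq_norm_sq]

theorem norm_toDom_le (f : Q.FormSpace) : ‖(Q.toDom f : H)‖ ≤ ‖f‖ := by
  refine le_of_sq_le_sq ?_ (norm_nonneg _)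
  rw [norm_sq_def]
  linarith [Q.nonneg (Q.toDom f)]

/-- The inclusion of the form space into the Hilbert space. -/
def incl : Q.FormSpace →L[ℝ] H :=
  LinearMap.mkContinuous (Q.dom.subtype ∘ₗ Q.toDom.toLinearMap) 1 fun f => by
    simpa using Q.norm_toDom_le f

/-- An element of the domain as an element of the form space. -/
def ofMem {f : H} (hf : f ∈ Q.dom) : Q.FormSpace := Q.toDom.symm ⟨f, hf⟩

@[simp] theorem incl_ofMem {f : H} (hf : f ∈ Q.dom) : Q.incl (Q.ofMem hf) = f := rfl

theorem incl_mem (f : Q.FormSpace) : Q.incl f ∈ Q.dom := (Q.toDom f).2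

theorem incl_injective : Function.Injective Q.incl := fun _ _ h => Q.toDom.injective (Subtype.ext h)

theorem norm_incl_le (f : Q.FormSpace) : ‖Q.incl f‖ ≤ ‖f‖ := Q.norm_toDom_le f

/-- The bilinear form on the form space. -/
def fm (f g : Q.FormSpace) : ℝ := Q.form (Q.toDom f) (Q.toDom g)

theorem inner_eq (f g : Q.FormSpace) :
    inner ℝ f g = Q.fm f g + inner ℝ (Q.incl f) (Q.incl g) := rfl

theorem norm_sq_eq (f : Q.FormSpace) : ‖f‖ ^ 2 = Q.fm f f + ‖Q.incl f‖ ^ 2 := Q.norm_sq_def f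

theorem fm_nonneg (f : Q.FormSpace) : 0 ≤ Q.fm f f := Q.nonneg _

theorem fm_comm (f g : Q.FormSpace) : Q.fm f g = Q.fm g f := Q.symm _ _

theorem val_incl (f : Q.FormSpace) : Q.val (Q.incl f) = ENNReal.ofReal (Q.fm f f) :=
  Q.val_of_mem (Q.incl_mem f)

theorem toReal_val_incl (f : Q.FormSpace) : (Q.val (Q.incl f)).toReal = Q.fm f f := by
  rw [val_incl, ENNReal.toReal_ofReal (Q.fm_nonneg f)]

theorem toReal_val {f : H} (hf : f ∈ Q.dom) :
    (Q.val f).toReal = Q.fm (Q.ofMem hf) (Q.ofMem hf) := Q.toReal_val_incl (Q.ofMem hf)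

theorem val₁_incl (f : Q.FormSpace) : Q.val₁ (Q.incl f) = ENNReal.ofReal (‖f‖ ^ 2) := by
  rw [val₁, val_incl, norm_sq_eq, ENNReal.ofReal_add (Q.fm_nonneg f) (by positivity)]

theorem val₁_incl_lt_iff (f : Q.FormSpace) {ε : ℝ} (hε : 0 < ε) :
    Q.val₁ (Q.incl f) < ENNReal.ofReal (ε ^ 2) ↔ ‖f‖ < ε := by
  rw [val₁_incl, ENNReal.ofReal_lt_ofReal_iff (by positivity),
    sq_lt_sq₀ (norm_nonneg _) hε.le]

theorem exists_ofReal_sq_le {ε : ℝ≥0∞} (hε : 0 < ε) : ∃ δ : ℝ, 0 < δ ∧ ENNReal.ofReal (δ ^ 2) ≤ ε := by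
  obtain ⟨r, hr, hr'⟩ := ENNReal.lt_iff_exists_nnreal_btwn.1 hε
  refine ⟨Real.sqrt r, Real.sqrt_pos.2 (by simpa using hr), ?_⟩
  rw [Real.sq_sqrt (NNReal.coe_nonneg r)]
  simpa using hr'.le

theorem completeSpace_of_isClosedForm (hQ : Q.IsClosedForm) : CompleteSpace Q.FormSpace := by
  refine Metric.complete_of_cauchySeq_tendsto fun u hu => ?_
  obtain ⟨f, hf, h⟩ := hQ (fun n => Q.incl (u n)) (fun n => Q.incl_mem _) (by
    intro ε hε
    obtain ⟨δ, hδ, hδ'⟩ := exists_ofReal_sq_le hε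
    obtain ⟨N, hN⟩ := Metric.cauchySeq_iff.1 hu δ hδ
    refine ⟨N, fun n hn k hk => lt_of_lt_of_le ?_ hδ'⟩
    rw [← map_sub, val₁_incl_lt_iff _ _ hδ, ← dist_eq_norm]
    exact hN n hn k hk)
  refine ⟨Q.ofMem hf, Metric.tendsto_atTop'.2 fun ε hε => ?_⟩
  have h' := (tendsto_order.1 h).2 (ENNReal.ofReal (ε ^ 2)) (by simp; positivity)
  obtain ⟨N, hN⟩ := eventually_atTop.1 h'
  refine ⟨N, fun n hn => ?_⟩
  rw [dist_eq_norm, ← Q.val₁_incl_lt_iff _ hε, map_sub, incl_ofMem]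
  exact hN n hn.le

theorem isClosedForm_of_completeSpace [CompleteSpace Q.FormSpace] : Q.IsClosedForm := by
  intro u hu hc
  have hcs : CauchySeq fun n => Q.ofMem (hu n) := by
    refine Metric.cauchySeq_iff.2 fun ε hε => ?_
    obtain ⟨N, hN⟩ := hc (ENNReal.ofReal (ε ^ 2)) (by simp; positivity)
    refine ⟨N, fun n hn k hk => ?_⟩
    rw [dist_eq_norm, ← Q.val₁_incl_lt_iff _ hε, map_sub, incl_ofMem, incl_ofMem]
    exact hN n hn k hk
  obtain ⟨f, hf⟩ := cauchySeq_tendsto_of_complete hcs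
  refine ⟨Q.incl f, Q.incl_mem f, ?_⟩
  have : ∀ n, Q.val₁ (u n - Q.incl f) = ENNReal.ofReal (‖Q.ofMem (hu n) - f‖ ^ 2) := fun n => by
    rw [← val₁_incl, map_sub, incl_ofMem]
  simp only [this]
  have h2 := ((tendsto_iff_norm_sub_tendsto_zero.1 hf).pow 2)
  simpa using ENNReal.tendsto_ofReal h2

/-- Finiteness of the functional recovers the domain, polarization the bilinear form. -/
theorem ext_val {Q Q' : SymmForm H} (h : ∀ f, Q.val f = Q'.val f) : Q = Q' := by
  have hd : Q.dom = Q'.dom := by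
    ext f
    rw [← val_ne_top_iff, ← val_ne_top_iff, h]
  obtain ⟨D, a, s, p⟩ := Q
  obtain ⟨D', a', s', p'⟩ := Q'
  obtain rfl : D = D' := hd
  have hq : ∀ f, a f f = a' f f := by
    intro f
    have := congrArg ENNReal.toReal (h f)
    rwa [val_of_mem _ f.2, val_of_mem _ f.2, ENNReal.toReal_ofReal (p _),
      ENNReal.toReal_ofReal (p' _)] at this
  have : a = a' := by
    ext f g
    have h1 := hq (f + g)
    have h2 := s f g
    have h3 := s' f g
    simp only [map_add, LinearMap.add_apply] at h1
    linarith [hq f, hq g]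
  subst this
  rfl

section fm

variable {Q}

theorem fm_add_left (f g h : Q.FormSpace) : Q.fm (f + g) h = Q.fm f h + Q.fm g h := by simp [fm]

theorem fm_add_right (f g h : Q.FormSpace) : Q.fm f (g + h) = Q.fm f g + Q.fm f h := by simp [fm]

theorem fm_smul_left (a : ℝ) (f g : Q.FormSpace) : Q.fm (a • f) g = a * Q.fm f g := by simp [fm]

theorem fm_smul_right (a : ℝ) (f g : Q.FormSpace) : Q.fm f (a • g) = a * Q.fm f g := by simp [fm]

end fm

/-! ### The resolvent -/

section resolvent

/-- The bounded bilinear form `ε Q(f,g) + ⟨f,g⟩` on the form space. -/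
def resolventForm (ε : ℝ) : Q.FormSpace →L[ℝ] Q.FormSpace →L[ℝ] ℝ :=
  -- Writing the form through the two inner products makes its continuity automatic.
  ε • innerSL ℝ + (1 - ε) • (innerSL ℝ).bilinearComp Q.incl Q.incl

theorem resolventForm_apply (ε : ℝ) (f g : Q.FormSpace) :
    Q.resolventForm ε f g = ε * Q.fm f g + inner ℝ (Q.incl f) (Q.incl g) := by
  change ε * inner ℝ f g + (1 - ε) * inner ℝ (Q.incl f) (Q.incl g) = _
  rw [inner_eq]
  ring

theorem isCoercive_resolventForm {ε : ℝ} (hε : 0 < ε) : IsCoercive (Q.resolventForm ε) := by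
  refine ⟨min ε 1, lt_min hε one_pos, fun f => ?_⟩
  rw [resolventForm_apply, mul_assoc, ← pow_two, norm_sq_eq, real_inner_self_eq_norm_sq]
  have h1 := Q.fm_nonneg f
  have h2 : 0 ≤ ‖Q.incl f‖ ^ 2 := by positivity
  nlinarith [mul_le_mul_of_nonneg_right (min_le_left ε 1) h1,
    mul_le_mul_of_nonneg_right (min_le_right ε 1) h2]

/-- Lax–Milgram on the form space: `⟨·, f⟩` is a bounded functional there, represented by the
adjoint of the inclusion, and `ε Q + ⟨·,·⟩` is coercive. -/
theorem exists_resolvent [CompleteSpace H] [CompleteSpace Q.FormSpace] {ε : ℝ} (hε : 0 < ε) :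
    ∃ J : H →L[ℝ] Q.FormSpace, ∀ f g, ε * Q.fm g (J f) + inner ℝ (Q.incl g) (Q.incl (J f)) =
      inner ℝ (Q.incl g) f := by
  let e := (Q.isCoercive_resolventForm hε).continuousLinearEquivOfBilin
  refine ⟨(e.symm : Q.FormSpace →L[ℝ] Q.FormSpace) ∘L ContinuousLinearMap.adjoint Q.incl,
    fun f g => ?_⟩
  have h := (Q.isCoercive_resolventForm hε).continuousLinearEquivOfBilin_apply
    (e.symm (ContinuousLinearMap.adjoint Q.incl f)) g
  rw [show (Q.isCoercive_resolventForm hε).continuousLinearEquivOfBilin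
    (e.symm (ContinuousLinearMap.adjoint Q.incl f)) = ContinuousLinearMap.adjoint Q.incl f from
    e.apply_symm_apply _, ContinuousLinearMap.adjoint_inner_left, resolventForm_apply] at h
  rw [real_inner_comm f, h, fm_comm, real_inner_comm (Q.incl g)]
  rfl

variable [CompleteSpace H] [CompleteSpace Q.FormSpace]

open Classical in
/-- The resolvent `(εL + 1)⁻¹` of a closed form (zero if `ε ≤ 0`). -/
def resolvent (ε : ℝ) : H →L[ℝ] Q.FormSpace :=
  if hε : 0 < ε then (Q.exists_resolvent hε).choose else 0

variable {Q} {ε : ℝ}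

theorem resolvent_spec (hε : 0 < ε) (f : H) (g : Q.FormSpace) :
    ε * Q.fm g (Q.resolvent ε f) + inner ℝ (Q.incl g) (Q.incl (Q.resolvent ε f)) =
      inner ℝ (Q.incl g) f := by
  rw [resolvent, dif_pos hε]
  exact (Q.exists_resolvent hε).choose_spec f g

/-- Both sides are the symmetric form `ε Q + ⟨·,·⟩` evaluated at the two resolvents. -/
theorem inner_resolvent_comm (hε : 0 < ε) (f g : H) :
    inner ℝ (Q.incl (Q.resolvent ε f)) g = inner ℝ f (Q.incl (Q.resolvent ε g)) := by
  have h1 := resolvent_spec hε g (Q.resolvent ε f)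
  have h2 := resolvent_spec hε f (Q.resolvent ε g)
  rw [fm_comm, real_inner_comm] at h2
  rw [← h1, h2, real_inner_comm]

/-- The resolvent minimizes `ε Q(v) + ‖v - f‖²`. -/
theorem resolvent_minimizes (hε : 0 < ε) (f : H) (v : Q.FormSpace) :
    ε * Q.fm v v + ‖Q.incl v - f‖ ^ 2 =
      ε * Q.fm (Q.resolvent ε f) (Q.resolvent ε f) + ‖Q.incl (Q.resolvent ε f) - f‖ ^ 2 +
      (ε * Q.fm (v - Q.resolvent ε f) (v - Q.resolvent ε f)
        + ‖Q.incl (v - Q.resolvent ε f)‖ ^ 2) := by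
  have h := resolvent_spec hε f (v - Q.resolvent ε f)
  set u := Q.resolvent ε f
  obtain ⟨d, rfl⟩ : ∃ d, v = u + d := ⟨v - u, by abel⟩
  rw [add_sub_cancel_left] at h ⊢
  -- With `v = u + d`, the terms linear in `d` cancel by the resolvent equation tested with `d`.
  have e : Q.incl (u + d) - f = Q.incl d + (Q.incl u - f) := by rw [map_add]; abel
  rw [e, norm_add_sq_real, inner_sub_right]
  simp only [fm_add_left, fm_add_right]
  rw [fm_comm Q u d]
  linear_combination (2 : ℝ) * h

/-- Uniqueness of the minimizer: the excess of `v` over the minimum dominates the squared distance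
from `v` to the resolvent. This is how contractions are later seen to fix a resolvent. -/
theorem eq_resolvent_of_le (hε : 0 < ε) (f : H) (v : Q.FormSpace)
    (h : ε * Q.fm v v + ‖Q.incl v - f‖ ^ 2 ≤
      ε * Q.fm (Q.resolvent ε f) (Q.resolvent ε f) + ‖Q.incl (Q.resolvent ε f) - f‖ ^ 2) :
    v = Q.resolvent ε f := by
  have h1 := resolvent_minimizes hε f v
  have h2 := Q.fm_nonneg (v - Q.resolvent ε f)
  have h3 : ‖Q.incl (v - Q.resolvent ε f)‖ ^ 2 ≤ 0 := by nlinarith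
  have h4 : Q.incl (v - Q.resolvent ε f) = 0 := by
    rw [← norm_eq_zero]
    exact pow_eq_zero_iff (two_ne_zero) |>.1 (le_antisymm h3 (by positivity))
  exact sub_eq_zero.1 (Q.incl_injective (h4.trans (map_zero _).symm))

/-- Bounds for the resolvent applied to elements of the form domain. -/
theorem resolvent_bounds (hε : 0 < ε) (f : Q.FormSpace) :
    Q.fm (Q.resolvent ε (Q.incl f)) (Q.resolvent ε (Q.incl f)) ≤ Q.fm f f ∧
      ‖Q.incl (Q.resolvent ε (Q.incl f)) - Q.incl f‖ ^ 2 ≤ ε * Q.fm f f := by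
  -- The competitor is `f` itself, for which the distance term is zero.
  have h := resolvent_minimizes hε (Q.incl f) f
  rw [sub_self, norm_zero] at h
  have h1 := Q.fm_nonneg (Q.resolvent ε (Q.incl f))
  have h2 := Q.fm_nonneg (f - Q.resolvent ε (Q.incl f))
  have h3 := mul_nonneg hε.le h1
  have h4 := mul_nonneg hε.le h2
  have h5 : 0 ≤ ‖Q.incl (Q.resolvent ε (Q.incl f)) - Q.incl f‖ ^ 2 := by positivity
  have h6 : 0 ≤ ‖Q.incl (f - Q.resolvent ε (Q.incl f))‖ ^ 2 := by positivity
  constructor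
  · refine le_of_mul_le_mul_left ?_ hε
    linarith
  · linarith

theorem norm_incl_resolvent_le (hε : 0 < ε) (f : H) : ‖Q.incl (Q.resolvent ε f)‖ ≤ ‖f‖ := by
  have h := resolvent_spec hε f (Q.resolvent ε f)
  have h1 := mul_nonneg hε.le (Q.fm_nonneg (Q.resolvent ε f))
  rw [real_inner_self_eq_norm_sq] at h
  have h2 := real_inner_le_norm (Q.incl (Q.resolvent ε f)) f
  have h3 := norm_nonneg (Q.incl (Q.resolvent ε f))
  have h4 := norm_nonneg f
  by_contra hlt
  push Not at hlt
  nlinarith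

/-- The pair `(J f, (f - J f)/ε)` belongs to the graph of the operator. -/
theorem resolvent_mem_generatorGraph (hε : 0 < ε) (f : H) :
    (Q.incl (Q.resolvent ε f), ε⁻¹ • (f - Q.incl (Q.resolvent ε f))) ∈ Q.generatorGraph := by
  refine ⟨Q.incl_mem _, fun g => ?_⟩
  have h := resolvent_spec hε f (Q.toDom.symm g)
  change Q.fm (Q.toDom.symm g) (Q.resolvent ε f) =
    inner ℝ (Q.incl (Q.toDom.symm g)) (ε⁻¹ • (f - Q.incl (Q.resolvent ε f)))
  rw [inner_smul_right, inner_sub_right, ← h]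
  field_simp
  ring

end resolvent

end SymmForm

/-- A bounded family in an inner product space which converges weakly against a total set converges
weakly. -/
theorem tendsto_inner_of_total {E ι : Type*} [NormedAddCommGroup E] [InnerProductSpace ℝ E]
    {S : Set E} (hS : (Submodule.span ℝ S).topologicalClosure = ⊤) {l : Filter ι} {u : ι → E}
    {a : E} {B : ℝ} (hB : ∀ i, ‖u i‖ ≤ B)
    (h : ∀ s ∈ S, Tendsto (fun i => inner ℝ (u i) s) l (𝓝 (inner ℝ a s))) (v : E) :
    Tendsto (fun i => inner ℝ (u i) v) l (𝓝 (inner ℝ a v)) := by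
  have hspan : ∀ s ∈ Submodule.span ℝ S,
      Tendsto (fun i => inner ℝ (u i) s) l (𝓝 (inner ℝ a s)) := by
    intro s hs
    induction hs using Submodule.span_induction with
    | mem x hx => exact h x hx
    | zero => simpa using tendsto_const_nhds
    | add x y _ _ hx hy => simpa only [inner_add_right] using hx.add hy
    | smul c x _ hx => simpa only [inner_smul_right] using hx.const_mul c
  have hv : v ∈ closure (Submodule.span ℝ S : Set E) := by
    rw [← Submodule.topologicalClosure_coe, hS]; trivial
  rw [Metric.tendsto_nhds]
  intro ε hε
  -- `K` bounds `‖u i - a‖`; the absolute value and the summand `1` keep it positive in all cases.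
  set K := |B| + ‖a‖ + 1
  have hK : 0 < K := by positivity
  obtain ⟨s, hs, hd⟩ := Metric.mem_closure_iff.1 hv (ε / (2 * K)) (by positivity)
  have h1 := Metric.tendsto_nhds.1 (hspan s hs) (ε / 2) (by positivity)
  filter_upwards [h1] with i hi
  rw [Real.dist_eq] at hi ⊢
  have e : inner ℝ (u i) v - inner ℝ a v
      = (inner ℝ (u i) s - inner ℝ a s) + (inner ℝ (u i - a) (v - s) : ℝ) := by
    rw [inner_sub_left, inner_sub_right, inner_sub_right]; ring
  have h2 : |(inner ℝ (u i - a) (v - s) : ℝ)| ≤ K * (ε / (2 * K)) := by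
    refine (abs_real_inner_le_norm _ _).trans (mul_le_mul ?_ ?_ (norm_nonneg _) hK.le)
    · have := hB i
      have := le_abs_self B
      have := norm_sub_le (u i) a
      linarith
    · rw [← dist_eq_norm]; exact hd.le
  have h3 : K * (ε / (2 * K)) = ε / 2 := by field_simp
  rw [e]
  refine (abs_add_le _ _).trans_lt ?_
  linarith

/-! ## Normal contractions of the line -/

namespace NormalContraction

theorem lipschitz_of_abs_le {C : ℝ → ℝ} (h : ∀ s t, |C s - C t| ≤ |s - t|) : LipschitzWith 1 C :=
  LipschitzWith.of_dist_le_mul fun s t => by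
    simpa [Real.dist_eq] using h s t

theorem abs_sub_le {C : ℝ → ℝ} (hC : LipschitzWith 1 C) (s t : ℝ) : |C s - C t| ≤ |s - t| := by
  simpa [Real.dist_eq] using hC.dist_le_mul s t

theorem abs_le {C : ℝ → ℝ} (hC : LipschitzWith 1 C) (h0 : C 0 = 0) (s : ℝ) : |C s| ≤ |s| := by
  simpa [h0] using abs_sub_le hC s 0

theorem abs : LipschitzWith 1 (fun t : ℝ => |t|) := lipschitz_of_abs_le fun _ _ => abs_abs_sub_abs_le _ _

/-- Truncation at the levels `-a` and `a`. -/
def clamp (a t : ℝ) : ℝ := max (-a) (min t a)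

theorem lipschitz_clamp (a : ℝ) : LipschitzWith 1 (clamp a) :=
  (LipschitzWith.id.min_const a).const_max (-a)

theorem clamp_zero {a : ℝ} (ha : 0 ≤ a) : clamp a 0 = 0 := by simp [clamp, ha]

theorem abs_clamp_le {a : ℝ} (ha : 0 ≤ a) (t : ℝ) : |clamp a t| ≤ a :=
  _root_.abs_le.2 ⟨le_max_left _ _, max_le (by linarith) (min_le_right _ _)⟩

theorem clamp_eq_self {a t : ℝ} (h : |t| ≤ a) : clamp a t = t := by
  obtain ⟨h1, h2⟩ := _root_.abs_le.1 h
  rw [clamp, min_eq_left h2, max_eq_right h1]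

/-- A truncation that stays strictly below its level has not acted; this transfers limits of
truncations back to the function. -/
theorem eq_clamp_of_abs_clamp_lt {a t : ℝ} (h : |clamp a t| < a) : clamp a t = t := by
  rw [clamp] at *
  rw [abs_lt] at h
  rcases le_total t a with h1 | h1
  · rw [min_eq_left h1] at *
    rcases le_total (-a) t with h2 | h2
    · rw [max_eq_right h2]
    · rw [max_eq_left h2] at h; linarith [h.1]
  · rw [min_eq_right h1] at *
    rcases le_total (-a) a with h2 | h2
    · rw [max_eq_right h2] at h; linarith [h.2]
    · rw [max_eq_left h2] at h; linarith [h.1]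

/-- The part of `t` exceeding the levels `-a` and `a`. -/
def excess (a t : ℝ) : ℝ := t - clamp a t

/-- Truncation is monotone and `1`-Lipschitz, so for `t ≤ s` the remainder increases by an amount
between `0` and `s - t`. -/
theorem lipschitz_excess (a : ℝ) : LipschitzWith 1 (excess a) := by
  refine lipschitz_of_abs_le fun s t => ?_
  wlog h : t ≤ s generalizing s t
  · rw [abs_sub_comm, abs_sub_comm s]; exact this t s (le_of_not_ge h)
  have h1 : clamp a t ≤ clamp a s := by unfold clamp; gcongr
  have h2 := abs_sub_le (lipschitz_clamp a) s t
  rw [abs_of_nonneg (by linarith), abs_of_nonneg (by linarith)] at h2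
  rw [abs_of_nonneg (by unfold excess; linarith), abs_of_nonneg (by linarith)]
  unfold excess
  linarith

theorem excess_zero {a : ℝ} (ha : 0 ≤ a) : excess a 0 = 0 := by simp [excess, clamp_zero ha]

theorem excess_eq_zero {a t : ℝ} (h : |t| ≤ a) : excess a t = 0 := by
  rw [excess, clamp_eq_self h, sub_self]

/-- The positive part of `t - a`. -/
def above (a t : ℝ) : ℝ := max (t - a) 0

theorem lipschitz_above (a : ℝ) : LipschitzWith 1 (above a) := by
  refine lipschitz_of_abs_le fun s t => ?_
  have := abs_max_sub_max_le_abs (s - a) (t - a) 0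
  unfold above
  refine this.trans (le_of_eq ?_)
  congr 1; ring

theorem above_zero {a : ℝ} (ha : 0 ≤ a) : above a 0 = 0 := by simp [above, ha]

/-- Truncation at the levels `0` and `a`. -/
def clampPos (a t : ℝ) : ℝ := max 0 (min t a)

theorem lipschitz_clampPos (a : ℝ) : LipschitzWith 1 (clampPos a) :=
  (LipschitzWith.id.min_const a).const_max 0

theorem clampPos_zero {a : ℝ} (ha : 0 ≤ a) : clampPos a 0 = 0 := by simp [clampPos, ha]

/-- The arctangent is an injective bounded normal contraction: it turns any function of finite
energy into a bounded one from which boundary values in `[-∞, ∞]` can be read off. -/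
theorem lipschitz_arctan : LipschitzWith 1 Real.arctan := by
  refine lipschitzWith_of_nnnorm_deriv_le Real.differentiable_arctan fun x => ?_
  rw [← NNReal.coe_le_coe, coe_nnnorm, Real.deriv_arctan, Real.norm_eq_abs, abs_of_nonneg (by positivity)]
  exact (div_le_one (by positivity)).2 (by nlinarith [sq_nonneg x])

end NormalContraction

/-! ## Square summable functions on a discrete measure space -/

section Lp

variable {X : Type*} [MeasurableSpace X] {m : Measure X} [IsDiscreteMeasure m]

namespace DiscreteL2

theorem ext {f g : Lp ℝ 2 m} (h : ∀ x, f x = g x) : f = g := Lp.ext (ae_of_all _ h)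

theorem add_apply (f g : Lp ℝ 2 m) (x : X) : (f + g) x = f x + g x :=
  forall_of_ae m (Lp.coeFn_add f g) x

theorem sub_apply (f g : Lp ℝ 2 m) (x : X) : (f - g) x = f x - g x :=
  forall_of_ae m (Lp.coeFn_sub f g) x

theorem smul_apply (a : ℝ) (f : Lp ℝ 2 m) (x : X) : (a • f) x = a * f x :=
  forall_of_ae m (Lp.coeFn_smul a f) x

theorem neg_apply (f : Lp ℝ 2 m) (x : X) : (-f) x = -f x := forall_of_ae m (Lp.coeFn_neg f) x

theorem zero_apply (x : X) : (0 : Lp ℝ 2 m) x = 0 := forall_of_ae m (Lp.coeFn_zero ℝ 2 m) x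

theorem comp_apply {C : ℝ → ℝ} (hC : LipschitzWith 1 C) (h0 : C 0 = 0) (f : Lp ℝ 2 m) (x : X) :
    hC.compLp h0 f x = C (f x) := forall_of_ae m (hC.coeFn_compLp h0 f) x

theorem sum_apply {ι : Type*} (s : Finset ι) (f : ι → Lp ℝ 2 m) (x : X) :
    (∑ i ∈ s, f i) x = ∑ i ∈ s, f i x := by
  classical
  induction s using Finset.induction_on with
  | empty => rw [Finset.sum_empty, Finset.sum_empty]; exact DiscreteL2.zero_apply x
  | insert a s ha ih => rw [Finset.sum_insert ha, Finset.sum_insert ha, add_apply, ih]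

theorem mass_pos (x : X) : 0 < m.real {x} :=
  ENNReal.toReal_pos (IsDiscreteMeasure.pos x).ne' (IsDiscreteMeasure.lt_top x).ne

variable [Countable X] [DiscreteMeasurableSpace X]

/-- On a countable discrete space `m` is the sum of its weighted Dirac measures, which turns the
integral into a series. -/
theorem hasSum_inner (f g : Lp ℝ 2 m) :
    HasSum (fun x => m.real {x} * f x * g x) (inner ℝ f g) := by
  rw [L2.inner_def]
  have hi := L2.integrable_inner (𝕜 := ℝ) f g
  have h : Integrable (fun x => (inner ℝ (f x) (g x) : ℝ))
    (Measure.sum fun x => m {x} • Measure.dirac x) := by rwa [Measure.sum_smul_dirac]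
  have h2 := hasSum_integral_measure h
  rw [Measure.sum_smul_dirac] at h2
  have e : (fun x => m.real {x} * f x * g x) =
      fun x => ∫ y, (inner ℝ (f y) (g y) : ℝ) ∂(m {x} • Measure.dirac x) := by
    funext x
    rw [integral_smul_measure, integral_dirac, smul_eq_mul, measureReal_def]
    simp only [RCLike.inner_apply, conj_trivial]
    ring
  rw [e]
  exact h2

theorem hasSum_norm_sq (f : Lp ℝ 2 m) : HasSum (fun x => m.real {x} * f x ^ 2) (‖f‖ ^ 2) := by
  rw [← real_inner_self_eq_norm_sq]
  simpa only [pow_two, mul_assoc] using hasSum_inner f f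

theorem mass_mul_sq_le (f : Lp ℝ 2 m) (x : X) : m.real {x} * f x ^ 2 ≤ ‖f‖ ^ 2 := by
  have h := (hasSum_norm_sq f)
  rw [← h.tsum_eq]
  exact h.summable.le_tsum x fun y _ => mul_nonneg (mass_pos y).le (sq_nonneg _)

theorem norm_le_of_abs_le {f g : Lp ℝ 2 m} (h : ∀ x, |f x| ≤ |g x|) : ‖f‖ ≤ ‖g‖ := by
  refine le_of_sq_le_sq (hasSum_le (fun x => ?_) (hasSum_norm_sq f) (hasSum_norm_sq g)) (norm_nonneg _)
  exact mul_le_mul_of_nonneg_left (sq_le_sq.2 (h x)) (mass_pos x).le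

theorem exists_of_abs_le (f : Lp ℝ 2 m) (g : X → ℝ) (c : ℝ) (h : ∀ x, |g x| ≤ c * |f x|) :
    ∃ G : Lp ℝ 2 m, ∀ x, G x = g x := by
  have hg : MemLp g 2 m := (Lp.memLp f).of_le_mul
    (measurable_of_countable g).aestronglyMeasurable (ae_of_all _ h)
  exact ⟨hg.toLp g, forall_of_ae m hg.coeFn_toLp⟩

/-- Convergence in `ℓ²` implies pointwise convergence. -/
theorem tendsto_apply {ι : Type*} {l : Filter ι} {u : ι → Lp ℝ 2 m} {f : Lp ℝ 2 m}
    (h : Tendsto u l (𝓝 f)) (x : X) : Tendsto (fun i => u i x) l (𝓝 (f x)) := by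
  rw [tendsto_iff_norm_sub_tendsto_zero] at h ⊢
  have h2 : Tendsto (fun i => ‖u i - f‖ / Real.sqrt (m.real {x})) l (𝓝 0) := by
    simpa using h.div_const (Real.sqrt (m.real {x}))
  refine squeeze_zero (fun _ => norm_nonneg _) (fun i => ?_) h2
  rw [le_div_iff₀ (Real.sqrt_pos.2 (mass_pos x)), Real.norm_eq_abs]
  refine le_of_sq_le_sq ?_ (norm_nonneg _)
  rw [mul_pow, Real.sq_sqrt (mass_pos x).le, sq_abs, ← sub_apply, mul_comm]
  exact mass_mul_sq_le _ x

/-! ### Indicators of points and restrictions to finite sets -/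

section single

open Classical in
/-- The indicator function of a point. -/
def single (m : Measure X) [IsDiscreteMeasure m] (x : X) : Lp ℝ 2 m :=
  indicatorConstLp 2 (measurableSet_singleton x) (IsDiscreteMeasure.lt_top x).ne 1

theorem single_self (x : X) : single m x x = 1 :=
  forall_of_ae m (indicatorConstLp_coeFn_mem (hs := measurableSet_singleton x)) x rfl

theorem single_of_ne {x y : X} (h : y ≠ x) : single m x y = 0 :=
  forall_of_ae m (indicatorConstLp_coeFn_notMem (hs := measurableSet_singleton x)) y (by simpa using h)

theorem inner_single (x : X) (f : Lp ℝ 2 m) : inner ℝ (single m x) f = m.real {x} * f x := by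
  refine (hasSum_inner (single m x) f).unique ?_
  convert hasSum_single x (fun y hy => ?_) using 1
  · rw [single_self, mul_one]
  · rw [single_of_ne hy]; ring

theorem single_mem_finSupp (x : X) : single m x ∈ finSupp m := by
  refine (Set.finite_singleton x).subset fun y hy => ?_
  by_contra h
  exact hy (single_of_ne h)

/-- The restriction of a function to a finite set. -/
def cut (K : Finset X) (f : Lp ℝ 2 m) : Lp ℝ 2 m := ∑ x ∈ K, f x • single m x

theorem cut_apply_of_mem {K : Finset X} {x : X} (hx : x ∈ K) (f : Lp ℝ 2 m) : cut K f x = f x := by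
  rw [cut, sum_apply, Finset.sum_eq_single x]
  · rw [smul_apply, single_self, mul_one]
  · intro y _ hy
    rw [smul_apply, single_of_ne hy.symm, mul_zero]
  · intro h; exact absurd hx h

theorem cut_apply_of_notMem {K : Finset X} {x : X} (hx : x ∉ K) (f : Lp ℝ 2 m) : cut K f x = 0 := by
  rw [cut, sum_apply]
  refine Finset.sum_eq_zero fun y hy => ?_
  rw [smul_apply, single_of_ne (ne_of_mem_of_not_mem hy hx).symm, mul_zero]

theorem cut_mem_finSupp (K : Finset X) (f : Lp ℝ 2 m) : cut K f ∈ finSupp m :=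
  Submodule.sum_mem _ fun x _ => Submodule.smul_mem _ _ (single_mem_finSupp x)

theorem exists_eq_cut {f : Lp ℝ 2 m} (hf : f ∈ finSupp m) : ∃ K, ∀ K', K ⊆ K' → f = cut K' f := by
  have hf' : (Function.support (toFunₗ m f)).Finite := hf
  refine ⟨hf'.toFinset, fun K' h => ext fun x => ?_⟩
  by_cases hx : x ∈ K'
  · rw [cut_apply_of_mem hx]
  · rw [cut_apply_of_notMem hx]
    by_contra h0
    exact hx (h (hf'.mem_toFinset.2 h0))

/-- By Pythagoras the squared error is `‖f‖²` minus the partial sum of the norm series over `K`. -/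
theorem tendsto_cut (f : Lp ℝ 2 m) : Tendsto (fun K => cut K f) atTop (𝓝 f) := by
  rw [tendsto_iff_norm_sub_tendsto_zero]
  have h1 : ∀ K, ‖cut K f - f‖ ^ 2 = ‖f‖ ^ 2 - ∑ x ∈ K, m.real {x} * f x ^ 2 := by
    intro K
    have h2 : inner ℝ (cut K f) f = ∑ x ∈ K, m.real {x} * f x ^ 2 := by
      rw [cut, sum_inner]
      refine Finset.sum_congr rfl fun x _ => ?_
      rw [inner_smul_left, inner_single]; simp; ring
    have h3 : inner ℝ (cut K f) (cut K f) = ∑ x ∈ K, m.real {x} * f x ^ 2 := by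
      nth_rw 1 [cut]
      rw [sum_inner]
      refine Finset.sum_congr rfl fun x hx => ?_
      rw [inner_smul_left, inner_single, cut_apply_of_mem hx]; simp; ring
    rw [norm_sub_sq_real, ← real_inner_self_eq_norm_sq, h2, h3]
    ring
  have h4 : Tendsto (fun K => ‖cut K f - f‖ ^ 2) atTop (𝓝 0) := by
    simp only [h1]
    have h6 := (tendsto_const_nhds (x := ‖f‖ ^ 2)).sub (hasSum_norm_sq f)
    rwa [sub_self] at h6
  have h5 := h4.sqrt
  simpa [Real.sqrt_sq] using h5

theorem dense_finSupp : Dense (finSupp m : Set (Lp ℝ 2 m)) := fun f =>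
  mem_closure_of_tendsto (tendsto_cut f) (Eventually.of_forall fun K => cut_mem_finSupp K f)

end single

end DiscreteL2

/-! ## Forms on `ℓ²` -/

namespace SymmForm

open DiscreteL2

variable [Countable X] [DiscreteMeasurableSpace X] (Q : SymmForm (Lp ℝ 2 m))

theorem formSpace_ext {f g : Q.FormSpace} (h : ∀ x, Q.incl f x = Q.incl g x) : f = g :=
  Q.incl_injective (DiscreteL2.ext h)

variable {Q} [CompleteSpace Q.FormSpace]

/-- Bounded families in the form space which converge pointwise converge weakly. -/
theorem tendsto_inner_of_pointwise {ι : Type*} {l : Filter ι} {u : ι → Q.FormSpace}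
    {a : Q.FormSpace} {B : ℝ} (hB : ∀ i, ‖u i‖ ≤ B)
    (h : ∀ x, Tendsto (fun i => Q.incl (u i) x) l (𝓝 (Q.incl a x))) (v : Q.FormSpace) :
    Tendsto (fun i => inner ℝ (u i) v) l (𝓝 (inner ℝ a v)) := by
  -- Point evaluations are continuous on the form space, represented up to the factor `m(x)` by the
  -- adjoint of the inclusion. They separate points, so their representers are total.
  have key : ∀ (f : Q.FormSpace) (x : X),
      inner ℝ f (ContinuousLinearMap.adjoint Q.incl (single m x)) = m.real {x} * Q.incl f x := by
    intro f x
    rw [ContinuousLinearMap.adjoint_inner_right, real_inner_comm, inner_single]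
  refine tendsto_inner_of_total
    (S := range fun x => ContinuousLinearMap.adjoint Q.incl (single m x)) ?_ hB ?_ v
  · rw [Submodule.topologicalClosure_eq_top_iff, Submodule.eq_bot_iff]
    intro f hf
    refine formSpace_ext Q fun x => ?_
    have h1 := (Submodule.mem_orthogonal' _ _).1 hf _ (Submodule.subset_span ⟨x, rfl⟩)
    rw [key] at h1
    rw [map_zero, DiscreteL2.zero_apply]
    exact (mul_eq_zero.1 h1).resolve_left (mass_pos x).ne'
  · rintro _ ⟨x, rfl⟩
    simp only [key]
    exact (h x).const_mul _

/-- Closed subspaces of the form space are stable under bounded pointwise convergence. -/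
theorem mem_of_pointwise {W : Submodule ℝ Q.FormSpace} (hW : IsClosed (W : Set Q.FormSpace))
    {ι : Type*} {l : Filter ι} [l.NeBot] {u : ι → Q.FormSpace} {a : Q.FormSpace} {B : ℝ}
    (hB : ∀ i, ‖u i‖ ≤ B) (hu : ∀ i, u i ∈ W)
    (h : ∀ x, Tendsto (fun i => Q.incl (u i) x) l (𝓝 (Q.incl a x))) : a ∈ W := by
  -- Weak limits stay in the double orthogonal complement, which is the closure of `W`.
  have h1 : a ∈ Wᗮᗮ := by
    rw [Submodule.mem_orthogonal']
    intro v hv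
    refine tendsto_nhds_unique (tendsto_inner_of_pointwise hB h v) ?_
    have : ∀ i, inner ℝ (u i) v = 0 := fun i => (Submodule.mem_orthogonal _ _).1 hv _ (hu i)
    simp only [this]
    exact tendsto_const_nhds
  rw [Submodule.orthogonal_orthogonal_eq_closure] at h1
  rwa [hW.submodule_topologicalClosure_eq] at h1

end SymmForm

end Lp

/-! ## Markovian forms -/

namespace SymmForm

variable {Y : Type*} [MeasurableSpace Y] {μ : Measure Y} {Q : SymmForm (Lp ℝ 2 μ)}
  (hQ : MarkovianOn Q.dom fun f => (Q.val f).toReal) {C : ℝ → ℝ}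
  (hC : LipschitzWith 1 C) (h0 : C 0 = 0)

/-- The action of a normal contraction on the form space of a Markovian form. -/
def contr (f : Q.FormSpace) : Q.FormSpace := Q.ofMem (hQ C hC h0 _ (Q.incl_mem f)).1

theorem incl_contr (f : Q.FormSpace) : Q.incl (contr hQ hC h0 f) = hC.compLp h0 (Q.incl f) := rfl

theorem fm_contr_le (f : Q.FormSpace) : Q.fm (contr hQ hC h0 f) (contr hQ hC h0 f) ≤ Q.fm f f := by
  have h := (hQ C hC h0 _ (Q.incl_mem f)).2
  simp only [← incl_contr hQ] at h
  rwa [toReal_val_incl, toReal_val_incl] at h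

theorem norm_contr_le (f : Q.FormSpace) : ‖contr hQ hC h0 f‖ ≤ ‖f‖ := by
  refine le_of_sq_le_sq ?_ (norm_nonneg _)
  rw [norm_sq_eq, norm_sq_eq]
  refine add_le_add (fm_contr_le hQ hC h0 f) ?_
  have h := hC.norm_compLp_le h0 (Q.incl f)
  rw [← incl_contr hQ] at h
  gcongr
  simpa using h

theorem contr_apply {X : Type*} [MeasurableSpace X] {m : Measure X} [IsDiscreteMeasure m]
    {Q : SymmForm (Lp ℝ 2 m)} (hQ : MarkovianOn Q.dom fun f => (Q.val f).toReal)
    (f : Q.FormSpace) (x : X) : Q.incl (contr hQ hC h0 f) x = C (Q.incl f x) := by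
  rw [incl_contr, DiscreteL2.comp_apply]

end SymmForm

/-! ## The Neumann form -/

namespace WGraph

variable {X : Type*} (G : WGraph X)

/-- The weights of edges and vertices in the energy. -/
def weight : (X × X) ⊕ X → ℝ := Sum.elim (fun p => G.b p.1 p.2 / 2) fun x => G.c x

/-- The differences along edges and the values at vertices of a function. -/
def grad (f : X → ℝ) : (X × X) ⊕ X → ℝ := Sum.elim (fun p => f p.1 - f p.2) f

theorem weight_nonneg (i : (X × X) ⊕ X) : 0 ≤ G.weight i := by
  rcases i with p | x
  · exact div_nonneg (NNReal.coe_nonneg _) two_pos.le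
  · exact NNReal.coe_nonneg _

theorem mem_finiteEnergy_iff (f : X → ℝ) :
    f ∈ G.finiteEnergy ↔ Summable fun i => G.weight i * grad f i ^ 2 := by
  rw [show f ∈ G.finiteEnergy ↔ G.energy f ≠ ∞ from Iff.rfl, energy_ne_top_iff]
  constructor
  · rintro ⟨h1, h2⟩
    refine (HasSum.sum (f := fun i => G.weight i * grad f i ^ 2)
      ((h1.mul_left (1 / 2)).congr fun p => ?_).hasSum h2.hasSum).summable
    simp only [weight, grad, Function.comp_apply, Sum.elim_inl]
    ring
  · intro h
    refine ⟨((h.comp_injective Sum.inl_injective).mul_left 2).congr fun p => ?_,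
      h.comp_injective Sum.inr_injective⟩
    simp only [weight, grad, Function.comp_apply, Sum.elim_inl]
    ring

theorem hasSum_energyForm (f g : G.finiteEnergy) :
    HasSum (fun i => G.weight i * grad f.1 i * grad g.1 i) (G.energyForm f g) := by
  have h1 := ((G.summable_edge f g).hasSum.mul_left (1 / 2))
  have h2 := (G.summable_vertex f g).hasSum
  refine HasSum.sum (f := fun i => G.weight i * grad f.1 i * grad g.1 i) ?_ h2
  refine (congrArg (fun F => HasSum F _) (funext fun p => ?_)).mp h1
  simp only [weight, grad, Function.comp_apply, Sum.elim_inl]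
  ring

variable [MeasurableSpace X] {m : Measure X} [IsDiscreteMeasure m]

variable (m) in
/-- The form space of the Neumann form. -/
abbrev NSpace : Type _ := (G.neumann m).FormSpace

variable {G}

theorem hasSum_fm (f g : G.NSpace m) : HasSum
    (fun i => G.weight i * grad ((G.neumann m).incl f) i * grad ((G.neumann m).incl g) i)
    ((G.neumann m).fm f g) :=
  G.hasSum_energyForm ⟨_, (G.neumann m).incl_mem f⟩ ⟨_, (G.neumann m).incl_mem g⟩

theorem hasSum_fm_self (f : G.NSpace m) : HasSum
    (fun i => G.weight i * grad ((G.neumann m).incl f) i ^ 2) ((G.neumann m).fm f f) := by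
  simpa only [pow_two, mul_assoc] using hasSum_fm f f

theorem mem_neumann_iff (f : Lp ℝ 2 m) :
    f ∈ (G.neumann m).dom ↔ Summable fun i => G.weight i * grad f i ^ 2 :=
  G.mem_finiteEnergy_iff f

theorem tendsto_grad {ι : Type*} {l : Filter ι} {u : ι → X → ℝ} {f : X → ℝ}
    (h : ∀ x, Tendsto (fun i => u i x) l (𝓝 (f x))) (k : (X × X) ⊕ X) :
    Tendsto (fun i => grad (u i) k) l (𝓝 (grad f k)) := by
  rcases k with p | x
  · exact (h p.1).sub (h p.2)
  · exact h x

theorem abs_grad_comp_le {C : ℝ → ℝ} (hC : LipschitzWith 1 C) (h0 : C 0 = 0) (f : X → ℝ)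
    (i : (X × X) ⊕ X) : |grad (fun x => C (f x)) i| ≤ |grad f i| := by
  rcases i with p | x
  · exact NormalContraction.abs_sub_le hC _ _
  · exact NormalContraction.abs_le hC h0 _

/-- Lower semicontinuity of the energy. -/
theorem mem_neumann_of_tendsto {ι : Type*} {l : Filter ι} [l.NeBot] {u : ι → G.NSpace m}
    {f : Lp ℝ 2 m} {B : ℝ} (hB : ∀ᶠ i in l, (G.neumann m).fm (u i) (u i) ≤ B)
    (h : ∀ x, Tendsto (fun i => (G.neumann m).incl (u i) x) l (𝓝 (f x))) :
    ∃ hf : f ∈ (G.neumann m).dom,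
      (G.neumann m).fm ((G.neumann m).ofMem hf) ((G.neumann m).ofMem hf) ≤ B := by
  -- Finite partial sums of the energy are continuous under pointwise convergence, so the bound
  -- passes to them and then to the whole series.
  have hs : ∀ s : Finset ((X × X) ⊕ X), ∑ i ∈ s, G.weight i * grad f i ^ 2 ≤ B := by
    intro s
    have ht : Tendsto (fun i => ∑ k ∈ s, G.weight k * grad ((G.neumann m).incl (u i)) k ^ 2) l
        (𝓝 (∑ k ∈ s, G.weight k * grad f k ^ 2)) :=
      tendsto_finsetSum _ fun k _ => ((tendsto_grad h k).pow 2).const_mul _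
    refine le_of_tendsto ht (hB.mono fun i hi => le_trans ?_ hi)
    exact sum_le_hasSum s (fun k _ => mul_nonneg (G.weight_nonneg k) (sq_nonneg _))
      (hasSum_fm_self (u i))
  have hsum : Summable fun i => G.weight i * grad f i ^ 2 :=
    summable_of_sum_le (fun k => mul_nonneg (G.weight_nonneg k) (sq_nonneg _)) hs
  refine ⟨(mem_neumann_iff f).2 hsum, ?_⟩
  exact hasSum_le_of_sum_le (hasSum_fm_self ((G.neumann m).ofMem ((mem_neumann_iff f).2 hsum))) hs

variable [Countable X] [DiscreteMeasurableSpace X]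

/-- A Cauchy sequence converges in `ℓ²`, hence pointwise; lower semicontinuity of the energy,
applied to `u n - u k` as `k → ∞`, then controls the energy of `u n - f`. -/
instance : CompleteSpace (G.NSpace m) := by
  refine Metric.complete_of_cauchySeq_tendsto fun u hu => ?_
  have hu' : CauchySeq fun n => (G.neumann m).incl (u n) :=
    hu.map (G.neumann m).incl.uniformContinuous
  obtain ⟨f, hf⟩ := cauchySeq_tendsto_of_complete hu'
  have key : ∀ ε > 0, ∃ N, ∀ n ≥ N, ∃ h : (G.neumann m).incl (u n) - f ∈ (G.neumann m).dom,
      (G.neumann m).fm ((G.neumann m).ofMem h) ((G.neumann m).ofMem h) ≤ ε ^ 2 := by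
    intro ε hε
    obtain ⟨N, hN⟩ := Metric.cauchySeq_iff.1 hu ε hε
    refine ⟨N, fun n hn => ?_⟩
    refine mem_neumann_of_tendsto (l := atTop) (u := fun k => u n - u k) ?_ fun x => ?_
    · filter_upwards [eventually_ge_atTop N] with k hk
      have h1 := hN n hn k hk
      rw [dist_eq_norm] at h1
      have h2 := (G.neumann m).norm_sq_eq (u n - u k)
      nlinarith [norm_nonneg (u n - u k), sq_nonneg ‖(G.neumann m).incl (u n - u k)‖]
    · simp only [map_sub, DiscreteL2.sub_apply]
      exact tendsto_const_nhds.sub (DiscreteL2.tendsto_apply hf x)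
  have hfd : f ∈ (G.neumann m).dom := by
    obtain ⟨N, hN⟩ := key 1 one_pos
    obtain ⟨h, -⟩ := hN N le_rfl
    simpa using (G.neumann m).dom.sub_mem ((G.neumann m).incl_mem (u N)) h
  refine ⟨(G.neumann m).ofMem hfd, ?_⟩
  rw [tendsto_iff_norm_sub_tendsto_zero]
  have h0 : Tendsto (fun n => ‖u n - (G.neumann m).ofMem hfd‖ ^ 2) atTop (𝓝 0) := by
    simp only [SymmForm.norm_sq_eq]
    rw [← add_zero (0 : ℝ)]
    refine Tendsto.add ?_ ?_
    · rw [Metric.tendsto_atTop]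
      intro ε hε
      obtain ⟨N, hN⟩ := key (Real.sqrt (ε / 2)) (by positivity)
      refine ⟨N, fun n hn => ?_⟩
      obtain ⟨h, h'⟩ := hN n hn
      rw [Real.sq_sqrt (by positivity)] at h'
      rw [Real.dist_eq, sub_zero, abs_of_nonneg (SymmForm.fm_nonneg _ _)]
      exact lt_of_le_of_lt h' (by linarith)
    · have := (tendsto_iff_norm_sub_tendsto_zero.1 hf).pow 2
      simpa using this
  simpa [Real.sqrt_sq] using h0.sqrt

variable (G m)

theorem markovianOn_neumann :
    MarkovianOn (G.neumann m).dom fun f => ((G.neumann m).val f).toReal := by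
  intro C hC h0 f hf
  have e : (hC.compLp h0 f : X → ℝ) = fun x => C (f x) :=
    funext fun x => DiscreteL2.comp_apply hC h0 f x
  have hle : ∀ i, G.weight i * grad (hC.compLp h0 f) i ^ 2 ≤ G.weight i * grad f i ^ 2 := fun i =>
    mul_le_mul_of_nonneg_left (sq_le_sq.2 (e ▸ abs_grad_comp_le hC h0 f i)) (G.weight_nonneg i)
  have hmem : hC.compLp h0 f ∈ (G.neumann m).dom := by
    rw [mem_neumann_iff] at hf ⊢
    exact Summable.of_nonneg_of_le (fun i => mul_nonneg (G.weight_nonneg i) (sq_nonneg _)) hle hf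
  refine ⟨hmem, ?_⟩
  simp only [SymmForm.toReal_val _ hmem, SymmForm.toReal_val _ hf]
  exact hasSum_le hle (hasSum_fm_self ((G.neumann m).ofMem hmem))
    (hasSum_fm_self ((G.neumann m).ofMem hf))

/-- The action of a normal contraction on the form space of the Neumann form. -/
abbrev ncontr {C : ℝ → ℝ} (hC : LipschitzWith 1 C) (h0 : C 0 = 0) (f : G.NSpace m) : G.NSpace m :=
  SymmForm.contr (G.markovianOn_neumann m) hC h0 f

variable {G m}

theorem ncontr_apply {C : ℝ → ℝ} (hC : LipschitzWith 1 C) (h0 : C 0 = 0) (f : G.NSpace m) (x : X) :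
    (G.neumann m).incl (G.ncontr m hC h0 f) x = C ((G.neumann m).incl f x) :=
  SymmForm.contr_apply hC h0 _ f x

theorem norm_ncontr_le {C : ℝ → ℝ} (hC : LipschitzWith 1 C) (h0 : C 0 = 0) (f : G.NSpace m) :
    ‖G.ncontr m hC h0 f‖ ≤ ‖f‖ := SymmForm.norm_contr_le _ hC h0 f

/-- Products of bounded functions in the form domain. -/
theorem exists_mul {f g : G.NSpace m} {A B : ℝ} (hf : ∀ x, |(G.neumann m).incl f x| ≤ A)
    (hg : ∀ x, |(G.neumann m).incl g x| ≤ B) : ∃ k : G.NSpace m, ∀ x,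
      (G.neumann m).incl k x = (G.neumann m).incl f x * (G.neumann m).incl g x := by
  obtain ⟨k, hk⟩ := DiscreteL2.exists_of_abs_le ((G.neumann m).incl g)
    (fun x => (G.neumann m).incl f x * (G.neumann m).incl g x) A fun x => by
      rw [abs_mul]; exact mul_le_mul_of_nonneg_right (hf x) (abs_nonneg _)
  have hmem : k ∈ (G.neumann m).dom := by
    have h1 := (mem_neumann_iff _).1 ((G.neumann m).incl_mem f)
    have h2 := (mem_neumann_iff _).1 ((G.neumann m).incl_mem g)
    rw [mem_neumann_iff]
    refine Summable.of_nonneg_of_le (fun i => mul_nonneg (G.weight_nonneg i) (sq_nonneg _))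
      (fun i => ?_) ((h1.mul_left (2 * B ^ 2)).add (h2.mul_left (2 * A ^ 2)))
    have e : (k : X → ℝ) = fun x => (G.neumann m).incl f x * (G.neumann m).incl g x := funext hk
    have hw := G.weight_nonneg i
    have hfA : ∀ x, (G.neumann m).incl f x ^ 2 ≤ A ^ 2 := fun x => by
      rw [← sq_abs]; gcongr; exact hf x
    have hgB : ∀ x, (G.neumann m).incl g x ^ 2 ≤ B ^ 2 := fun x => by
      rw [← sq_abs]; gcongr; exact hg x
    rw [e, show ∀ a b c d e : ℝ, a * (b * c) + d * (b * e) = b * (a * c + d * e) by intros; ring]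
    refine mul_le_mul_of_nonneg_left ?_ hw
    rcases i with p | x
    · simp only [grad, Sum.elim_inl]
      set s := (G.neumann m).incl f p.1
      set t := (G.neumann m).incl f p.2
      set s' := (G.neumann m).incl g p.1
      set t' := (G.neumann m).incl g p.2
      -- Discrete Leibniz rule: `s s' - t t' = s (s' - t') + t' (s - t)`.
      have h3 : (s * s' - t * t') ^ 2 ≤ 2 * (s ^ 2 * (s' - t') ^ 2) + 2 * (t' ^ 2 * (s - t) ^ 2) := by
        nlinarith [sq_nonneg (s * (s' - t') - t' * (s - t))]
      have h4 := mul_le_mul_of_nonneg_right (hfA p.1) (sq_nonneg (s' - t'))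
      have h5 := mul_le_mul_of_nonneg_right (hgB p.2) (sq_nonneg (s - t))
      linarith
    · simp only [grad, Sum.elim_inr]
      have h4 := mul_le_mul_of_nonneg_right (hfA x) (sq_nonneg ((G.neumann m).incl g x))
      have h5 := mul_nonneg (sq_nonneg B) (sq_nonneg ((G.neumann m).incl f x))
      have h6 := mul_nonneg (sq_nonneg A) (sq_nonneg ((G.neumann m).incl g x))
      nlinarith
  exact ⟨(G.neumann m).ofMem hmem, hk⟩

/-! ### Green's formula -/

theorem summable_row (x : X) : Summable fun y => (G.b x y : ℝ) := NNReal.summable_coe.2 (G.summable x)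

theorem hasSum_fst {F : X × X → ℝ} {x : X} (h : ∀ p : X × X, p.1 ≠ x → F p = 0) {a : ℝ} :
    HasSum (fun y => F (x, y)) a ↔ HasSum F a :=
  (Prod.mk_right_injective x).hasSum_iff fun p hp => h p fun h' => hp ⟨p.2, by rw [← h']⟩

theorem hasSum_snd {F : X × X → ℝ} {x : X} (h : ∀ p : X × X, p.2 ≠ x → F p = 0) {a : ℝ} :
    HasSum (fun y => F (y, x)) a ↔ HasSum F a :=
  (Prod.mk_left_injective x).hasSum_iff fun p hp => h p fun h' => hp ⟨p.1, by rw [← h']⟩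

theorem summable_of_mem_laplacianDomain {f : X → ℝ} (hf : f ∈ G.laplacianDomain) (x : X) :
    Summable fun y => (G.b x y : ℝ) * (f x - f y) := by
  refine Summable.of_norm_bounded (((summable_row (G := G) x).mul_right |f x|).add (hf x)) fun y => ?_
  rw [Real.norm_eq_abs, abs_mul, NNReal.abs_eq, ← mul_add]
  exact mul_le_mul_of_nonneg_left (abs_sub _ _) (NNReal.coe_nonneg _)

theorem mem_laplacianDomain_of_bounded {f : X → ℝ} {B : ℝ} (hf : ∀ x, |f x| ≤ B) :
    f ∈ G.laplacianDomain := fun x =>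
  Summable.of_nonneg_of_le (fun y => by positivity)
    (fun y => mul_le_mul_of_nonneg_left (hf y) (NNReal.coe_nonneg _)) ((summable_row x).mul_right B)

/-- `|f y| ≤ |f x| + 1 + (f x - f y)²`: the constant part is summable against a row of `b`, the
square by finiteness of the energy. -/
theorem mem_laplacianDomain {f : Lp ℝ 2 m} (hf : f ∈ (G.neumann m).dom) :
    (f : X → ℝ) ∈ G.laplacianDomain := by
  intro x
  have h1 := ((G.energy_ne_top_iff _).1 hf).1.comp_injective (Prod.mk_right_injective x)
  refine Summable.of_nonneg_of_le (fun y => by positivity) (fun y => ?_)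
    (((summable_row (G := G) x).mul_right (|f x| + 1)).add h1)
  have hb := (G.b x y).coe_nonneg
  have h2 : |f y| ≤ |f x| + 1 + (f x - f y) ^ 2 := by
    have h3 : |f y| ≤ |f x| + |f x - f y| := by
      have := abs_sub_abs_le_abs_sub (f y) (f x)
      rw [abs_sub_comm] at this; linarith
    nlinarith [sq_abs (f x - f y), sq_nonneg (|f x - f y| - 1)]
  calc (G.b x y : ℝ) * |f y| ≤ G.b x y * (|f x| + 1 + (f x - f y) ^ 2) :=
        mul_le_mul_of_nonneg_left h2 hb
    _ = _ := by rw [mul_add]; rfl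

theorem mass_mul_laplacian (f : X → ℝ) (x : X) :
    m.real {x} * G.laplacian m f x = ∑' y, (G.b x y : ℝ) * (f x - f y) + G.c x * f x := by
  rw [laplacian]
  field_simp [(DiscreteL2.mass_pos (m := m) x).ne']

/-- Green's formula against an indicator. Each edge at `x` occurs as `(x, y)` and as `(y, x)`, which
cancels the factor `1/2` in the weights. -/
theorem single_hasSum {f : X → ℝ} (hf : f ∈ G.laplacianDomain) (x : X) :
    HasSum (fun i => G.weight i * grad (DiscreteL2.single m x) i * grad f i)
      (m.real {x} * G.laplacian m f x) := by
  classical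
  rw [mass_mul_laplacian]
  refine HasSum.sum (f := fun i => G.weight i * grad (DiscreteL2.single m x) i * grad f i) ?_ ?_
  · have h := (summable_of_mem_laplacianDomain hf x).hasSum
    set S := ∑' y, (G.b x y : ℝ) * (f x - f y)
    have h1 : HasSum (fun p : X × X => G.b p.1 p.2 * DiscreteL2.single m x p.1 * (f p.1 - f p.2)) S := by
      rw [← hasSum_fst (x := x)]
      · simpa only [DiscreteL2.single_self, mul_one] using h
      · intro p hp; rw [DiscreteL2.single_of_ne hp]; ring
    have h2 : HasSum (fun p : X × X => G.b p.1 p.2 * DiscreteL2.single m x p.2 * (f p.2 - f p.1)) S := by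
      rw [← hasSum_snd (x := x)]
      · simp only [DiscreteL2.single_self, mul_one, G.symm _ x]
        exact h
      · intro p hp; rw [DiscreteL2.single_of_ne hp]; ring
    have h3 := (h1.add h2).mul_left (1 / 2)
    rw [show 1 / 2 * (S + S) = S by ring] at h3
    refine (congrArg (fun F => HasSum F S) (funext fun p => ?_)).mp h3
    simp only [weight, grad, Function.comp_apply, Sum.elim_inl]
    ring
  · have h := hasSum_single (f := fun y => G.c y * DiscreteL2.single m x y * f y) x fun y hy => by
      rw [DiscreteL2.single_of_ne hy]; ring
    simp only [DiscreteL2.single_self, mul_one] at h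
    exact h

theorem single_mem_neumann (x : X) : DiscreteL2.single m x ∈ (G.neumann m).dom := by
  rw [mem_neumann_iff]
  have hb : ∀ y, |(DiscreteL2.single m x : X → ℝ) y| ≤ 1 := fun y => by
    by_cases h : y = x
    · rw [h, DiscreteL2.single_self]; simp
    · rw [DiscreteL2.single_of_ne h]; simp
  -- Green's formula with the indicator in both slots: its series is the energy of the indicator.
  have := (single_hasSum (m := m) (G := G) (mem_laplacianDomain_of_bounded hb) x).summable
  exact this.congr fun i => by ring

theorem finSupp_le_neumann : finSupp m ≤ (G.neumann m).dom := by
  intro f hf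
  obtain ⟨K, hK⟩ := DiscreteL2.exists_eq_cut hf
  rw [hK K subset_rfl]
  exact Submodule.sum_mem _ fun x _ => Submodule.smul_mem _ _ (single_mem_neumann x)

variable (G m) in
/-- The indicator function of a point in the form space. -/
def nsingle (x : X) : G.NSpace m := (G.neumann m).ofMem (single_mem_neumann x)

theorem fm_nsingle (x : X) (f : G.NSpace m) :
    (G.neumann m).fm (G.nsingle m x) f = m.real {x} * G.laplacian m ((G.neumann m).incl f) x :=
  (hasSum_fm (G.nsingle m x) f).unique
    (single_hasSum (mem_laplacianDomain ((G.neumann m).incl_mem f)) x)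

/-- The bridge between geometry and harmonicity: orthogonality to all indicators in the form inner
product means `(ℒ + 1) f = 0`. -/
theorem inner_nsingle (x : X) (f : G.NSpace m) : inner ℝ (G.nsingle m x) f =
    m.real {x} * (G.laplacian m ((G.neumann m).incl f) x + (G.neumann m).incl f x) := by
  rw [SymmForm.inner_eq, fm_nsingle]
  change _ + inner ℝ (DiscreteL2.single m x) _ = _
  rw [DiscreteL2.inner_single]
  ring

/-! ### The Dirichlet form -/

variable (G m) in
/-- The domain of the Dirichlet form as a closed subspace of the form space. -/
def dspace : Submodule ℝ (G.NSpace m) :=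
  ((finSupp m).comap (G.neumann m).incl.toLinearMap).topologicalClosure

theorem isClosed_dspace : IsClosed (G.dspace m : Set (G.NSpace m)) :=
  Submodule.isClosed_topologicalClosure _

instance : CompleteSpace (G.dspace m) := isClosed_dspace.completeSpace_coe

theorem mem_dspace_iff (f : G.NSpace m) :
    f ∈ G.dspace m ↔ (G.neumann m).incl f ∈ (G.dirichlet m).dom := by
  constructor
  · intro hf
    refine ⟨(G.neumann m).incl_mem f, fun ε hε => ?_⟩
    obtain ⟨δ, hδ, hδ'⟩ := SymmForm.exists_ofReal_sq_le hε
    obtain ⟨g, hg, hd⟩ := Metric.mem_closure_iff.1 hf δ hδ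
    refine ⟨(G.neumann m).incl g, hg, lt_of_lt_of_le ?_ hδ'⟩
    rw [← map_sub, SymmForm.val₁_incl_lt_iff _ _ hδ, ← dist_eq_norm]
    exact hd
  · rintro ⟨-, h⟩
    refine Metric.mem_closure_iff.2 fun ε hε => ?_
    obtain ⟨g, hg, hd⟩ := h (ENNReal.ofReal (ε ^ 2)) (by simp; positivity)
    refine ⟨(G.neumann m).ofMem (finSupp_le_neumann hg), hg, ?_⟩
    rw [dist_eq_norm, ← SymmForm.val₁_incl_lt_iff _ _ hε]
    exact hd

theorem mem_dspace_of_finSupp {f : G.NSpace m} (hf : (G.neumann m).incl f ∈ finSupp m) :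
    f ∈ G.dspace m := Submodule.le_topologicalClosure _ hf

theorem nsingle_mem_dspace (x : X) : G.nsingle m x ∈ G.dspace m :=
  mem_dspace_of_finSupp (DiscreteL2.single_mem_finSupp x)

/-- The domain of the Dirichlet form is an order ideal in the domain of the Neumann form. -/
theorem mem_dspace_of_abs_le {u v : G.NSpace m} (hv : v ∈ G.dspace m)
    (h : ∀ x, |(G.neumann m).incl u x| ≤ |(G.neumann m).incl v x|) : u ∈ G.dspace m := by
  obtain ⟨w, hw, hwv⟩ := mem_closure_iff_seq_limit.1 hv
  let A : G.NSpace m → G.NSpace m := G.ncontr m NormalContraction.abs abs_zero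
  have hA : ∀ f x, (G.neumann m).incl (A f) x = |(G.neumann m).incl f x| := ncontr_apply _ _
  have hAn : ∀ f, ‖A f‖ ≤ ‖f‖ := norm_ncontr_le _ _
  obtain ⟨B, hB⟩ : ∃ B, ∀ n, ‖w n‖ ≤ B := by
    obtain ⟨B, hB⟩ := (Metric.isBounded_range_of_tendsto w hwv).exists_norm_le
    exact ⟨B, fun n => hB _ ⟨n, rfl⟩⟩
  -- This is `u` truncated to `[-|w n|, |w n|]`, written with absolute values only: it vanishes
  -- where `w n` does, its form norm stays bounded, and it converges pointwise to `u` truncated to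
  -- `[-|v|, |v|]`, that is, to `u`.
  let t : ℕ → G.NSpace m := fun n => (1 / 2 : ℝ) • (A (u + A (w n)) - A (u - A (w n)))
  have ht : ∀ n x, (G.neumann m).incl (t n) x = 1 / 2 *
      (abs ((G.neumann m).incl u x + abs ((G.neumann m).incl (w n) x))
        - abs ((G.neumann m).incl u x - abs ((G.neumann m).incl (w n) x))) := by
    intro n x
    simp only [t, map_smul, map_sub, DiscreteL2.smul_apply, DiscreteL2.sub_apply, hA, map_add,
      DiscreteL2.add_apply]
  refine SymmForm.mem_of_pointwise isClosed_dspace (l := atTop) (u := t) (B := ‖u‖ + B)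
    (fun n => ?_) (fun n => mem_dspace_of_finSupp ?_) fun x => ?_
  · have h1 := hAn (u + A (w n))
    have h2 := hAn (u - A (w n))
    have h3 := norm_add_le u (A (w n))
    have h4 := norm_sub_le u (A (w n))
    have h5 := hAn (w n)
    have h6 := norm_sub_le (A (u + A (w n))) (A (u - A (w n)))
    have h7 := hB n
    simp only [t]
    rw [norm_smul, Real.norm_eq_abs, abs_of_pos (by norm_num)]
    linarith
  · refine (show (Function.support (toFunₗ m ((G.neumann m).incl (w n)))).Finite from hw n).subset
      fun x hx => ?_
    intro h0
    refine hx ?_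
    change (G.neumann m).incl (t n) x = 0
    rw [ht, show (G.neumann m).incl (w n) x = 0 from h0]
    simp
  · simp only [ht]
    have h1 := DiscreteL2.tendsto_apply (((G.neumann m).incl.continuous.tendsto v).comp hwv) x
    have h2 := ((h1.abs.const_add ((G.neumann m).incl u x)).abs.sub
      (h1.abs.const_sub ((G.neumann m).incl u x)).abs).const_mul (1 / 2)
    obtain ⟨h3, h4⟩ := abs_le.1 (h x)
    suffices e : (G.neumann m).incl u x = 1 / 2 *
        (abs ((G.neumann m).incl u x + abs ((G.neumann m).incl v x))
          - abs ((G.neumann m).incl u x - abs ((G.neumann m).incl v x))) by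
      rw [← e] at h2; exact h2
    rw [abs_of_nonneg (by linarith : 0 ≤ (G.neumann m).incl u x + |(G.neumann m).incl v x|),
      abs_of_nonpos (by linarith : (G.neumann m).incl u x - |(G.neumann m).incl v x| ≤ 0)]
    ring

end WGraph

/-! ## Comparison of forms -/

namespace SymmForm

section Compare

variable {H : Type*} [NormedAddCommGroup H] [InnerProductSpace ℝ H] {Q N : SymmForm H}

/-- The inclusion of form spaces induced by an inclusion of form domains. -/
def mapLE (h : Q.dom ≤ N.dom) : Q.FormSpace →ₗ[ℝ] N.FormSpace :=
  N.toDom.symm.toLinearMap ∘ₗ Submodule.inclusion h ∘ₗ Q.toDom.toLinearMap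

@[simp] theorem incl_mapLE (h : Q.dom ≤ N.dom) (f : Q.FormSpace) :
    N.incl (mapLE h f) = Q.incl f := rfl

theorem le_iff : N ≤ Q ↔ ∃ h : Q.dom ≤ N.dom, ∀ f, N.fm (mapLE h f) (mapLE h f) ≤ Q.fm f f := by
  constructor
  · intro hle
    have hd : Q.dom ≤ N.dom := fun f hf => by
      rw [← val_ne_top_iff] at hf ⊢
      exact ne_top_of_le_ne_top hf (hle f)
    refine ⟨hd, fun f => ?_⟩
    have h := hle (Q.incl f)
    rw [Q.val_incl, ← incl_mapLE hd, N.val_incl] at h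
    exact (ENNReal.ofReal_le_ofReal_iff (Q.fm_nonneg f)).1 h
  · rintro ⟨hd, h⟩ f
    by_cases hf : f ∈ Q.dom
    · have e1 : f = Q.incl (Q.ofMem hf) := rfl
      have e2 : f = N.incl (mapLE hd (Q.ofMem hf)) := rfl
      calc N.val f = _ := (congrArg N.val e2).trans (val_incl _ _)
        _ ≤ _ := ENNReal.ofReal_le_ofReal (h (Q.ofMem hf))
        _ = Q.val f := (val_incl _ _).symm
    · have : Q.val f = ∞ := by by_contra h'; exact hf ((Q.val_ne_top_iff f).1 h')
      rw [this]; exact le_top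

/-- If `N ≤ Q` and the two forms agree at `f`, then `Q(f,g) = N(f,g)` for all `g`. -/
theorem fm_eq_of_fm_self_eq (hd : Q.dom ≤ N.dom)
    (hle : ∀ f, N.fm (mapLE hd f) (mapLE hd f) ≤ Q.fm f f) {f : Q.FormSpace}
    (hf : Q.fm f f = N.fm (mapLE hd f) (mapLE hd f)) (g : Q.FormSpace) :
    Q.fm f g = N.fm (mapLE hd f) (mapLE hd g) := by
  by_contra hne
  set β := Q.fm f g - N.fm (mapLE hd f) (mapLE hd g) with hβ
  have hβ0 : β ≠ 0 := sub_ne_zero.2 hne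
  set γ := Q.fm g g - N.fm (mapLE hd g) (mapLE hd g) with hγ
  -- The difference form vanishes at `f`, so at `g + t f` it equals `γ + 2 t β`. The chosen `t`
  -- makes this `-1`, contradicting nonnegativity.
  have h := hle (g + (-(γ + 1) / (2 * β)) • f)
  rw [map_add, map_smul] at h
  simp only [fm_add_left, fm_add_right, fm_smul_left, fm_smul_right] at h
  rw [fm_comm Q g f, fm_comm N (mapLE hd g) (mapLE hd f), hf] at h
  have e : -(γ + 1) / (2 * β) * β = -(γ + 1) / 2 := by field_simp
  have e2 : -(γ + 1) / (2 * β) * Q.fm f g -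
    -(γ + 1) / (2 * β) * N.fm (mapLE hd f) (mapLE hd g) = -(γ + 1) / 2 := by
      rw [← mul_sub, ← hβ, e]
  linarith

end Compare

end SymmForm

namespace WGraph

variable {X : Type*} [MeasurableSpace X] {m : Measure X} [IsDiscreteMeasure m] {G : WGraph X}
  [Countable X] [DiscreteMeasurableSpace X] {Q : SymmForm (Lp ℝ 2 m)}

/-! ## The generator -/

/-- Testing with indicators shows that the relation `generatorGraph` is single-valued, so it is
indeed the graph of `generator`. -/
theorem eq_zero_of_mem_generatorGraph (hQ : finSupp m ≤ Q.dom) {p : Lp ℝ 2 m × Lp ℝ 2 m}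
    (hp : p ∈ Q.generatorGraph) (h0 : p.1 = 0) : p.2 = 0 := by
  obtain ⟨h, h'⟩ := hp
  refine DiscreteL2.ext fun x => ?_
  have h1 := h' ⟨_, hQ (DiscreteL2.single_mem_finSupp x)⟩
  rw [DiscreteL2.inner_single] at h1
  have h2 : (⟨p.1, h⟩ : Q.dom) = 0 := Subtype.ext h0
  rw [h2, map_zero] at h1
  rw [DiscreteL2.zero_apply]
  exact (mul_eq_zero.1 h1.symm).resolve_left (DiscreteL2.mass_pos x).ne'

/-- The generator is a restriction of the formal Laplacian iff this holds for the pairs in its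
graph. -/
theorem generatorIsRestriction_iff (hQ : finSupp m ≤ Q.dom) :
    G.GeneratorIsRestriction m Q ↔ ∀ p ∈ Q.generatorGraph, ⇑(p.1 : Lp ℝ 2 m) ∈ G.laplacianDomain ∧
      ∀ x, (p.2 : Lp ℝ 2 m) x = G.laplacian m (p.1 : Lp ℝ 2 m) x := by
  have hg := fun (p : Lp ℝ 2 m × Lp ℝ 2 m) (hp : p ∈ Q.generatorGraph) =>
    eq_zero_of_mem_generatorGraph hQ hp
  constructor
  · intro h p hp
    rw [← Submodule.toLinearPMap_graph_eq _ hg, LinearPMap.mem_graph_iff] at hp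
    obtain ⟨f, hf, hf'⟩ := hp
    rw [← hf, ← hf']
    exact h f
  · intro h f
    have h1 : ((f : Lp ℝ 2 m), Q.generator f) ∈ Q.generatorGraph :=
      Submodule.mem_graph_toLinearPMap hg f
    have h2 := h _ h1
    dsimp only at h2
    exact h2

/-! ### Agreement with the Neumann form on finitely supported functions -/

theorem dom_dirichlet_le : (G.dirichlet m).dom ≤ (G.neumann m).dom := fun _ h => h.1

theorem finSupp_le_dirichlet : finSupp m ≤ (G.dirichlet m).dom := fun _ hf =>
  (mem_dspace_iff ((G.neumann m).ofMem (finSupp_le_neumann hf))).1 (mem_dspace_of_finSupp hf)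

theorem dirichlet_le_dom (hle : Q ≤ G.dirichlet m) : (G.dirichlet m).dom ≤ Q.dom :=
  (SymmForm.le_iff.1 hle).1

/-- Forms between the Neumann and the Dirichlet form agree with the Neumann form as soon as one
argument belongs to the domain of the Dirichlet form. -/
theorem fm_eq_of_mem_dirichlet (hN : G.neumann m ≤ Q) (hD : Q ≤ G.dirichlet m)
    (hd : Q.dom ≤ (G.neumann m).dom) {f : Q.FormSpace} (hf : Q.incl f ∈ (G.dirichlet m).dom)
    (g : Q.FormSpace) :
    Q.fm f g = (G.neumann m).fm (SymmForm.mapLE hd f) (SymmForm.mapLE hd g) := by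
  obtain ⟨_, hle⟩ := SymmForm.le_iff.1 hN
  obtain ⟨_, hle'⟩ := SymmForm.le_iff.1 hD
  refine SymmForm.fm_eq_of_fm_self_eq hd hle (le_antisymm ?_ (hle f)) g
  -- `Q^(D)` is a restriction of `Q^(N)`, so `Q ≤ Q^(D)` at `f` reads `Q(f) ≤ Q^(N)(f)`.
  exact hle' ((G.dirichlet m).ofMem hf)

/-- Indicators lie in `D(Q^(D))`, so `Q(1_x, g) = Q^(N)(1_x, g)`; the left side is `m(x) L g(x)`,
the right side `m(x) ℒ g(x)` by Green's formula. -/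
theorem generatorIsRestriction_of_intermediate (hN : G.neumann m ≤ Q) (hD : Q ≤ G.dirichlet m) :
    G.GeneratorIsRestriction m Q := by
  have hd : Q.dom ≤ (G.neumann m).dom := (SymmForm.le_iff.1 hN).1
  have hc : finSupp m ≤ Q.dom := finSupp_le_dirichlet.trans (dirichlet_le_dom hD)
  rw [generatorIsRestriction_iff hc]
  rintro ⟨g, k⟩ ⟨hg, h⟩
  refine ⟨mem_laplacianDomain (hd hg), fun x => ?_⟩
  have h1 := h ⟨_, hc (DiscreteL2.single_mem_finSupp x)⟩
  have h2 := fm_eq_of_mem_dirichlet hN hD hd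
    (f := Q.ofMem (hc (DiscreteL2.single_mem_finSupp x)))
    (finSupp_le_dirichlet (DiscreteL2.single_mem_finSupp x)) (Q.ofMem hg)
  have h3 := fm_nsingle (G := G) x (SymmForm.mapLE hd (Q.ofMem hg))
  rw [DiscreteL2.inner_single] at h1
  exact mul_left_cancel₀ (DiscreteL2.mass_pos (m := m) x).ne' (h1.symm.trans (h2.trans h3))

/-- A closed form which agrees with the Neumann form on the finitely supported functions is
dominated by the Dirichlet form. -/
theorem le_dirichlet_of_eqOn_finSupp [CompleteSpace Q.FormSpace] (hc : finSupp m ≤ Q.dom)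
    (h : ∀ (f : Q.FormSpace) (g : G.NSpace m), Q.incl f = (G.neumann m).incl g →
      Q.incl f ∈ finSupp m → Q.fm f f = (G.neumann m).fm g g) : Q ≤ G.dirichlet m := by
  rw [SymmForm.le_iff]
  have key : ∀ f : (G.dirichlet m).FormSpace, ∃ hf : (G.dirichlet m).incl f ∈ Q.dom,
      Q.fm (Q.ofMem hf) (Q.ofMem hf) = (G.dirichlet m).fm f f := by
    intro f
    set F : G.NSpace m := SymmForm.mapLE dom_dirichlet_le f with hF
    have hFd : F ∈ G.dspace m := (mem_dspace_iff F).2 ((G.dirichlet m).incl_mem f)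
    obtain ⟨w, hw, hwF⟩ := mem_closure_iff_seq_limit.1 hFd
    have hw' : ∀ n, (G.neumann m).incl (w n) ∈ finSupp m := hw
    set v : ℕ → Q.FormSpace := fun n => Q.ofMem (hc (hw n)) with hv
    have hnorm : ∀ (f : Q.FormSpace) (g : G.NSpace m), Q.incl f = (G.neumann m).incl g →
        Q.incl f ∈ finSupp m → ‖f‖ ^ 2 = ‖g‖ ^ 2 := by
      intro f g e hf
      rw [SymmForm.norm_sq_eq, SymmForm.norm_sq_eq, h f g e hf, e]
    -- The two form norms agree on finitely supported functions, so a sequence approximating `f` for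
    -- `Q^(D)` is Cauchy for `Q` as well, with the same `ℓ²` limit.
    have hcauchy : CauchySeq v := by
      have h1 := hwF.cauchySeq
      rw [Metric.cauchySeq_iff] at h1 ⊢
      intro ε hε
      obtain ⟨N, hN⟩ := h1 ε hε
      refine ⟨N, fun n hn k hk => ?_⟩
      have h2 := hnorm (v n - v k) (w n - w k) (by rw [map_sub, map_sub]; rfl)
        (by rw [map_sub]; exact Submodule.sub_mem _ (hw n) (hw k))
      have h3 : ‖v n - v k‖ = ‖w n - w k‖ := by
        rwa [sq_eq_sq₀ (norm_nonneg _) (norm_nonneg _)] at h2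
      rw [dist_eq_norm, h3, ← dist_eq_norm]
      exact hN n hn k hk
    obtain ⟨g, hg⟩ := cauchySeq_tendsto_of_complete hcauchy
    have e : Q.incl g = (G.dirichlet m).incl f :=
      tendsto_nhds_unique ((Q.incl.continuous.tendsto g).comp hg)
        (((G.neumann m).incl.continuous.tendsto F).comp hwF)
    have hmem : (G.dirichlet m).incl f ∈ Q.dom := e ▸ Q.incl_mem g
    refine ⟨hmem, ?_⟩
    have eg : Q.ofMem hmem = g := Q.incl_injective e.symm
    rw [eg]
    have hl1 := hg.norm.pow 2
    have hl2 := hwF.norm.pow 2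
    have hl3 : ∀ n, ‖v n‖ ^ 2 = ‖w n‖ ^ 2 := fun n => hnorm (v n) (w n) rfl (hw n)
    simp only [hl3] at hl1
    have h4 := tendsto_nhds_unique hl1 hl2
    rw [SymmForm.norm_sq_eq, SymmForm.norm_sq_eq, e] at h4
    have h5 : (G.neumann m).incl F = (G.dirichlet m).incl f := rfl
    rw [h5] at h4
    exact add_right_cancel h4
  exact ⟨fun _ hf => (key ((G.dirichlet m).ofMem hf)).1, fun f => (key f).2.le⟩

/-- A graph is determined by its formal Laplacian on indicator functions. -/
theorem eq_of_intermediate {G' : WGraph X} (hN : G.neumann m ≤ Q) (hD : Q ≤ G.dirichlet m)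
    (hN' : G'.neumann m ≤ Q) (hD' : Q ≤ G'.dirichlet m) : G = G' := by
  have hc : finSupp m ≤ Q.dom := finSupp_le_dirichlet.trans (dirichlet_le_dom hD)
  -- `Q(1_x, 1_y)` can be computed from either graph: off the diagonal it is `-b(x,y)`, on the
  -- diagonal `∑ b(x,z) + c(x)`.
  have key : ∀ (G : WGraph X), G.neumann m ≤ Q → Q ≤ G.dirichlet m → ∀ x y,
      Q.fm (Q.ofMem (hc (DiscreteL2.single_mem_finSupp x)))
        (Q.ofMem (hc (DiscreteL2.single_mem_finSupp y))) =
      ∑' z, (G.b x z : ℝ) * (DiscreteL2.single m y x - DiscreteL2.single m y z)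
        + G.c x * DiscreteL2.single m y x := by
    intro G hN hD x y
    rw [← mass_mul_laplacian (m := m)]
    have hd : Q.dom ≤ (G.neumann m).dom := (SymmForm.le_iff.1 hN).1
    exact (fm_eq_of_mem_dirichlet hN hD hd (finSupp_le_dirichlet (DiscreteL2.single_mem_finSupp x))
      _).trans (fm_nsingle (G := G) x (G.nsingle m y))
  have hb : ∀ (G : WGraph X) {x y}, x ≠ y →
      ∑' z, (G.b x z : ℝ) * (DiscreteL2.single m y x - DiscreteL2.single m y z)
        + G.c x * DiscreteL2.single m y x = - G.b x y := by
    intro G x y hxy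
    rw [DiscreteL2.single_of_ne hxy, tsum_eq_single y]
    · rw [DiscreteL2.single_self]; ring
    · intro z hz; rw [DiscreteL2.single_of_ne hz]; ring
  have hcc : ∀ (G : WGraph X) (x : X),
      ∑' z, (G.b x z : ℝ) * (DiscreteL2.single m x x - DiscreteL2.single m x z)
        + G.c x * DiscreteL2.single m x x = ∑' z, (G.b x z : ℝ) + G.c x := by
    intro G x
    rw [DiscreteL2.single_self]
    congr 1
    · refine tsum_congr fun z => ?_
      by_cases hz : z = x
      · rw [hz, G.diag]; simp
      · rw [DiscreteL2.single_of_ne hz]; ring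
    · ring
  have h1 : G.b = G'.b := by
    funext x y
    by_cases hxy : x = y
    · rw [hxy, G.diag, G'.diag]
    · have := (key G hN hD x y).symm.trans (key G' hN' hD' x y)
      rw [hb G hxy, hb G' hxy] at this
      exact NNReal.coe_injective (neg_injective this)
  refine WGraph.ext h1 ?_
  funext x
  have := (key G hN hD x x).symm.trans (key G' hN' hD' x x)
  rw [hcc, hcc, h1] at this
  exact NNReal.coe_injective (add_left_cancel this)

end WGraph

/-! ## Approximating forms -/

namespace DiscreteL2

variable {X : Type*} [MeasurableSpace X] {m : Measure X} [IsDiscreteMeasure m]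
  [Countable X] [DiscreteMeasurableSpace X]

theorem inner_cut (K : Finset X) (f g : Lp ℝ 2 m) :
    inner ℝ (cut K f) g = ∑ x ∈ K, m.real {x} * f x * g x := by
  rw [cut, sum_inner]
  refine Finset.sum_congr rfl fun x _ => ?_
  rw [inner_smul_left, inner_single]
  simp only [conj_trivial]
  ring

variable (m) in
/-- The indicator function of a finite set. -/
def ind (K : Finset X) : Lp ℝ 2 m := ∑ x ∈ K, single m x

theorem ind_apply_of_mem {K : Finset X} {x : X} (hx : x ∈ K) : ind m K x = 1 := by
  rw [ind, sum_apply, Finset.sum_eq_single x]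
  · rw [single_self]
  · intro y _ hy
    rw [single_of_ne hy.symm]
  · intro h; exact absurd hx h

theorem ind_apply_of_notMem {K : Finset X} {x : X} (hx : x ∉ K) : ind m K x = 0 := by
  rw [ind, sum_apply]
  refine Finset.sum_eq_zero fun y hy => ?_
  rw [single_of_ne (ne_of_mem_of_not_mem hy hx).symm]

end DiscreteL2

namespace SymmForm

open DiscreteL2 WGraph

variable {X : Type*} [MeasurableSpace X] {m : Measure X} [IsDiscreteMeasure m]
  [Countable X] [DiscreteMeasurableSpace X] {Q : SymmForm (Lp ℝ 2 m)} [CompleteSpace Q.FormSpace]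
  {ε : ℝ}

variable (Q) in
/-- The resolvent as an operator on `ℓ²`. -/
def res (ε : ℝ) : Lp ℝ 2 m →L[ℝ] Lp ℝ 2 m := Q.incl ∘L Q.resolvent ε

theorem res_def (ε : ℝ) (f : Lp ℝ 2 m) : Q.res ε f = Q.incl (Q.resolvent ε f) := rfl

/-- The resolvent of a Markovian form preserves the constraints given by contractions. -/
theorem comp_res (hQ : MarkovianOn Q.dom fun f => (Q.val f).toReal) (hε : 0 < ε) {C : ℝ → ℝ}
    (hC : LipschitzWith 1 C) (h0 : C 0 = 0) {f : Lp ℝ 2 m}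
    (h : ∀ x t, |C t - f x| ≤ |t - f x|) (x : X) : C (Q.res ε f x) = Q.res ε f x := by
  have key : contr hQ hC h0 (Q.resolvent ε f) = Q.resolvent ε f := by
    -- Composing with `C` lowers the energy and, by `h`, does not increase the distance to `f`; the
    -- minimizer is unique, hence fixed.
    refine eq_resolvent_of_le hε f _ (add_le_add ?_ ?_)
    · exact mul_le_mul_of_nonneg_left (fm_contr_le hQ hC h0 _) hε.le
    · refine pow_le_pow_left₀ (norm_nonneg _) (norm_le_of_abs_le fun x => ?_) 2
      rw [DiscreteL2.sub_apply, DiscreteL2.sub_apply, contr_apply]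
      exact h x _
  rw [res_def, ← contr_apply hC h0 hQ, key]

theorem res_nonneg (hQ : MarkovianOn Q.dom fun f => (Q.val f).toReal) (hε : 0 < ε) {f : Lp ℝ 2 m}
    (hf : ∀ x, 0 ≤ f x) (x : X) : 0 ≤ Q.res ε f x := by
  rw [← comp_res hQ hε NormalContraction.abs abs_zero (fun x t => ?_) x]
  · exact abs_nonneg _
  · have := abs_abs_sub_abs_le t (f x)
    rwa [abs_of_nonneg (hf x)] at this

theorem res_le_one (hQ : MarkovianOn Q.dom fun f => (Q.val f).toReal) (hε : 0 < ε) {f : Lp ℝ 2 m}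
    (hf : ∀ x, |f x| ≤ 1) (x : X) : |Q.res ε f x| ≤ 1 := by
  rw [← comp_res hQ hε (NormalContraction.lipschitz_clamp 1)
    (NormalContraction.clamp_zero zero_le_one) (fun x t => ?_) x]
  · exact NormalContraction.abs_clamp_le zero_le_one _
  · have := NormalContraction.abs_sub_le (NormalContraction.lipschitz_clamp 1) t (f x)
    rwa [NormalContraction.clamp_eq_self (hf x)] at this

variable (Q) in
/-- The approximating form `ε⁻¹ ⟨f - J f, f⟩`. -/
def approx (ε : ℝ) (f : Lp ℝ 2 m) : ℝ := ε⁻¹ * inner ℝ (f - Q.res ε f) f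

theorem continuous_approx : Continuous (Q.approx ε) := by
  unfold approx
  fun_prop

variable (Q) in
/-- The edge weights of the approximating form. -/
def approxEdge (ε : ℝ) (x y : X) : ℝ := ε⁻¹ * (m.real {x} * Q.res ε (single m y) x)

variable (Q) in
/-- The killing term of the approximating form. -/
def approxKill (ε : ℝ) (x : X) : ℝ := ε⁻¹ * (m.real {x} * (1 - ⨆ K, Q.res ε (ind m K) x))

variable (Q) in
/-- The weights of the approximating form. -/
def approxWeight (ε : ℝ) : (X × X) ⊕ X → ℝ :=
  Sum.elim (fun p => Q.approxEdge ε p.1 p.2 / 2) (Q.approxKill ε)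

theorem abs_single_le (y x : X) : |single m y x| ≤ 1 := by
  by_cases h : x = y
  · rw [h, single_self]; simp
  · rw [single_of_ne h]; simp

theorem single_nonneg (y x : X) : 0 ≤ single m y x := by
  by_cases h : x = y
  · rw [h, single_self]; simp
  · rw [single_of_ne h]

theorem abs_ind_le (K : Finset X) (x : X) : |ind m K x| ≤ 1 := by
  by_cases h : x ∈ K
  · rw [ind_apply_of_mem h]; simp
  · rw [ind_apply_of_notMem h]; simp

theorem approxEdge_comm (hε : 0 < ε) (x y : X) : Q.approxEdge ε x y = Q.approxEdge ε y x := by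
  rw [approxEdge, approxEdge, ← inner_single, ← inner_single, res_def, res_def,
    ← inner_resolvent_comm hε, real_inner_comm]

theorem approxEdge_nonneg (hQ : MarkovianOn Q.dom fun f => (Q.val f).toReal) (hε : 0 < ε) (x y : X) :
    0 ≤ Q.approxEdge ε x y :=
  mul_nonneg (inv_nonneg.2 hε.le)
    (mul_nonneg (mass_pos x).le (res_nonneg hQ hε (single_nonneg y) x))

/-- The kernel of `J` is symmetric, and `-2 f(x) f(y) = (f(x) - f(y))² - f(x)² - f(y)²`; the pure
squares combine with `‖f‖²` into the killing `1 - J 1_K`. For a Markovian form all coefficients are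
nonnegative. -/
theorem approx_cut (hε : 0 < ε) (K : Finset X) (f : Lp ℝ 2 m) :
    Q.approx ε (cut K f) = ∑ x ∈ K, ∑ y ∈ K, Q.approxEdge ε x y / 2 * (f x - f y) ^ 2
      + ∑ x ∈ K, ε⁻¹ * (m.real {x} * (1 - Q.res ε (ind m K) x)) * f x ^ 2 := by
  have hJ : ∀ x, Q.res ε (cut K f) x = ∑ y ∈ K, f y * Q.res ε (single m y) x := by
    intro x
    rw [cut, map_sum, DiscreteL2.sum_apply]
    refine Finset.sum_congr rfl fun y _ => ?_
    rw [map_smul, DiscreteL2.smul_apply]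
  have hI : ∀ x, Q.res ε (ind m K) x = ∑ y ∈ K, Q.res ε (single m y) x := by
    intro x
    rw [ind, map_sum, DiscreteL2.sum_apply]
  have hA : Q.approx ε (cut K f) = ∑ x ∈ K, ε⁻¹ * m.real {x} * f x ^ 2
      - ∑ x ∈ K, ∑ y ∈ K, Q.approxEdge ε x y * (f x * f y) := by
    rw [approx, real_inner_comm, inner_cut, Finset.mul_sum, ← Finset.sum_sub_distrib]
    refine Finset.sum_congr rfl fun x hx => ?_
    rw [DiscreteL2.sub_apply, cut_apply_of_mem hx, hJ, mul_sub, Finset.mul_sum, mul_sub, Finset.mul_sum]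
    congr 1
    · ring
    · refine Finset.sum_congr rfl fun y _ => ?_
      rw [approxEdge]; ring
  have h1 : ∑ x ∈ K, ∑ y ∈ K, Q.approxEdge ε x y * f y ^ 2 =
      ∑ x ∈ K, ∑ y ∈ K, Q.approxEdge ε x y * f x ^ 2 := by
    rw [Finset.sum_comm]
    refine Finset.sum_congr rfl fun x _ => Finset.sum_congr rfl fun y _ => ?_
    rw [approxEdge_comm hε]
  have h2 : ∑ x ∈ K, ε⁻¹ * (m.real {x} * (1 - Q.res ε (ind m K) x)) * f x ^ 2 =
      ∑ x ∈ K, ε⁻¹ * m.real {x} * f x ^ 2 - ∑ x ∈ K, ∑ y ∈ K, Q.approxEdge ε x y * f x ^ 2 := by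
    rw [← Finset.sum_sub_distrib]
    refine Finset.sum_congr rfl fun x _ => ?_
    rw [hI, ← Finset.sum_mul]
    simp only [approxEdge]
    rw [← Finset.mul_sum, ← Finset.mul_sum]
    ring
  have h3 : ∑ x ∈ K, ∑ y ∈ K, Q.approxEdge ε x y / 2 * (f x - f y) ^ 2 =
      1 / 2 * (∑ x ∈ K, ∑ y ∈ K, Q.approxEdge ε x y * f x ^ 2) +
      1 / 2 * (∑ x ∈ K, ∑ y ∈ K, Q.approxEdge ε x y * f y ^ 2) -
      ∑ x ∈ K, ∑ y ∈ K, Q.approxEdge ε x y * (f x * f y) := by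
    simp only [Finset.mul_sum, ← Finset.sum_sub_distrib, ← Finset.sum_add_distrib]
    refine Finset.sum_congr rfl fun x _ => Finset.sum_congr rfl fun y _ => ?_
    ring
  rw [hA, h2, h3, h1]
  ring

theorem monotone_res_ind (hQ : MarkovianOn Q.dom fun f => (Q.val f).toReal) (hε : 0 < ε) (x : X) :
    Monotone fun K => Q.res ε (ind m K) x := by
  classical
  intro K K' h
  have h1 := res_nonneg hQ hε (f := ind m K' - ind m K) (fun y => ?_) x
  · rw [map_sub, DiscreteL2.sub_apply] at h1
    simpa using h1
  · rw [DiscreteL2.sub_apply]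
    by_cases hy : y ∈ K
    · rw [ind_apply_of_mem hy, ind_apply_of_mem (h hy), sub_self]
    · rw [ind_apply_of_notMem hy, sub_zero]
      by_cases hy' : y ∈ K'
      · rw [ind_apply_of_mem hy']; exact zero_le_one
      · rw [ind_apply_of_notMem hy']

/-- The supremum over `K` plays the role of `J 1`, as the constant `1` need not lie in `ℓ²`. The
bound matters because an unbounded real supremum would be `0` by convention. -/
theorem bddAbove_res_ind (hQ : MarkovianOn Q.dom fun f => (Q.val f).toReal) (hε : 0 < ε) (x : X) :
    BddAbove (range fun K => Q.res ε (ind m K) x) :=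
  ⟨1, by rintro _ ⟨K, rfl⟩; exact (abs_le.1 (res_le_one hQ hε (abs_ind_le K) x)).2⟩

theorem tendsto_res_ind (hQ : MarkovianOn Q.dom fun f => (Q.val f).toReal) (hε : 0 < ε) (x : X) :
    Tendsto (fun K => Q.res ε (ind m K) x) atTop (𝓝 (⨆ K, Q.res ε (ind m K) x)) :=
  tendsto_atTop_ciSup (monotone_res_ind hQ hε x) (bddAbove_res_ind hQ hε x)

theorem iSup_res_ind_le_one (hQ : MarkovianOn Q.dom fun f => (Q.val f).toReal) (hε : 0 < ε) (x : X) :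
    ⨆ K, Q.res ε (ind m K) x ≤ 1 :=
  ciSup_le fun K => (abs_le.1 (res_le_one hQ hε (abs_ind_le K) x)).2

theorem res_single_le_iSup (hQ : MarkovianOn Q.dom fun f => (Q.val f).toReal) (hε : 0 < ε) (x : X) :
    Q.res ε (single m x) x ≤ ⨆ K, Q.res ε (ind m K) x := by
  have h := le_ciSup (bddAbove_res_ind hQ hε x) {x}
  simpa [ind] using h

/-- Removing finitely many edges and part of the killing from the approximating form leaves a
Markovian functional. -/
theorem sum_approxWeight_le (hQ : MarkovianOn Q.dom fun f => (Q.val f).toReal) (hε : 0 < ε)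
    {C : ℝ → ℝ} (hC : LipschitzWith 1 C) (h0 : C 0 = 0) (f : Lp ℝ 2 m)
    (s : Finset ((X × X) ⊕ X)) :
    ∑ i ∈ s, Q.approxWeight ε i * (grad f i ^ 2 - grad (hC.compLp h0 f) i ^ 2) ≤
      Q.approx ε f - Q.approx ε (hC.compLp h0 f) := by
  classical
  set g := hC.compLp h0 f with hg
  have hgf : (g : X → ℝ) = fun x => C (f x) := funext fun x => comp_apply hC h0 f x
  have hd : ∀ i, 0 ≤ grad f i ^ 2 - grad g i ^ 2 := fun i => by
    rw [sub_nonneg, hgf]; exact sq_le_sq.2 (abs_grad_comp_le hC h0 f i)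
  -- All vertices touched by `s`. For finite `K ⊇ F` the sum over `s` is part of a sum of
  -- nonnegative terms coming from `approx_cut`; then `K` grows to `X`.
  set F : Finset X := s.toLeft.image Prod.fst ∪ s.toLeft.image Prod.snd ∪ s.toRight with hF
  have key : ∀ K, F ⊆ K → ∑ i ∈ s, Q.approxWeight ε i * (grad f i ^ 2 - grad g i ^ 2) ≤
      Q.approx ε (cut K f) - Q.approx ε (cut K g) := by
    intro K hK
    have hw : ∀ x, 0 ≤ 1 - ⨆ K, Q.res ε (ind m K) x := fun x =>
      sub_nonneg.2 (iSup_res_ind_le_one hQ hε x)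
    have hwn : ∀ i, 0 ≤ Q.approxWeight ε i := by
      rintro (p | x)
      · exact div_nonneg (approxEdge_nonneg hQ hε _ _) two_pos.le
      · exact mul_nonneg (inv_nonneg.2 hε.le) (mul_nonneg (mass_pos x).le (hw x))
    have hs : s ⊆ (K ×ˢ K).disjSum K := by
      intro i hi
      rcases i with p | x
      · rw [Finset.inl_mem_disjSum, Finset.mem_product]
        have hp : p ∈ s.toLeft := Finset.mem_toLeft.2 hi
        exact ⟨hK (Finset.mem_union_left _ (Finset.mem_union_left _ (Finset.mem_image_of_mem _ hp))),
          hK (Finset.mem_union_left _ (Finset.mem_union_right _ (Finset.mem_image_of_mem _ hp)))⟩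
      · rw [Finset.inr_mem_disjSum]
        exact hK (Finset.mem_union_right _ (Finset.mem_toRight.2 hi))
    refine (Finset.sum_le_sum_of_subset_of_nonneg hs fun i _ _ =>
      mul_nonneg (hwn i) (hd i)).trans ?_
    rw [Finset.sum_disjSum, Finset.sum_product, approx_cut hε, approx_cut hε, add_sub_add_comm,
      ← Finset.sum_sub_distrib, ← Finset.sum_sub_distrib]
    refine add_le_add (le_of_eq (Finset.sum_congr rfl fun x _ => ?_))
      (Finset.sum_le_sum fun x _ => ?_)
    · rw [← Finset.sum_sub_distrib]
      refine Finset.sum_congr rfl fun y _ => ?_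
      simp only [approxWeight, grad, Sum.elim_inl]
      ring
    · rw [← mul_sub]
      refine mul_le_mul_of_nonneg_right ?_ (hd (Sum.inr x))
      refine mul_le_mul_of_nonneg_left (mul_le_mul_of_nonneg_left ?_ (mass_pos x).le)
        (inv_nonneg.2 hε.le)
      -- The killing on the finite set `K` is at least the limiting killing.
      exact sub_le_sub_left (le_ciSup (bddAbove_res_ind hQ hε x) K) 1
  refine ge_of_tendsto (((continuous_approx.tendsto f).comp (tendsto_cut f)).sub
    ((continuous_approx.tendsto g).comp (tendsto_cut g))) ?_
  exact (eventually_ge_atTop F).mono key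

/-! ### Convergence of the resolvent -/

/-- For `ε ≤ 0` the resolvent is zero by convention, so the bound holds for every `ε`, as the weak
convergence argument requires. -/
theorem norm_resolvent_incl_le (ε : ℝ) (f : Q.FormSpace) : ‖Q.resolvent ε (Q.incl f)‖ ≤ ‖f‖ := by
  by_cases hε : 0 < ε
  · refine le_of_sq_le_sq ?_ (norm_nonneg _)
    rw [norm_sq_eq, norm_sq_eq]
    exact add_le_add (resolvent_bounds hε f).1
      (pow_le_pow_left₀ (norm_nonneg _) (norm_incl_resolvent_le hε _) 2)
  · rw [resolvent, dif_neg hε]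
    simp

theorem tendsto_res (f : Q.FormSpace) :
    Tendsto (fun ε => Q.res ε (Q.incl f)) (𝓝[>] 0) (𝓝 (Q.incl f)) := by
  rw [tendsto_iff_norm_sub_tendsto_zero]
  have h1 : Tendsto (fun ε : ℝ => Real.sqrt (ε * Q.fm f f)) (𝓝[>] 0) (𝓝 0) := by
    have : Tendsto (fun ε : ℝ => Real.sqrt (ε * Q.fm f f)) (𝓝 0) (𝓝 (Real.sqrt (0 * Q.fm f f))) :=
      (by fun_prop : Continuous fun ε : ℝ => Real.sqrt (ε * Q.fm f f)).tendsto 0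
    rw [zero_mul, Real.sqrt_zero] at this
    exact this.mono_left nhdsWithin_le_nhds
  refine squeeze_zero' (Eventually.of_forall fun _ => norm_nonneg _) ?_ h1
  filter_upwards [self_mem_nhdsWithin] with ε hε
  exact Real.le_sqrt_of_sq_le (resolvent_bounds hε f).2

/-- The resolvents are bounded in form norm and converge in `ℓ²`, hence weakly in the form space;
subtracting the `ℓ²` inner product leaves `Q`. -/
theorem tendsto_fm_resolvent (f g : Q.FormSpace) :
    Tendsto (fun ε => Q.fm (Q.resolvent ε (Q.incl f)) g) (𝓝[>] 0) (𝓝 (Q.fm f g)) := by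
  have h1 := tendsto_inner_of_pointwise (l := 𝓝[>] (0 : ℝ))
    (fun ε => norm_resolvent_incl_le ε f) (fun x => tendsto_apply (tendsto_res f) x) g
  have h2 : Tendsto (fun ε => inner ℝ (Q.res ε (Q.incl f)) (Q.incl g)) (𝓝[>] 0)
      (𝓝 (inner ℝ (Q.incl f) (Q.incl g))) := (tendsto_res f).inner tendsto_const_nhds
  have h3 := h1.sub h2
  simpa [inner_eq, res_def] using h3

theorem approx_incl (hε : 0 < ε) (f : Q.FormSpace) :
    Q.approx ε (Q.incl f) = Q.fm (Q.resolvent ε (Q.incl f)) f := by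
  have h := resolvent_spec hε (Q.incl f) f
  rw [approx, real_inner_comm, inner_sub_right, ← h, res_def, fm_comm]
  field_simp
  ring

theorem tendsto_approx (f : Q.FormSpace) :
    Tendsto (fun ε => Q.approx ε (Q.incl f)) (𝓝[>] 0) (𝓝 (Q.fm f f)) := by
  refine (tendsto_fm_resolvent f f).congr' ?_
  filter_upwards [self_mem_nhdsWithin] with ε hε
  exact (approx_incl hε f).symm

end SymmForm

/-! ## Forms whose operator is a restriction of the formal Laplacian -/

namespace WGraph

open DiscreteL2 SymmForm

variable {X : Type*} [MeasurableSpace X] {m : Measure X} [IsDiscreteMeasure m] {G : WGraph X}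
  [Countable X] [DiscreteMeasurableSpace X] {Q : SymmForm (Lp ℝ 2 m)}

theorem tendsto_laplacian {ι : Type*} {l : Filter ι} {u : ι → X → ℝ} {f : X → ℝ} {B : ℝ}
    (hB : ∀ᶠ i in l, ∀ x, |u i x| ≤ B) (h : ∀ x, Tendsto (fun i => u i x) l (𝓝 (f x))) (x : X) :
    Tendsto (fun i => G.laplacian m (u i) x) l (𝓝 (G.laplacian m f x)) := by
  unfold laplacian
  refine (Tendsto.const_mul _ ?_).add ((h x).const_mul _)
  refine tendsto_tsum_of_dominated_convergence (bound := fun y => G.b x y * (2 * B))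
    ((summable_row x).mul_right _) (fun y => ((h x).sub (h y)).const_mul _) ?_
  filter_upwards [hB] with i hi y
  rw [Real.norm_eq_abs, abs_mul, NNReal.abs_eq]
  refine mul_le_mul_of_nonneg_left ?_ (NNReal.coe_nonneg _)
  have := abs_sub (u i x) (u i y)
  linarith [hi x, hi y]

/-- The left side is `L J f`. Through this identity the hypothesis on the operator enters the limits
of the approximating weights and the values of `Q` on indicators. -/
theorem laplacian_res (hQ : Q ∈ dirichletForms m) (hG : G.GeneratorIsRestriction m Q)
    [CompleteSpace Q.FormSpace] {ε : ℝ} (hε : 0 < ε) (f : Lp ℝ 2 m) (x : X) :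
    ε⁻¹ * (f x - Q.res ε f x) = G.laplacian m (Q.res ε f) x := by
  have h := ((generatorIsRestriction_iff hQ.2).1 hG _ (resolvent_mem_generatorGraph hε f)).2 x
  simp only [DiscreteL2.smul_apply, DiscreteL2.sub_apply] at h
  exact h

/-! ### Convergence of the approximating weights to `b` and `c` -/

section convergence

variable [CompleteSpace Q.FormSpace]

/-- Off the diagonal, `laplacian_res` says that the weight is `-m(x) ℒ(J 1_y)(x)`. As `J 1_y` is
bounded by `1` and tends to `1_y`, the limit is `-m(x) ℒ 1_y(x) = b(x,y)`. -/
theorem tendsto_approxEdge (hQ : Q ∈ dirichletForms m) (hG : G.GeneratorIsRestriction m Q)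
    {x y : X} (hxy : x ≠ y) :
    Tendsto (fun ε => Q.approxEdge ε x y) (𝓝[>] 0) (𝓝 (G.b x y)) := by
  have h1 : Tendsto (fun ε => -(m.real {x} * G.laplacian m (Q.res ε (single m y)) x)) (𝓝[>] 0)
      (𝓝 (-(m.real {x} * G.laplacian m (single m y) x))) := by
    refine ((tendsto_laplacian (B := 1) ?_ (fun z => ?_) x).const_mul _).neg
    · filter_upwards [self_mem_nhdsWithin] with ε hε
      exact res_le_one hQ.1.markovian hε (abs_single_le y)
    · exact tendsto_apply (tendsto_res (Q.ofMem (hQ.2 (single_mem_finSupp y)))) z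
  have h2 : -(m.real {x} * G.laplacian m (single m y) x) = G.b x y := by
    rw [mass_mul_laplacian, tsum_eq_single y, single_self, single_of_ne hxy]
    · ring
    · intro z hz; rw [single_of_ne hz, single_of_ne hxy]; ring
  rw [h2] at h1
  refine h1.congr' ?_
  filter_upwards [self_mem_nhdsWithin] with ε hε
  rw [← laplacian_res hQ hG hε, single_of_ne hxy, approxEdge]
  ring

/-- This is `laplacian_res` for `1_K` with `x ∈ K`, in the limit `K ↑ X`. -/
theorem approxKill_eq (hQ : Q ∈ dirichletForms m) (hG : G.GeneratorIsRestriction m Q)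
    {ε : ℝ} (hε : 0 < ε) (x : X) : Q.approxKill ε x =
      m.real {x} * G.laplacian m (fun y => ⨆ K, Q.res ε (ind m K) y) x := by
  have hM := hQ.1.markovian
  have h1 : Tendsto (fun K => ε⁻¹ * (m.real {x} * (1 - Q.res ε (ind m K) x))) atTop
      (𝓝 (Q.approxKill ε x)) :=
    (((tendsto_res_ind hM hε x).const_sub 1).const_mul _).const_mul _
  have h2 : Tendsto (fun K => m.real {x} * G.laplacian m (Q.res ε (ind m K)) x) atTop
      (𝓝 (m.real {x} * G.laplacian m (fun y => ⨆ K, Q.res ε (ind m K) y) x)) :=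
    (tendsto_laplacian (B := 1)
      (Eventually.of_forall fun K => res_le_one hM hε (abs_ind_le K))
      (tendsto_res_ind hM hε) x).const_mul _
  refine tendsto_nhds_unique h1 (h2.congr' ?_)
  filter_upwards [eventually_ge_atTop {x}] with K hK
  rw [← laplacian_res hQ hG hε, ind_apply_of_mem (hK (Finset.mem_singleton_self x))]
  ring

/-- At each `y` the supremum is squeezed between `J 1_y(y) → 1` and `1`, so the Laplacian in
`approxKill_eq` tends to `ℒ 1 = c/m`. -/
theorem tendsto_approxKill (hQ : Q ∈ dirichletForms m) (hG : G.GeneratorIsRestriction m Q)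
    (x : X) : Tendsto (fun ε => Q.approxKill ε x) (𝓝[>] 0) (𝓝 (G.c x)) := by
  have hM := hQ.1.markovian
  have h1 : Tendsto (fun ε => m.real {x} * G.laplacian m (fun y => ⨆ K, Q.res ε (ind m K) y) x)
      (𝓝[>] 0) (𝓝 (m.real {x} * G.laplacian m (fun _ => 1) x)) := by
    refine (tendsto_laplacian (B := 1) ?_ (fun y => ?_) x).const_mul _
    · filter_upwards [self_mem_nhdsWithin] with ε hε y
      rw [abs_le]
      refine ⟨le_trans ?_ (res_single_le_iSup hM hε y), iSup_res_ind_le_one hM hε y⟩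
      have := res_nonneg hM hε (single_nonneg y) y
      linarith
    · have h2 := tendsto_apply (tendsto_res (Q.ofMem (hQ.2 (single_mem_finSupp y)))) y
      rw [incl_ofMem, single_self] at h2
      refine tendsto_of_tendsto_of_tendsto_of_le_of_le' h2 tendsto_const_nhds ?_ ?_
      · filter_upwards [self_mem_nhdsWithin] with ε hε
        exact res_single_le_iSup hM hε y
      · filter_upwards [self_mem_nhdsWithin] with ε hε
        exact iSup_res_ind_le_one hM hε y
  have h2 : m.real {x} * G.laplacian m (fun _ => 1) x = G.c x := by
    rw [mass_mul_laplacian]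
    simp
  rw [h2] at h1
  refine h1.congr' ?_
  filter_upwards [self_mem_nhdsWithin] with ε hε
  exact (approxKill_eq hQ hG hε x).symm

/-- Removing finitely many edges and part of the killing leaves a Markovian functional. -/
theorem sum_weight_le (hQ : Q ∈ dirichletForms m) (hG : G.GeneratorIsRestriction m Q)
    {C : ℝ → ℝ} (hC : LipschitzWith 1 C) (h0 : C 0 = 0) (f : Q.FormSpace)
    (s : Finset ((X × X) ⊕ X)) :
    ∑ i ∈ s, G.weight i *
        (grad (Q.incl f) i ^ 2 - grad (Q.incl (contr hQ.1.markovian hC h0 f)) i ^ 2) ≤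
      Q.fm f f - Q.fm (contr hQ.1.markovian hC h0 f) (contr hQ.1.markovian hC h0 f) := by
  set g := contr hQ.1.markovian hC h0 f with hg
  have h1 : Tendsto (fun ε => Q.approx ε (Q.incl f) - Q.approx ε (Q.incl g)) (𝓝[>] 0)
      (𝓝 (Q.fm f f - Q.fm g g)) := (tendsto_approx f).sub (tendsto_approx g)
  have h2 : Tendsto (fun ε => ∑ i ∈ s, Q.approxWeight ε i *
      (grad (Q.incl f) i ^ 2 - grad (Q.incl g) i ^ 2)) (𝓝[>] 0)
      (𝓝 (∑ i ∈ s, G.weight i * (grad (Q.incl f) i ^ 2 - grad (Q.incl g) i ^ 2))) := by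
    refine tendsto_finsetSum _ fun i _ => ?_
    rcases i with ⟨x, y⟩ | x
    -- The diagonal weights need not converge, but differences along `(x, x)` vanish.
    · by_cases hxy : x = y
      · subst hxy
        simp [grad]
      · exact ((tendsto_approxEdge hQ hG hxy).div_const 2).mul_const _
    · exact (tendsto_approxKill hQ hG x).mul_const _
  refine le_of_tendsto_of_tendsto h2 h1 ?_
  filter_upwards [self_mem_nhdsWithin] with ε hε
  exact sum_approxWeight_le hQ.1.markovian hε hC h0 (Q.incl f) s

/-- The contraction `C = 0` in `sum_weight_le` bounds every finite partial sum of the energy of `f`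
by `Q(f)`. -/
theorem neumann_le_of_generatorIsRestriction (hQ : Q ∈ dirichletForms m)
    (hG : G.GeneratorIsRestriction m Q) : G.neumann m ≤ Q := by
  have key : ∀ (f : Q.FormSpace) (s : Finset ((X × X) ⊕ X)),
      ∑ i ∈ s, G.weight i * grad (Q.incl f) i ^ 2 ≤ Q.fm f f := by
    intro f s
    have h := sum_weight_le hQ hG (C := fun _ => 0) (LipschitzWith.const' 0) rfl f s
    set g := contr hQ.1.markovian (C := fun _ => 0) (LipschitzWith.const' 0) rfl f with hg
    have hg0 : g = 0 := formSpace_ext Q fun x => by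
      rw [hg, contr_apply, map_zero, DiscreteL2.zero_apply]
    rw [hg0, map_zero] at h
    have h1 : ∀ i, grad (0 : Lp ℝ 2 m) i = 0 := by
      rintro (p | x)
      · change (0 : Lp ℝ 2 m) p.1 - (0 : Lp ℝ 2 m) p.2 = 0
        rw [DiscreteL2.zero_apply, DiscreteL2.zero_apply, sub_zero]
      · exact DiscreteL2.zero_apply x
    have h2 : Q.fm 0 0 = 0 := by simp [fm]
    simp only [h1, h2] at h
    simpa using h
  rw [le_iff]
  have hnn : ∀ (f : Q.FormSpace) i, 0 ≤ G.weight i * grad (Q.incl f) i ^ 2 := fun f i =>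
    mul_nonneg (G.weight_nonneg i) (sq_nonneg _)
  refine ⟨fun f hf => ?_, fun f => ?_⟩
  · exact (mem_neumann_iff f).2 (summable_of_sum_le (hnn (Q.ofMem hf)) (key (Q.ofMem hf)))
  · exact hasSum_le_of_sum_le (hasSum_fm_self _) (key f)

/-- The difference to the Neumann form is Markovian. -/
theorem sub_neumann_contr_le (hQ : Q ∈ dirichletForms m) (hG : G.GeneratorIsRestriction m Q)
    (hd : Q.dom ≤ (G.neumann m).dom) {C : ℝ → ℝ} (hC : LipschitzWith 1 C) (h0 : C 0 = 0)
    (f : Q.FormSpace) :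
    Q.fm (contr hQ.1.markovian hC h0 f) (contr hQ.1.markovian hC h0 f)
        - (G.neumann m).fm (mapLE hd (contr hQ.1.markovian hC h0 f))
          (mapLE hd (contr hQ.1.markovian hC h0 f)) ≤
      Q.fm f f - (G.neumann m).fm (mapLE hd f) (mapLE hd f) := by
  set g := contr hQ.1.markovian hC h0 f with hg
  have h1 := (hasSum_fm_self (G := G) (mapLE hd f)).sub (hasSum_fm_self (G := G) (mapLE hd g))
  simp only [incl_mapLE, ← mul_sub] at h1
  have h2 := hasSum_le_of_sum_le h1 (sum_weight_le hQ hG hC h0 f)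
  linarith

/-- An indicator need not belong to the domain of the operator. The value is therefore obtained as
the limit of `Q(J 1_y, 1_x) = m(x) ℒ(J 1_y)(x)`. -/
theorem fm_single_single (hQ : Q ∈ dirichletForms m) (hG : G.GeneratorIsRestriction m Q) (x y : X) :
    Q.fm (Q.ofMem (hQ.2 (single_mem_finSupp y))) (Q.ofMem (hQ.2 (single_mem_finSupp x))) =
      m.real {x} * G.laplacian m (single m y) x := by
  set f := Q.ofMem (hQ.2 (single_mem_finSupp y))
  set g := Q.ofMem (hQ.2 (single_mem_finSupp x)) with hg
  have h1 : Tendsto (fun ε => m.real {x} * G.laplacian m (Q.res ε (single m y)) x) (𝓝[>] 0)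
      (𝓝 (m.real {x} * G.laplacian m (single m y) x)) := by
    refine (tendsto_laplacian (B := 1) ?_ (fun z => ?_) x).const_mul _
    · filter_upwards [self_mem_nhdsWithin] with ε hε
      exact res_le_one hQ.1.markovian hε (abs_single_le y)
    · exact tendsto_apply (tendsto_res f) z
  refine tendsto_nhds_unique (tendsto_fm_resolvent f g) (h1.congr' ?_)
  filter_upwards [self_mem_nhdsWithin] with ε hε
  have h2 : ε * Q.fm g (Q.resolvent ε (Q.incl f)) + m.real {x} * Q.res ε (single m y) x =
      m.real {x} * single m y x := by
    rw [← inner_single, ← inner_single]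
    exact resolvent_spec hε (Q.incl f) g
  rw [fm_comm] at h2
  rw [← laplacian_res hQ hG hε]
  have h3 : ε * Q.fm (Q.resolvent ε (Q.incl f)) g =
      m.real {x} * (single m y x - Q.res ε (single m y) x) := by
    linear_combination h2
  rw [mul_left_comm, ← h3]
  exact inv_mul_cancel_left₀ (ne_of_gt hε) _

theorem le_dirichlet_of_generatorIsRestriction (hQ : Q ∈ dirichletForms m)
    (hG : G.GeneratorIsRestriction m Q) : Q ≤ G.dirichlet m := by
  refine le_dirichlet_of_eqOn_finSupp hQ.2 fun f g e hf => ?_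
  obtain ⟨K, hK⟩ := exists_eq_cut hf
  have hf' : f = ∑ x ∈ K, Q.incl f x • Q.ofMem (hQ.2 (single_mem_finSupp x)) := by
    refine Q.incl_injective ?_
    rw [map_sum]
    exact hK K subset_rfl
  have hg' : g = ∑ x ∈ K, Q.incl f x • G.nsingle m x := by
    refine (G.neumann m).incl_injective ?_
    rw [map_sum, ← e]
    exact hK K subset_rfl
  rw [hf', hg']
  simp only [fm, map_sum, map_smul, LinearMap.sum_apply, LinearMap.smul_apply]
  refine Finset.sum_congr rfl fun y _ => congrArg _ (Finset.sum_congr rfl fun x _ => congrArg _ ?_)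
  have h1 := fm_single_single hQ hG x y
  have h2 := fm_nsingle (G := G) x (G.nsingle m y)
  exact ((fm_comm _ _ _).trans h1).trans h2.symm

end convergence

/-- The operator of a Dirichlet form is a restriction of the formal Laplacian of a graph iff the
form lies between the Neumann and the Dirichlet form of the graph. -/
theorem generatorIsRestriction_iff_intermediate (hQ : Q ∈ dirichletForms m) :
    G.GeneratorIsRestriction m Q ↔ Q ∈ G.intermediateForms m := by
  have := Q.completeSpace_of_isClosedForm hQ.1.closed
  exact ⟨fun hG => ⟨hQ.1, neumann_le_of_generatorIsRestriction hQ hG,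
    le_dirichlet_of_generatorIsRestriction hQ hG⟩,
    fun h => generatorIsRestriction_of_intermediate h.2.1 h.2.2⟩

end WGraph

namespace WGraph

open DiscreteL2

variable {X : Type*} [MeasurableSpace X] {m : Measure X} [IsDiscreteMeasure m] {G : WGraph X}

/-! ## Boundary values -/

/-- The trace on `X` of the neighbourhoods of a boundary point. -/
def nb (z : G.Boundary m) : Filter X := comap (G.evalMap m) (𝓝 z.1)

instance (z : G.Boundary m) : (nb z).NeBot := by
  rw [nb, comap_neBot_iff]
  intro t ht
  obtain ⟨_, h1, x, rfl⟩ := mem_closure_iff_nhds.1 z.2.1 t ht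
  exact ⟨x, h1⟩

theorem tendsto_nb (f : G.BoundedNeumann m) (z : G.Boundary m) :
    Tendsto (fun x => f.1 x) (nb z) (𝓝 (G.trace₀ m f z)) :=
  ((continuous_apply f).tendsto z.1).comp tendsto_comap

/-- A bounded element of the form space as an element of the algebra of bounded functions. -/
def toBdd (f : G.NSpace m) (h : ∃ B : ℝ, ∀ x, |(G.neumann m).incl f x| ≤ B) : G.BoundedNeumann m :=
  ⟨(G.neumann m).incl f, (G.neumann m).incl_mem f, h⟩

/-- A bounded function as an element of the form space. -/
def ofBdd (f : G.BoundedNeumann m) : G.NSpace m := (G.neumann m).ofMem f.2.1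

theorem incl_ofBdd (f : G.BoundedNeumann m) : (G.neumann m).incl (ofBdd f) = f.1 := rfl

theorem trace_eq {f : Lp ℝ 2 m} {z : G.Boundary m} {a : EReal}
    (h : Tendsto (fun x => ((f x : ℝ) : EReal)) (nb z) (𝓝 a)) : G.trace m f z = a := h.limUnder_eq

theorem trace_eq_of_tendsto {f : Lp ℝ 2 m} {z : G.Boundary m} {a : ℝ}
    (h : Tendsto (fun x => f x) (nb z) (𝓝 a)) : G.trace m f z = (a : EReal) :=
  trace_eq (EReal.tendsto_coe.2 h)

theorem trace_coe (f : G.BoundedNeumann m) (z : G.Boundary m) :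
    G.trace m f.1 z = (G.trace₀ m f z : EReal) := trace_eq_of_tendsto (tendsto_nb f z)

variable [Countable X] [DiscreteMeasurableSpace X]

theorem abs_arctan_le (t : ℝ) : |Real.arctan t| ≤ Real.pi / 2 :=
  abs_le.2 ⟨(Real.neg_pi_div_two_lt_arctan t).le, (Real.arctan_lt_pi_div_two t).le⟩

variable (m) in
/-- The bounded function `arctan ∘ f`. -/
def arctanBdd (f : G.NSpace m) : G.BoundedNeumann m :=
  toBdd (G.ncontr m NormalContraction.lipschitz_arctan Real.arctan_zero f)
    ⟨Real.pi / 2, fun x => by rw [ncontr_apply]; exact abs_arctan_le _⟩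

theorem arctanBdd_apply (f : G.NSpace m) (x : X) :
    (arctanBdd m f).1 x = Real.arctan ((G.neumann m).incl f x) := ncontr_apply _ _ f x

theorem abs_trace₀_arctan_le (f : G.NSpace m) (z : G.Boundary m) :
    |G.trace₀ m (arctanBdd m f) z| ≤ Real.pi / 2 := by
  refine le_of_tendsto (tendsto_nb (arctanBdd m f) z).abs (Eventually.of_forall fun x => ?_)
  rw [arctanBdd_apply]
  exact abs_arctan_le _

theorem tendsto_of_abs_trace₀_lt (f : G.NSpace m) {z : G.Boundary m}
    (h : |G.trace₀ m (arctanBdd m f) z| < Real.pi / 2) :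
    Tendsto (fun x => (G.neumann m).incl f x) (nb z)
      (𝓝 (Real.tan (G.trace₀ m (arctanBdd m f) z))) := by
  have h1 := tendsto_nb (arctanBdd m f) z
  have hc : Real.cos (G.trace₀ m (arctanBdd m f) z) ≠ 0 :=
    (Real.cos_pos_of_mem_Ioo (abs_lt.1 h)).ne'
  have h2 := (Real.continuousAt_tan.2 hc).tendsto.comp h1
  refine h2.congr fun x => ?_
  rw [Function.comp_apply, arctanBdd_apply, Real.tan_arctan]

/-- The boundary value of `arctan ∘ f` lies in `[-π/2, π/2]`, the endpoints corresponding to the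
limits `±∞`. Hence the `limUnder` defining `trace` is an actual limit. -/
theorem tendsto_trace (f : G.NSpace m) (z : G.Boundary m) :
    Tendsto (fun x => (((G.neumann m).incl f x : ℝ) : EReal)) (nb z)
      (𝓝 (G.trace m ((G.neumann m).incl f) z)) := by
  suffices h : ∃ a : EReal,
      Tendsto (fun x => (((G.neumann m).incl f x : ℝ) : EReal)) (nb z) (𝓝 a) by
    obtain ⟨a, ha⟩ := h
    rwa [trace_eq ha]
  have h1 := tendsto_nb (arctanBdd m f) z
  rcases lt_or_eq_of_le (abs_trace₀_arctan_le f z) with h | h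
  · exact ⟨_, EReal.tendsto_coe.2 (tendsto_of_abs_trace₀_lt f h)⟩
  · rcases abs_choice (G.trace₀ m (arctanBdd m f) z) with h' | h'
    · refine ⟨⊤, EReal.tendsto_nhds_top_iff_real.2 fun a => ?_⟩
      rw [h'] at h
      rw [h] at h1
      filter_upwards [(tendsto_order.1 h1).1 _ (Real.arctan_lt_pi_div_two a)] with x hx
      rw [arctanBdd_apply] at hx
      exact EReal.coe_lt_coe_iff.2 (Real.arctan_strictMono.lt_iff_lt.1 hx)
    · refine ⟨⊥, EReal.tendsto_nhds_bot_iff_real.2 fun a => ?_⟩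
      rw [h'] at h
      rw [neg_eq_iff_eq_neg.1 h] at h1
      filter_upwards [(tendsto_order.1 h1).2 _ (Real.neg_pi_div_two_lt_arctan a)] with x hx
      rw [arctanBdd_apply] at hx
      exact EReal.coe_lt_coe_iff.2 (Real.arctan_strictMono.lt_iff_lt.1 hx)

theorem trace_eq_coe_iff (f : G.NSpace m) (z : G.Boundary m) (a : ℝ) :
    G.trace m ((G.neumann m).incl f) z = (a : EReal) ↔
      Tendsto (fun x => (G.neumann m).incl f x) (nb z) (𝓝 a) := by
  constructor
  · intro h
    have h1 := tendsto_trace f z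
    rw [h] at h1
    exact EReal.tendsto_coe.1 h1
  · exact trace_eq_of_tendsto

/-! ### Functions vanishing at the boundary -/

variable (m) in
/-- Truncation in the form space. -/
def nclamp (a : ℝ) (ha : 0 ≤ a) (f : G.NSpace m) : G.NSpace m :=
  G.ncontr m (NormalContraction.lipschitz_clamp a) (NormalContraction.clamp_zero ha) f

theorem nclamp_apply {a : ℝ} (ha : 0 ≤ a) (f : G.NSpace m) (x : X) :
    (G.neumann m).incl (nclamp m a ha f) x = NormalContraction.clamp a ((G.neumann m).incl f x) :=
  ncontr_apply _ _ f x

theorem abs_nclamp_le {a : ℝ} (ha : 0 ≤ a) (f : G.NSpace m) (x : X) :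
    |(G.neumann m).incl (nclamp m a ha f) x| ≤ a := by
  rw [nclamp_apply]
  exact NormalContraction.abs_clamp_le ha _

theorem norm_nclamp_le {a : ℝ} (ha : 0 ≤ a) (f : G.NSpace m) : ‖nclamp m a ha f‖ ≤ ‖f‖ :=
  norm_ncontr_le _ _ f

theorem ncontr_mem_dspace {C : ℝ → ℝ} (hC : LipschitzWith 1 C) (h0 : C 0 = 0) {f : G.NSpace m}
    (hf : f ∈ G.dspace m) : G.ncontr m hC h0 f ∈ G.dspace m :=
  mem_dspace_of_abs_le hf fun x => by
    rw [ncontr_apply]; exact NormalContraction.abs_le hC h0 _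

/-- Functions in the domain of the Dirichlet form vanish at the boundary. -/
theorem tendsto_zero_of_mem_dspace {f : G.NSpace m} (hf : f ∈ G.dspace m) (z : G.Boundary m) :
    Tendsto (fun x => (G.neumann m).incl f x) (nb z) (𝓝 0) := by
  have h1 := tendsto_nb (toBdd (nclamp m 1 zero_le_one f) ⟨1, abs_nclamp_le _ f⟩) z
  have h2 : G.trace₀ m (toBdd (nclamp m 1 zero_le_one f) ⟨1, abs_nclamp_le _ f⟩) z = 0 :=
    z.2.2.2 _ ((mem_dspace_iff _).1 (ncontr_mem_dspace _ _ hf))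
  rw [h2] at h1
  refine h1.congr' ?_
  -- Near `z` the truncation at level `1` is small, so there it coincides with `f`.
  have h3 := (tendsto_order.1 h1.abs).2 1 (by simp)
  filter_upwards [h3] with x hx
  change |(G.neumann m).incl (nclamp m 1 zero_le_one f) x| < 1 at hx
  change (G.neumann m).incl (nclamp m 1 zero_le_one f) x = _
  rw [nclamp_apply] at hx ⊢
  exact NormalContraction.eq_clamp_of_abs_clamp_lt hx

theorem isCompact_closure_range : IsCompact (closure (range (G.evalMap m))) := by
  have h : ∀ f : G.BoundedNeumann m, ∃ B : ℝ, ∀ x, |f.1 x| ≤ B := fun f => f.2.2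
  choose B hB using h
  refine (isCompact_univ_pi fun f => isCompact_Icc (a := -B f) (b := B f)).closure_of_subset ?_
  rintro _ ⟨x, rfl⟩ f -
  exact abs_le.1 (hB f x)

/-- A point of `X` is detected by its indicator. Any other point at which all bounded functions of
`D(Q^(D))` vanish belongs to `∂X`, where `f` tends to `0`; it cannot adhere to `{|f| > δ}`. -/
theorem exists_ne_zero_of_notMem {f : G.NSpace m}
    (hf : ∀ z : G.Boundary m, Tendsto (fun x => (G.neumann m).incl f x) (nb z) (𝓝 0)) {δ : ℝ}
    (hδ : 0 < δ) {z : G.BoundedNeumann m → ℝ}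
    (hz : z ∈ closure (G.evalMap m '' {x | δ < |(G.neumann m).incl f x|})) :
    ∃ g : G.BoundedNeumann m, ofBdd g ∈ G.dspace m ∧ z g ≠ 0 := by
  by_cases hr : z ∈ range (G.evalMap m)
  · obtain ⟨x, rfl⟩ := hr
    refine ⟨toBdd (G.nsingle m x) ⟨1, SymmForm.abs_single_le x⟩, nsingle_mem_dspace x, ?_⟩
    change single m x x ≠ 0
    rw [single_self]
    exact one_ne_zero
  · by_contra! hcon
    have hz' : z ∈ closure (range (G.evalMap m)) := closure_mono (image_subset_range _ _) hz
    let w : G.Boundary m := ⟨z, hz', hr, fun g hg => hcon g ((mem_dspace_iff _).2 hg)⟩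
    have h1 := (tendsto_order.1 (hf w).abs).2 δ (by simpa using hδ)
    obtain ⟨V, hV, hV'⟩ := mem_comap.1 h1
    obtain ⟨_, h2, x, hx, rfl⟩ := mem_closure_iff_nhds.1 hz V hV
    have h3 : |(G.neumann m).incl f x| < δ := hV' h2
    exact lt_asymm hx h3

/-- Functions of finite energy vanishing at the boundary belong to the domain of the Dirichlet
form. -/
theorem mem_dspace_of_tendsto_zero {f : G.NSpace m}
    (hf : ∀ z : G.Boundary m, Tendsto (fun x => (G.neumann m).incl f x) (nb z) (𝓝 0)) :
    f ∈ G.dspace m := by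
  have hδ : ∀ n : ℕ, (0 : ℝ) < 1 / (n + 1) := fun n => by positivity
  let e : ℕ → G.NSpace m := fun n => G.ncontr m (NormalContraction.lipschitz_excess (1 / (n + 1)))
    (NormalContraction.excess_zero (hδ n).le) f
  have he : ∀ n x, (G.neumann m).incl (e n) x =
      NormalContraction.excess (1 / (n + 1)) ((G.neumann m).incl f x) := fun n x =>
    ncontr_apply _ _ f x
  -- `s n` is bounded by `n`, vanishes where `|f| ≤ 1/(n+1)`, has form norm at most `‖f‖` and
  -- converges pointwise to `f`.
  let s : ℕ → G.NSpace m := fun n => nclamp m n n.cast_nonneg (e n)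
  refine SymmForm.mem_of_pointwise isClosed_dspace (l := atTop) (u := s) (B := ‖f‖)
    (fun n => (norm_nclamp_le _ _).trans (norm_ncontr_le _ _ f)) (fun n => ?_) fun x => ?_
  · set T := closure (G.evalMap m '' {x | 1 / ((n : ℝ) + 1) < |(G.neumann m).incl f x|}) with hT
    have hTc : IsCompact T := isCompact_closure_range.of_isClosed_subset isClosed_closure
      (closure_mono (image_subset_range _ _))
    -- Compactness of `T` glues the local functions, each scaled by `2/|z g|` to be at least `1`
    -- near `z`. Then `|s n| ≤ n |v|` and the order ideal property applies.
    have key : ∃ v ∈ G.dspace m, ∀ x, G.evalMap m x ∈ T → 1 ≤ |(G.neumann m).incl v x| := by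
      refine hTc.induction_on (p := fun S => ∃ v ∈ G.dspace m, ∀ x, G.evalMap m x ∈ S →
        1 ≤ |(G.neumann m).incl v x|) ⟨0, Submodule.zero_mem _, fun _ h => h.elim⟩ ?_ ?_ ?_
      · rintro S S' h ⟨v, hv, hv'⟩
        exact ⟨v, hv, fun x hx => hv' x (h hx)⟩
      · rintro S S' ⟨v, hv, hv'⟩ ⟨w, hw, hw'⟩
        refine ⟨G.ncontr m NormalContraction.abs abs_zero v +
          G.ncontr m NormalContraction.abs abs_zero w,
          Submodule.add_mem _ (ncontr_mem_dspace _ _ hv) (ncontr_mem_dspace _ _ hw), ?_⟩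
        intro x hx
        rw [map_add, DiscreteL2.add_apply, ncontr_apply, ncontr_apply,
          abs_of_nonneg (by positivity)]
        rcases hx with hx | hx
        · have := hv' x hx; have := abs_nonneg ((G.neumann m).incl w x); linarith
        · have := hw' x hx; have := abs_nonneg ((G.neumann m).incl v x); linarith
      · intro z hz
        obtain ⟨g, hg, hzg⟩ := exists_ne_zero_of_notMem hf (hδ n) hz
        have hp := abs_pos.2 hzg
        refine ⟨{w | |z g| / 2 < |w g|}, mem_nhdsWithin_of_mem_nhds ?_,
          (2 / |z g|) • ofBdd g, Submodule.smul_mem _ _ hg, fun x hx => ?_⟩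
        · refine (isOpen_lt continuous_const (continuous_apply g).abs).mem_nhds ?_
          change |z g| / 2 < |z g|
          linarith
        · change |z g| / 2 < |g.1 x| at hx
          rw [map_smul, DiscreteL2.smul_apply, incl_ofBdd, abs_mul, abs_of_pos (by positivity),
            div_mul_eq_mul_div, le_div_iff₀ hp]
          linarith
    obtain ⟨v, hv, hv'⟩ := key
    refine mem_dspace_of_abs_le (Submodule.smul_mem _ (n : ℝ) hv) fun x => ?_
    rw [map_smul, DiscreteL2.smul_apply, abs_mul, Nat.abs_cast]
    by_cases hx : 1 / ((n : ℝ) + 1) < |(G.neumann m).incl f x|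
    · have h1 := hv' x (subset_closure ⟨x, hx, rfl⟩)
      have h2 := abs_nclamp_le (m := m) n.cast_nonneg (e n) x
      have h3 : (0 : ℝ) ≤ n := n.cast_nonneg
      nlinarith
    · rw [nclamp_apply, he, NormalContraction.excess_eq_zero (not_lt.1 hx),
        NormalContraction.clamp_zero n.cast_nonneg, abs_zero]
      positivity
  · set t := (G.neumann m).incl f x
    have h1 : ∀ᶠ n : ℕ in atTop, (G.neumann m).incl (s n) x =
        NormalContraction.excess (1 / (n + 1)) t := by
      obtain ⟨N, hN⟩ := exists_nat_ge |t|
      filter_upwards [eventually_ge_atTop N] with n hn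
      rw [nclamp_apply, he]
      refine NormalContraction.clamp_eq_self ?_
      refine (NormalContraction.abs_le (NormalContraction.lipschitz_excess _)
        (NormalContraction.excess_zero (hδ n).le) _).trans (hN.trans ?_)
      exact_mod_cast hn
    refine Tendsto.congr' (h1.mono fun n hn => hn.symm) ?_
    rw [tendsto_iff_norm_sub_tendsto_zero]
    refine squeeze_zero (fun _ => norm_nonneg _) (fun n => ?_) tendsto_one_div_add_atTop_nhds_zero_nat
    rw [NormalContraction.excess, Real.norm_eq_abs, sub_sub_cancel_left, abs_neg]
    exact NormalContraction.abs_clamp_le (hδ n).le _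

/-! ## Harmonic extensions -/

theorem mem_dspace_orthogonal_iff (f : G.NSpace m) :
    f ∈ (G.dspace m)ᗮ ↔ ∀ x, inner ℝ (G.nsingle m x) f = 0 := by
  constructor
  · intro h x
    exact (Submodule.mem_orthogonal _ _).1 h _ (nsingle_mem_dspace x)
  · intro h
    have h1 : (finSupp m).comap (G.neumann m).incl.toLinearMap ≤ (ℝ ∙ f)ᗮ := by
      intro g hg
      obtain ⟨K, hK⟩ := exists_eq_cut hg
      have h2 : g = ∑ x ∈ K, (G.neumann m).incl g x • G.nsingle m x := by
        refine (G.neumann m).incl_injective ?_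
        rw [map_sum]
        exact hK K subset_rfl
      rw [Submodule.mem_orthogonal_singleton_iff_inner_left, h2, sum_inner]
      refine Finset.sum_eq_zero fun x _ => ?_
      rw [inner_smul_left, h, mul_zero]
    have h2 : G.dspace m ≤ (ℝ ∙ f)ᗮ :=
      Submodule.topologicalClosure_minimal _ h1 (Submodule.isClosed_orthogonal _)
    rw [Submodule.mem_orthogonal]
    intro u hu
    exact Submodule.mem_orthogonal_singleton_iff_inner_left.1 (h2 hu)

/-- A function of finite energy is `1`-harmonic iff it is orthogonal to the domain of the Dirichlet
form. -/
theorem isOneHarmonic_iff (f : G.NSpace m) :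
    G.IsOneHarmonic m ((G.neumann m).incl f) ↔ f ∈ (G.dspace m)ᗮ := by
  rw [mem_dspace_orthogonal_iff, IsOneHarmonic,
    and_iff_right (mem_laplacianDomain ((G.neumann m).incl_mem f))]
  refine forall_congr' fun x => ?_
  rw [inner_nsingle, mul_eq_zero, or_iff_right (mass_pos x).ne']

variable (G m) in
/-- The harmonic part of a function in the form domain. -/
def harm : G.NSpace m →L[ℝ] G.NSpace m :=
  ContinuousLinearMap.id ℝ _ - (G.dspace m).starProjection

theorem harm_mem (f : G.NSpace m) : G.harm m f ∈ (G.dspace m)ᗮ :=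
  (G.dspace m).sub_starProjection_mem_orthogonal f

theorem sub_harm_mem (f : G.NSpace m) : f - G.harm m f ∈ G.dspace m := by
  have : f - G.harm m f = (G.dspace m).starProjection f := by simp [harm]
  rw [this]
  exact (G.dspace m).starProjection_apply_mem f

theorem inner_dspace_harm {f : G.NSpace m} (hf : f ∈ G.dspace m) {h : G.NSpace m}
    (hh : h ∈ (G.dspace m)ᗮ) : inner ℝ f h = 0 := (Submodule.mem_orthogonal _ _).1 hh _ hf

theorem eq_harm {f h : G.NSpace m} (hh : h ∈ (G.dspace m)ᗮ) (hd : f - h ∈ G.dspace m) :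
    h = G.harm m f := by
  have h1 : h - G.harm m f ∈ (G.dspace m)ᗮ := Submodule.sub_mem _ hh (harm_mem f)
  have h2 : h - G.harm m f ∈ G.dspace m := by
    have := Submodule.sub_mem _ (sub_harm_mem f) hd
    rwa [sub_sub_sub_cancel_left] at this
  exact sub_eq_zero.1 (inner_self_eq_zero.1 (inner_dspace_harm h2 h1))

theorem harm_eq_zero_iff (f : G.NSpace m) : G.harm m f = 0 ↔ f ∈ G.dspace m := by
  constructor
  · intro h
    simpa [h] using sub_harm_mem f
  · intro h
    exact (eq_harm (Submodule.zero_mem _) (by simpa using h)).symm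

theorem norm_sq_eq_harm (f : G.NSpace m) :
    ‖f‖ ^ 2 = ‖G.harm m f‖ ^ 2 + ‖f - G.harm m f‖ ^ 2 := by
  have h := norm_add_sq_real (f - G.harm m f) (G.harm m f)
  rw [sub_add_cancel, inner_dspace_harm (sub_harm_mem f) (harm_mem f)] at h
  linarith

theorem norm_harm_le (f : G.NSpace m) : ‖G.harm m f‖ ≤ ‖f‖ := by
  refine le_of_sq_le_sq ?_ (norm_nonneg _)
  rw [norm_sq_eq_harm f]
  linarith [sq_nonneg ‖f - G.harm m f‖]

theorem tendsto_harm {f : G.NSpace m} {z : G.Boundary m} {a : ℝ}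
    (h : Tendsto (fun x => (G.neumann m).incl f x) (nb z) (𝓝 a)) :
    Tendsto (fun x => (G.neumann m).incl (G.harm m f) x) (nb z) (𝓝 a) := by
  have h1 := h.sub (tendsto_zero_of_mem_dspace (sub_harm_mem f) z)
  rw [sub_zero] at h1
  refine h1.congr fun x => ?_
  rw [map_sub, DiscreteL2.sub_apply, sub_sub_cancel]

/-- The maximum principle for harmonic extensions. -/
theorem harm_le {f : G.NSpace m} {M : ℝ} (hM : 0 ≤ M) (hf : ∀ z : G.Boundary m, ∃ a ≤ M,
    Tendsto (fun x => (G.neumann m).incl f x) (nb z) (𝓝 a)) (x : X) :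
    (G.neumann m).incl (G.harm m f) x ≤ M := by
  set h := G.harm m f
  set u := G.ncontr m (NormalContraction.lipschitz_above M) (NormalContraction.above_zero hM) h
    with hu
  have hux : ∀ x, (G.neumann m).incl u x = NormalContraction.above M ((G.neumann m).incl h x) :=
    ncontr_apply _ _ h
  have hud : u ∈ G.dspace m := by
    refine mem_dspace_of_tendsto_zero fun z => ?_
    obtain ⟨a, ha, hfa⟩ := hf z
    have h1 := ((NormalContraction.lipschitz_above M).continuous.tendsto a).comp (tendsto_harm hfa)
    rw [show NormalContraction.above M a = 0 from max_eq_right (sub_nonpos.2 ha)] at h1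
    exact h1.congr fun x => (hux x).symm
  have hC : LipschitzWith 1 fun t : ℝ => min t M := LipschitzWith.id.min_const M
  -- `h - u` is `min h M`, so `‖h - u‖ ≤ ‖h‖`. But `u ∈ D(Q^(D))` is orthogonal to `h`, so `‖h - u‖²
  -- = ‖h‖² + ‖u‖²`, forcing `u = 0`.
  have h2 : h - u = G.ncontr m hC (min_eq_left hM) h := by
    refine SymmForm.formSpace_ext _ fun x => ?_
    rw [map_sub, DiscreteL2.sub_apply, hux, ncontr_apply, NormalContraction.above]
    rcases le_total ((G.neumann m).incl h x) M with h3 | h3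
    · rw [max_eq_right (sub_nonpos.2 h3), min_eq_left h3, sub_zero]
    · rw [max_eq_left (sub_nonneg.2 h3), min_eq_right h3, sub_sub_cancel]
  have h3 := norm_ncontr_le hC (min_eq_left hM) h
  rw [← h2] at h3
  have h4 := norm_sub_sq_real h u
  rw [real_inner_comm, inner_dspace_harm hud (harm_mem f)] at h4
  have h5 : ‖u‖ ^ 2 ≤ 0 := by
    have := pow_le_pow_left₀ (norm_nonneg _) h3 2
    linarith
  have h6 : u = 0 := by
    rw [← norm_eq_zero]
    exact pow_eq_zero_iff two_ne_zero |>.1 (le_antisymm h5 (by positivity))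
  have h7 := hux x
  rw [h6, map_zero, DiscreteL2.zero_apply] at h7
  have h8 := le_max_left ((G.neumann m).incl h x - M) 0
  rw [NormalContraction.above] at h7
  linarith

theorem harm_nonneg {f : G.NSpace m} (hf : ∀ x, 0 ≤ (G.neumann m).incl f x)
    (hb : ∃ B : ℝ, ∀ x, |(G.neumann m).incl f x| ≤ B) (x : X) :
    0 ≤ (G.neumann m).incl (G.harm m f) x := by
  have h := harm_le (f := -f) le_rfl (fun z => ?_) x
  · rw [map_neg, map_neg, DiscreteL2.neg_apply] at h
    linarith
  · have h1 := tendsto_nb (toBdd f hb) z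
    refine ⟨-G.trace₀ m (toBdd f hb) z, ?_, ?_⟩
    · exact neg_nonpos.2 (ge_of_tendsto h1 (Eventually.of_forall hf))
    · refine h1.neg.congr fun x => ?_
      rw [map_neg, DiscreteL2.neg_apply]; rfl

theorem abs_harm_le {f : G.NSpace m} {B : ℝ} (hB0 : 0 ≤ B)
    (hB : ∀ x, |(G.neumann m).incl f x| ≤ B) (x : X) :
    |(G.neumann m).incl (G.harm m f) x| ≤ B := by
  have h1 : ∀ z : G.Boundary m, Tendsto (fun x => (G.neumann m).incl f x) (nb z)
    (𝓝 (G.trace₀ m (toBdd f ⟨B, hB⟩) z)) := tendsto_nb (toBdd f ⟨B, hB⟩)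
  refine abs_le.2 ⟨?_, harm_le hB0 (fun z => ⟨_, ?_, h1 z⟩) x⟩
  · have h := harm_le (f := -f) hB0 (fun z => ⟨_, ?_, (h1 z).neg.congr fun x => ?_⟩) x
    · rw [map_neg, map_neg, DiscreteL2.neg_apply] at h
      linarith
    · exact le_of_tendsto (h1 z).neg (Eventually.of_forall fun x => by
        have := abs_le.1 (hB x); linarith)
    · rw [map_neg, DiscreteL2.neg_apply]
  · exact le_of_tendsto (h1 z) (Eventually.of_forall fun x => (abs_le.1 (hB x)).2)

end WGraph

namespace WGraph

open DiscreteL2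

/-! ## Existence of harmonic measures -/

/-- The sublinear functional `sup φ⁺`. -/
def posSup {Y : Type*} [TopologicalSpace Y] [CompactSpace Y] (φ : C(Y, ℝ)) : ℝ := ‖φ ⊔ 0‖

section posSup

variable {Y : Type*} [TopologicalSpace Y] [CompactSpace Y]

theorem le_posSup (φ : C(Y, ℝ)) (y : Y) : φ y ≤ posSup φ :=
  (le_max_left _ _).trans ((le_abs_self _).trans ((φ ⊔ 0).norm_coe_le_norm y))

theorem posSup_nonneg (φ : C(Y, ℝ)) : 0 ≤ posSup φ := norm_nonneg _

theorem posSup_le {φ : C(Y, ℝ)} {M : ℝ} (hM : 0 ≤ M) (h : ∀ y, φ y ≤ M) : posSup φ ≤ M := by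
  refine (ContinuousMap.norm_le _ hM).2 fun y => ?_
  rw [ContinuousMap.sup_apply, ContinuousMap.zero_apply, Real.norm_eq_abs,
    abs_of_nonneg (le_max_right _ _)]
  exact max_le (h y) hM

theorem posSup_smul {c : ℝ} (hc : 0 < c) (φ : C(Y, ℝ)) : posSup (c • φ) = c * posSup φ := by
  refine le_antisymm (posSup_le (mul_nonneg hc.le (posSup_nonneg _)) fun y => ?_) ?_
  · exact mul_le_mul_of_nonneg_left (le_posSup φ y) hc.le
  · rw [← le_div_iff₀' hc]
    refine posSup_le (div_nonneg (posSup_nonneg _) hc.le) fun y => ?_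
    rw [le_div_iff₀' hc]
    exact le_posSup (c • φ) y

theorem posSup_add (φ ψ : C(Y, ℝ)) : posSup (φ + ψ) ≤ posSup φ + posSup ψ :=
  posSup_le (add_nonneg (posSup_nonneg _) (posSup_nonneg _)) fun y =>
    add_le_add (le_posSup φ y) (le_posSup ψ y)

end posSup

/-- A linear functional bounded by `sup φ⁺` is given by a regular subprobability measure. -/
theorem exists_measure_of_le_posSup {Y : Type*} [TopologicalSpace Y] [CompactSpace Y] [T2Space Y]
    [MeasurableSpace Y] [BorelSpace Y] (Λ : C(Y, ℝ) →ₗ[ℝ] ℝ) (hΛ : ∀ φ, Λ φ ≤ posSup φ) :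
    ∃ ρ : Measure Y, ρ.Regular ∧ ρ univ ≤ 1 ∧ ∀ φ : C(Y, ℝ), ∫ y, φ y ∂ρ = Λ φ := by
  have hpos : ∀ φ : C(Y, ℝ), (∀ y, 0 ≤ φ y) → 0 ≤ Λ φ := by
    intro φ hφ
    have h1 := (hΛ (-φ)).trans (posSup_le le_rfl fun y => neg_nonpos.2 (hφ y))
    rw [map_neg] at h1
    linarith
  let Λ₀ : CompactlySupportedContinuousMap Y ℝ →ₗ[ℝ] ℝ :=
    { toFun := fun f => Λ f.toContinuousMap
      map_add' := fun f g => Λ.map_add f.toContinuousMap g.toContinuousMap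
      map_smul' := fun c f => Λ.map_smul c f.toContinuousMap }
  let Λ' : CompactlySupportedContinuousMap Y ℝ →ₚ[ℝ] ℝ :=
    PositiveLinearMap.mk₀ Λ₀ fun f hf => hpos f.toContinuousMap fun y => hf y
  have hint : ∀ φ : C(Y, ℝ), ∫ y, φ y ∂(RealRMK.rieszMeasure Λ') = Λ φ := fun φ =>
    RealRMK.integral_rieszMeasure Λ' (CompactlySupportedContinuousMap.continuousMapEquiv φ)
  refine ⟨RealRMK.rieszMeasure Λ', inferInstance, ?_, hint⟩
  have h1 := hint 1
  have h2 : Λ 1 ≤ 1 := (hΛ 1).trans (posSup_le zero_le_one fun y => le_rfl)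
  rw [← h1] at h2
  simp only [ContinuousMap.one_apply, integral_const, smul_eq_mul, mul_one] at h2
  rw [measureReal_def] at h2
  rw [← ENNReal.ofReal_toReal (measure_ne_top (RealRMK.rieszMeasure Λ') univ),
    ← ENNReal.ofReal_one]
  exact ENNReal.ofReal_le_ofReal h2

variable {X : Type*} [MeasurableSpace X] {m : Measure X} [IsDiscreteMeasure m] {G : WGraph X}

instance : T2Space (G.Boundary m) := inferInstanceAs (T2Space (Subtype _))

theorem continuous_trace₀ (f : G.BoundedNeumann m) : Continuous (G.trace₀ m f) :=
  (continuous_apply f).comp continuous_subtype_val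

variable [Countable X] [DiscreteMeasurableSpace X]

/-- The condition of not being in `X` is automatic, since the indicator of `x` lies in `D(Q^(D))`
and is `1` at `x`. What remains is closed in the compactification. -/
instance : CompactSpace (G.Boundary m) := by
  have h : {z : G.BoundedNeumann m → ℝ | z ∈ closure (range (G.evalMap m)) ∧
      z ∉ range (G.evalMap m) ∧ ∀ f, f.1 ∈ (G.dirichlet m).dom → z f = 0} =
      closure (range (G.evalMap m)) ∩ {z | ∀ f, f.1 ∈ (G.dirichlet m).dom → z f = 0} := by
    ext z
    constructor
    · exact fun hz => ⟨hz.1, hz.2.2⟩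
    · rintro ⟨h1, h2⟩
      refine ⟨h1, ?_, h2⟩
      rintro ⟨x, rfl⟩
      have h3 := h2 (toBdd (G.nsingle m x) ⟨1, SymmForm.abs_single_le x⟩)
        ((mem_dspace_iff _).1 (nsingle_mem_dspace x))
      change single m x x = 0 at h3
      rw [single_self] at h3
      exact one_ne_zero h3
  have hc : IsClosed {z : G.BoundedNeumann m → ℝ | ∀ f, f.1 ∈ (G.dirichlet m).dom → z f = 0} := by
    simp only [Set.ofPred_forall]
    exact isClosed_iInter fun f => isClosed_iInter fun _ =>
      isClosed_eq (continuous_apply f) continuous_const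
  have h2 := isCompact_closure_range.inter_right hc
  rw [← h] at h2
  exact isCompact_iff_compactSpace.1 h2

variable (G m) in
/-- The bounded functions in the form space. -/
def bddSpace : Submodule ℝ (G.NSpace m) where
  carrier := {f | ∃ B : ℝ, ∀ x, |(G.neumann m).incl f x| ≤ B}
  add_mem' := by
    rintro f g ⟨A, hA⟩ ⟨B, hB⟩
    refine ⟨A + B, fun x => ?_⟩
    rw [map_add, DiscreteL2.add_apply]
    exact (abs_add_le _ _).trans (add_le_add (hA x) (hB x))
  zero_mem' := ⟨0, fun x => by rw [map_zero, DiscreteL2.zero_apply, abs_zero]⟩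
  smul_mem' := by
    rintro c f ⟨B, hB⟩
    refine ⟨|c| * B, fun x => ?_⟩
    rw [map_smul, DiscreteL2.smul_apply, abs_mul]
    exact mul_le_mul_of_nonneg_left (hB x) (abs_nonneg c)

variable (G m) in
/-- The boundary values of bounded functions, as a linear map. -/
def traceC : G.bddSpace m →ₗ[ℝ] C(G.Boundary m, ℝ) where
  toFun f := ⟨G.trace₀ m (toBdd f.1 f.2), continuous_trace₀ _⟩
  map_add' f g := by
    ext z
    refine tendsto_nhds_unique (tendsto_nb (toBdd (f + g).1 (f + g).2) z) ?_
    refine ((tendsto_nb (toBdd f.1 f.2) z).add (tendsto_nb (toBdd g.1 g.2) z)).congr fun x => ?_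
    exact (DiscreteL2.add_apply _ _ x).symm
  map_smul' c f := by
    ext z
    refine tendsto_nhds_unique (tendsto_nb (toBdd (c • f).1 (c • f).2) z) ?_
    refine ((tendsto_nb (toBdd f.1 f.2) z).const_mul c).congr fun x => ?_
    exact (DiscreteL2.smul_apply _ _ x).symm

theorem tendsto_traceC (f : G.bddSpace m) (z : G.Boundary m) :
    Tendsto (fun x => (G.neumann m).incl f.1 x) (nb z) (𝓝 (G.traceC m f z)) :=
  tendsto_nb (toBdd f.1 f.2) z

variable (m) in
/-- The value of the harmonic extension at a point, as a linear map. -/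
def harmEval (x : X) : G.bddSpace m →ₗ[ℝ] ℝ where
  toFun f := (G.neumann m).incl (G.harm m f.1) x
  map_add' f g := by
    rw [Submodule.coe_add, map_add, map_add, DiscreteL2.add_apply]
  map_smul' c f := by
    rw [Submodule.coe_smul, map_smul, map_smul, DiscreteL2.smul_apply]; rfl

theorem harmEval_le (x : X) (f : G.bddSpace m) : harmEval m x f ≤ posSup (G.traceC m f) :=
  harm_le (posSup_nonneg _) (fun z => ⟨_, le_posSup _ z, tendsto_traceC f z⟩) x

/-- By the maximum principle the value at `x` of the harmonic extension depends only on the boundary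
values and is dominated by `sup φ⁺`. Hahn–Banach extends it with the same domination, which encodes
both positivity and total mass at most `1`. -/
theorem exists_functional (x : X) : ∃ Λ : C(G.Boundary m, ℝ) →ₗ[ℝ] ℝ,
    (∀ φ, Λ φ ≤ posSup φ) ∧ ∀ f : G.bddSpace m, Λ (G.traceC m f) = harmEval m x f := by
  set g : Submodule ℝ (C(G.Boundary m, ℝ) × ℝ) := LinearMap.range ((G.traceC m).prod (harmEval m x))
  have hg : ∀ p ∈ g, p.1 = 0 → p.2 = 0 := by
    rintro _ ⟨f, rfl⟩ h0
    change G.traceC m f = 0 at h0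
    change harmEval m x f = 0
    have h1 := harmEval_le x f
    have h2 := harmEval_le x (-f)
    rw [map_neg, map_neg, h0] at h2
    rw [h0] at h1
    have h3 : posSup (0 : C(G.Boundary m, ℝ)) ≤ 0 := posSup_le le_rfl fun _ => le_rfl
    rw [neg_zero] at h2
    linarith
  obtain ⟨Λ, h1, h2⟩ := exists_extension_of_le_sublinear g.toLinearPMap posSup
    (fun c hc φ => posSup_smul hc φ) posSup_add (fun φ => by
      obtain ⟨f, hf⟩ := Submodule.mem_graph_toLinearPMap hg φ
      have e1 : G.traceC m f = φ := congrArg Prod.fst hf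
      have e2 : harmEval m x f = g.toLinearPMap φ := congrArg Prod.snd hf
      rw [← e1, ← e2]
      exact harmEval_le x f)
  refine ⟨Λ, h2, fun f => ?_⟩
  have hmem : G.traceC m f ∈ g.toLinearPMap.domain := ⟨_, ⟨f, rfl⟩, rfl⟩
  have h3 := h1 ⟨_, hmem⟩
  obtain ⟨f', hf'⟩ := Submodule.mem_graph_toLinearPMap hg ⟨_, hmem⟩
  have e1 : G.traceC m f' = G.traceC m f := congrArg Prod.fst hf'
  have e2 : harmEval m x f' = g.toLinearPMap ⟨_, hmem⟩ := congrArg Prod.snd hf'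
  have h4 := hg _ ⟨f' - f, rfl⟩ (by change G.traceC m (f' - f) = 0; rw [map_sub, e1, sub_self])
  change harmEval m x (f' - f) = 0 at h4
  rw [map_sub, sub_eq_zero] at h4
  exact h3.trans (e2.symm.trans h4)

/-- Harmonic extensions of the boundary values of bounded functions are given by orthogonal
projection. -/
theorem eq_harm_of_isHarmonicExtension (f : G.BoundedNeumann m) {h : Lp ℝ 2 m}
    (hh : G.IsHarmonicExtension m (G.trace m f.1) h) :
    h = (G.neumann m).incl (G.harm m (ofBdd f)) := by
  obtain ⟨h1, h2, h3⟩ := hh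
  have key : (G.neumann m).ofMem h1 = G.harm m (ofBdd f) := by
    refine eq_harm ((isOneHarmonic_iff ((G.neumann m).ofMem h1)).1 h2)
      (mem_dspace_of_tendsto_zero fun z => ?_)
    have h4 := congrFun h3 z
    rw [trace_coe] at h4
    have h5 := (trace_eq_coe_iff ((G.neumann m).ofMem h1) z _).1 h4
    have h6 := (tendsto_nb f z).sub h5
    rw [sub_self] at h6
    refine h6.congr fun x => ?_
    rw [map_sub, DiscreteL2.sub_apply]
    rfl
  rw [← key]
  rfl

/-- Restricting the Riesz measure to the complement of the common zero set `Z` of all boundary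
functions changes none of the integrals and ensures `no_mass`. -/
theorem exists_isHarmonicMeasure (x : X) : ∃ μ, G.IsHarmonicMeasure m x μ := by
  obtain ⟨Λ, h1, h2⟩ := exists_functional (G := G) (m := m) x
  obtain ⟨ρ, hreg, hone, hint⟩ := exists_measure_of_le_posSup Λ h1
  set Z : Set (G.Boundary m) := {z | ∀ f, G.trace₀ m f z = 0} with hZ
  have hZc : IsClosed Z := by
    simp only [hZ, Set.ofPred_forall]
    exact isClosed_iInter fun f => isClosed_eq (continuous_trace₀ f) continuous_const
  have hfin : IsFiniteMeasure ρ := ⟨hone.trans_lt ENNReal.one_lt_top⟩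
  refine ⟨ρ.restrict Zᶜ, Measure.Regular.restrict_of_measure_ne_top (measure_ne_top _ _), ?_, ?_, ?_⟩
  · exact (Measure.restrict_le_self univ).trans hone
  · intro f h hh
    have h3 : ∫ z in Zᶜ, G.trace₀ m f z ∂ρ = ∫ z, G.trace₀ m f z ∂ρ :=
      setIntegral_eq_integral_of_forall_compl_eq_zero fun z hz => (not_not.1 hz) f
    rw [h3, eq_harm_of_isHarmonicExtension f hh]
    have h4 := h2 ⟨ofBdd f, f.2.2⟩
    rw [← hint] at h4
    exact h4.symm
  · intro z hz
    rw [Measure.restrict_apply' hZc.measurableSet.compl]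
    have : {z} ∩ Zᶜ = ∅ := by
      ext y
      simp only [mem_inter_iff, mem_singleton_iff, mem_compl_iff, mem_empty_iff_false, iff_false,
        not_and, not_not]
      rintro rfl
      exact hz
    rw [this, measure_empty]

theorem isHarmonicMeasure_harmonicMeasure (x : X) :
    G.IsHarmonicMeasure m x (G.harmonicMeasure m x) := by
  rw [harmonicMeasure, dif_pos (exists_isHarmonicMeasure x)]
  exact (exists_isHarmonicMeasure x).choose_spec

instance (x : X) : IsFiniteMeasure (G.harmonicMeasure m x) :=
  ⟨(isHarmonicMeasure_harmonicMeasure x).le_one.trans_lt ENNReal.one_lt_top⟩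

/-- The harmonic part of a bounded function is the integral of its boundary values. -/
theorem harm_eq_integral (f : G.BoundedNeumann m) (x : X) :
    (G.neumann m).incl (G.harm m (ofBdd f)) x =
      ∫ z, G.trace₀ m f z ∂(G.harmonicMeasure m x) := by
  refine (isHarmonicMeasure_harmonicMeasure x).eq_integral f _
    ⟨(G.neumann m).incl_mem _, (isOneHarmonic_iff _).2 (harm_mem _), ?_⟩
  funext z
  rw [trace_coe]
  exact trace_eq_of_tendsto (tendsto_harm (f := ofBdd f) (tendsto_nb f z))

/-! ## Boundary values are square integrable -/

/-- The energy estimate for squares of harmonic functions. -/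
theorem two_inner_sub_le {h h2 w hw : G.NSpace m} {a : ℝ}
    (e2 : ∀ x, (G.neumann m).incl h2 x = (G.neumann m).incl h x * (G.neumann m).incl h x)
    (ew : ∀ x, (G.neumann m).incl hw x = (G.neumann m).incl h x * (G.neumann m).incl w x)
    (hw0 : ∀ x, 0 ≤ (G.neumann m).incl w x) (hwa : ∀ x, (G.neumann m).incl w x ≤ a) :
    2 * inner ℝ h hw - inner ℝ h2 w ≤ 2 * a * ‖h‖ ^ 2 := by
  have h1 : 2 * (G.neumann m).fm h hw - (G.neumann m).fm h2 w ≤ 2 * a * (G.neumann m).fm h h := by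
    refine hasSum_le (fun i => ?_) (((hasSum_fm h hw).mul_left 2).sub (hasSum_fm h2 w))
      ((hasSum_fm_self h).mul_left (2 * a))
    have hwt := G.weight_nonneg i
    suffices hi : 2 * (grad ((G.neumann m).incl h) i * grad ((G.neumann m).incl hw) i) -
        grad ((G.neumann m).incl h2) i * grad ((G.neumann m).incl w) i ≤
        2 * a * grad ((G.neumann m).incl h) i ^ 2 by
      have := mul_le_mul_of_nonneg_left hi hwt
      linarith
    rcases i with p | x
    -- On an edge with values `s, t` of `h` and `w₁, w₂` of `w`, the left side equals `(s - t)² (w₁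
    -- + w₂)`.
    · simp only [grad, Sum.elim_inl, e2, ew]
      have h3 := hw0 p.1
      have h4 := hw0 p.2
      have h5 := hwa p.1
      have h6 := hwa p.2
      have h7 := sq_nonneg ((G.neumann m).incl h p.1 - (G.neumann m).incl h p.2)
      nlinarith
    · simp only [grad, Sum.elim_inr, e2, ew]
      have h5 := hwa x
      have h3 := hw0 x
      have h7 := sq_nonneg ((G.neumann m).incl h x)
      nlinarith
  have h2' : 2 * inner ℝ ((G.neumann m).incl h) ((G.neumann m).incl hw)
      - inner ℝ ((G.neumann m).incl h2) ((G.neumann m).incl w)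
      ≤ 2 * a * ‖(G.neumann m).incl h‖ ^ 2 := by
    refine hasSum_le (fun x => ?_) (((hasSum_inner ((G.neumann m).incl h) ((G.neumann m).incl hw)).mul_left
      2).sub (hasSum_inner ((G.neumann m).incl h2) ((G.neumann m).incl w)))
      ((hasSum_norm_sq ((G.neumann m).incl h)).mul_left (2 * a))
    have hm := (mass_pos (m := m) x).le
    rw [e2, ew]
    have h5 := hwa x
    have h3 := hw0 x
    have h7 := mul_nonneg hm (sq_nonneg ((G.neumann m).incl h x))
    nlinarith
  rw [SymmForm.inner_eq, SymmForm.inner_eq, SymmForm.norm_sq_eq]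
  linarith

/-- The truncation `C` is monotone and `1`-Lipschitz, so `(C s - C u)² ≤ (s - u)(C s - C u)`; sum
over edges and vertices. -/
theorem norm_sq_clampPos_le {a : ℝ} (ha : 0 ≤ a) (t : G.NSpace m) :
    ‖G.ncontr m (NormalContraction.lipschitz_clampPos a) (NormalContraction.clampPos_zero ha) t‖ ^ 2 ≤
      inner ℝ t (G.ncontr m (NormalContraction.lipschitz_clampPos a)
        (NormalContraction.clampPos_zero ha) t) := by
  set w := G.ncontr m (NormalContraction.lipschitz_clampPos a) (NormalContraction.clampPos_zero ha) t
  have hw : ∀ x, (G.neumann m).incl w x = NormalContraction.clampPos a ((G.neumann m).incl t x) :=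
    ncontr_apply _ _ t
  have key : ∀ s u : ℝ, (NormalContraction.clampPos a s - NormalContraction.clampPos a u) ^ 2 ≤
      (s - u) * (NormalContraction.clampPos a s - NormalContraction.clampPos a u) := by
    intro s u
    have h1 := NormalContraction.abs_sub_le (NormalContraction.lipschitz_clampPos a) s u
    rcases le_total u s with h | h
    · have h2 : NormalContraction.clampPos a u ≤ NormalContraction.clampPos a s := by
        unfold NormalContraction.clampPos; gcongr
      rw [abs_of_nonneg (sub_nonneg.2 h2), abs_of_nonneg (sub_nonneg.2 h)] at h1
      nlinarith
    · have h2 : NormalContraction.clampPos a s ≤ NormalContraction.clampPos a u := by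
        unfold NormalContraction.clampPos; gcongr
      rw [abs_of_nonpos (sub_nonpos.2 h2), abs_of_nonpos (sub_nonpos.2 h)] at h1
      nlinarith
  have key0 : ∀ s : ℝ, NormalContraction.clampPos a s ^ 2 ≤ s * NormalContraction.clampPos a s := by
    intro s
    simpa [NormalContraction.clampPos_zero ha] using key s 0
  rw [SymmForm.norm_sq_eq, SymmForm.inner_eq]
  refine add_le_add ?_ ?_
  · refine hasSum_le (fun i => ?_) (hasSum_fm_self w) (hasSum_fm t w)
    rw [mul_assoc]
    refine mul_le_mul_of_nonneg_left ?_ (G.weight_nonneg i)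
    rcases i with p | x
    · simp only [grad, Sum.elim_inl, hw]; exact key _ _
    · simp only [grad, Sum.elim_inr, hw]; exact key0 _
  · refine hasSum_le (fun x => ?_) (hasSum_norm_sq _) (hasSum_inner _ _)
    rw [mul_assoc, hw]
    exact mul_le_mul_of_nonneg_left (key0 _) (mass_pos (m := m) x).le

/-- The harmonic extension of the square of a bounded harmonic function. -/
theorem harm_sq_le {h h2 : G.NSpace m} (hh : h ∈ (G.dspace m)ᗮ) {B : ℝ}
    (hB : ∀ x, |(G.neumann m).incl h x| ≤ B)
    (e2 : ∀ x, (G.neumann m).incl h2 x = (G.neumann m).incl h x * (G.neumann m).incl h x) (x : X) :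
    m.real {x} * (G.neumann m).incl (G.harm m h2) x ≤ 3 * ‖h‖ ^ 2 := by
  have hm := mass_pos (m := m) x
  have h0 : m.real {x} * (G.neumann m).incl h2 x ≤ ‖h‖ ^ 2 := by
    rw [e2, ← pow_two]
    exact (mass_mul_sq_le _ x).trans (pow_le_pow_left₀ (norm_nonneg _) ((G.neumann m).norm_incl_le h) 2)
  -- It remains to bound `a = t x` by `2‖h‖²/m(x)`; together with `m(x) h(x)² ≤ ‖h‖²` this gives the
  -- constant `3`. The test function is `t` truncated to `[0, a]`.
  set t : G.NSpace m := G.harm m h2 - h2 with ht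
  have htd : t ∈ G.dspace m := by
    rw [ht, ← neg_sub]; exact Submodule.neg_mem _ (sub_harm_mem h2)
  have htx : (G.neumann m).incl (G.harm m h2) x = (G.neumann m).incl t x + (G.neumann m).incl h2 x := by
    rw [ht, map_sub, DiscreteL2.sub_apply, sub_add_cancel]
  set a := (G.neumann m).incl t x with ha
  rcases le_or_gt a 0 with ha0 | ha0
  · rw [htx]
    nlinarith [sq_nonneg ‖h‖]
  set w := G.ncontr m (NormalContraction.lipschitz_clampPos a) (NormalContraction.clampPos_zero ha0.le) t
  have hwd : w ∈ G.dspace m := ncontr_mem_dspace _ _ htd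
  have hwx : ∀ y, (G.neumann m).incl w y = NormalContraction.clampPos a ((G.neumann m).incl t y) :=
    ncontr_apply _ _ t
  have hw0 : ∀ y, 0 ≤ (G.neumann m).incl w y := fun y => by rw [hwx]; exact le_max_left _ _
  have hwa : ∀ y, (G.neumann m).incl w y ≤ a := fun y => by
    rw [hwx]; exact max_le ha0.le (min_le_right _ _)
  obtain ⟨hw, hhw⟩ := exists_mul hB (g := w) (B := a) fun y => by
    rw [abs_of_nonneg (hw0 y)]; exact hwa y
  have hhwd : hw ∈ G.dspace m := by
    refine mem_dspace_of_abs_le (Submodule.smul_mem _ B hwd) fun y => ?_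
    rw [hhw, map_smul, DiscreteL2.smul_apply, abs_mul, abs_mul]
    exact mul_le_mul_of_nonneg_right ((hB y).trans (le_abs_self B)) (abs_nonneg _)
  have h3 : m.real {x} * a ^ 2 ≤ ‖w‖ ^ 2 := by
    have h4 := mass_mul_sq_le ((G.neumann m).incl w) x
    rw [hwx, ← ha, NormalContraction.clampPos, min_self, max_eq_right ha0.le] at h4
    exact h4.trans (pow_le_pow_left₀ (norm_nonneg _) ((G.neumann m).norm_incl_le w) 2)
  -- Both `w` and `h w` lie in `D(Q^(D))`: the first is orthogonal to the harmonic part of `h²`, and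
  -- the second is orthogonal to `h`, so `2⟨h, h w⟩ = 0` may be inserted.
  have h4 : inner ℝ t w = 2 * inner ℝ h hw - inner ℝ h2 w := by
    rw [ht, inner_sub_left, real_inner_comm, inner_dspace_harm hwd (harm_mem h2),
      real_inner_comm hw h, inner_dspace_harm hhwd hh]
    ring
  have h5 := norm_sq_clampPos_le ha0.le t
  have h6 := two_inner_sub_le e2 hhw hw0 hwa
  have h7 : m.real {x} * a ^ 2 ≤ 2 * a * ‖h‖ ^ 2 := h3.trans (h5.trans (h4.le.trans h6))
  have h8 : m.real {x} * a ≤ 2 * ‖h‖ ^ 2 := by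
    refine le_of_mul_le_mul_right ?_ ha0
    nlinarith
  rw [htx]
  linarith

/-- Replace `f` by its harmonic part `h`: then `h²` has boundary values `(γ f)²`, and the integral
is the value at `x` of its harmonic extension. -/
theorem integral_trace₀_sq_le (f : G.BoundedNeumann m) (x : X) :
    m.real {x} * ∫ z, G.trace₀ m f z ^ 2 ∂(G.harmonicMeasure m x) ≤ 3 * ‖ofBdd f‖ ^ 2 := by
  obtain ⟨B, hB⟩ := f.2.2
  set h := G.harm m (ofBdd f)
  have hhB : ∀ x, |(G.neumann m).incl h x| ≤ |B| :=
    abs_harm_le (abs_nonneg B) fun x => (hB x).trans (le_abs_self B)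
  obtain ⟨h2, hh2⟩ := exists_mul hhB hhB
  have hb2 : ∃ C : ℝ, ∀ x, |(G.neumann m).incl h2 x| ≤ C :=
    ⟨|B| * |B|, fun x => by rw [hh2, abs_mul]; exact mul_le_mul (hhB x) (hhB x) (abs_nonneg _) (abs_nonneg _)⟩
  have e1 : ∀ z, G.trace₀ m (toBdd h2 hb2) z = G.trace₀ m f z ^ 2 := by
    intro z
    have h3 : Tendsto (fun x => (G.neumann m).incl h x) (nb z) (𝓝 (G.trace₀ m f z)) :=
      tendsto_harm (f := ofBdd f) (tendsto_nb f z)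
    refine tendsto_nhds_unique (tendsto_nb (toBdd h2 hb2) z) ((h3.pow 2).congr fun x => ?_)
    rw [pow_two, ← hh2]; rfl
  have h4 := harm_eq_integral (toBdd h2 hb2) x
  simp only [e1] at h4
  rw [← h4]
  exact (harm_sq_le (harm_mem _) hhB hh2 x).trans
    (mul_le_mul_of_nonneg_left (pow_le_pow_left₀ (norm_nonneg _) (norm_harm_le _) 2) (by norm_num))

end WGraph

namespace WGraph

open DiscreteL2

variable {X : Type*} [MeasurableSpace X] {m : Measure X} [IsDiscreteMeasure m] {G : WGraph X}
  [Countable X] [DiscreteMeasurableSpace X]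

/-! ## Reference measures -/

/-- The properties of the reference measure used for the trace map. -/
class IsTraceMeasure (μ : Measure (G.Boundary m)) : Prop where
  bound : ∃ C : ℝ≥0, ∀ f : G.BoundedNeumann m,
    ∫⁻ z, ENNReal.ofReal (G.trace₀ m f z ^ 2) ∂μ ≤ ENNReal.ofReal (C * ‖ofBdd f‖ ^ 2)
  mem_dspace : ∀ f : G.BoundedNeumann m, (∀ᵐ z ∂μ, G.trace₀ m f z = 0) → ofBdd f ∈ G.dspace m

theorem lintegral_trace₀_sq_le (f : G.BoundedNeumann m) (x : X) :
    ∫⁻ z, ENNReal.ofReal (G.trace₀ m f z ^ 2) ∂(G.harmonicMeasure m x) ≤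
      ENNReal.ofReal (3 * ‖ofBdd f‖ ^ 2) / m {x} := by
  have hi : Integrable (fun z => G.trace₀ m f z ^ 2) (G.harmonicMeasure m x) :=
    ((continuous_trace₀ f).pow 2).integrable_of_hasCompactSupport
      (HasCompactSupport.of_compactSpace _)
  have hm := mass_pos (m := m) x
  have h0 : m {x} = ENNReal.ofReal (m.real {x}) := by
    rw [Measure.real, ENNReal.ofReal_toReal (IsDiscreteMeasure.lt_top x).ne]
  rw [← ofReal_integral_eq_lintegral_ofReal hi (Eventually.of_forall fun z => sq_nonneg _), h0,
    ← ENNReal.ofReal_div_of_pos hm]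
  refine ENNReal.ofReal_le_ofReal ?_
  rw [le_div_iff₀' hm]
  exact integral_trace₀_sq_le f x

variable {w : X → ℝ≥0}

theorem exists_refMeasure_bound (hw : G.IsAdmissibleWeight m w) : ∃ C : ℝ≥0,
    ∀ f : G.BoundedNeumann m, ∫⁻ z, ENNReal.ofReal (G.trace₀ m f z ^ 2) ∂(G.refMeasure m w) ≤
      ENNReal.ofReal (C * ‖ofBdd f‖ ^ 2) := by
  -- The bounds `3‖f‖²/m(x)` for the single harmonic measures, summed with weights `w(x)`; this is
  -- where `sum_div_lt_top` is needed.
  refine ⟨(∑' x, (w x : ℝ≥0∞) / m {x}).toNNReal * 3, fun f => ?_⟩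
  rw [NNReal.coe_mul, mul_assoc, ENNReal.ofReal_mul (NNReal.coe_nonneg _), ENNReal.ofReal_coe_nnreal,
    ENNReal.coe_toNNReal hw.sum_div_lt_top.ne, refMeasure, lintegral_sum_measure,
    ← ENNReal.tsum_mul_right]
  refine ENNReal.tsum_le_tsum fun x => ?_
  rw [lintegral_smul_measure, ENNReal.smul_def, smul_eq_mul]
  refine (mul_le_mul_right (lintegral_trace₀_sq_le f x) _).trans (le_of_eq ?_)
  rw [ENNReal.div_eq_inv_mul, ENNReal.div_eq_inv_mul]
  simp only [NNReal.coe_ofNat]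
  ring

/-- A nonnegative harmonic function which vanishes at a point vanishes at the neighbours. -/
theorem eq_zero_of_adj {h : G.NSpace m} (hh : h ∈ (G.dspace m)ᗮ)
    (h0 : ∀ x, 0 ≤ (G.neumann m).incl h x) {x y : X} (hx : (G.neumann m).incl h x = 0)
    (hb : 0 < G.b x y) : (G.neumann m).incl h y = 0 := by
  have h1 := inner_nsingle x h
  rw [(mem_dspace_orthogonal_iff h).1 hh x, mul_add, mass_mul_laplacian, hx, mul_zero, mul_zero,
    add_zero, add_zero] at h1
  have h2 : Summable fun z => (G.b x z : ℝ) * (G.neumann m).incl h z :=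
    (mem_laplacianDomain ((G.neumann m).incl_mem h) x).congr fun z => by rw [abs_of_nonneg (h0 z)]
  have h3 : ∑' z, (G.b x z : ℝ) * (G.neumann m).incl h z = 0 := by
    rw [← neg_eq_zero, ← tsum_neg, h1]
    exact tsum_congr fun z => by ring
  have h4 := (hasSum_zero_iff_of_nonneg fun z => mul_nonneg (G.b x z).coe_nonneg (h0 z)).1
    (h3 ▸ h2.hasSum)
  exact (mul_eq_zero.1 (congrFun h4 y)).resolve_left (NNReal.coe_pos.2 hb).ne'

theorem Connected.symm {x y : X} (h : G.Connected x y) : G.Connected y x :=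
  Relation.ReflTransGen.mono (fun u v huv => by rwa [G.symm]) _ _ h.swap

/-- The harmonic extension of `|γ f|` is nonnegative and vanishes wherever `w > 0`. Its zeros spread
along edges through each component, so it is zero and `|f| ∈ D(Q^(D))`. -/
theorem mem_dspace_of_trace₀_ae_eq_zero (hw : G.IsAdmissibleWeight m w) (f : G.BoundedNeumann m)
    (hf : ∀ᵐ z ∂(G.refMeasure m w), G.trace₀ m f z = 0) : ofBdd f ∈ G.dspace m := by
  obtain ⟨B, hB⟩ := f.2.2
  set g : G.NSpace m := G.ncontr m NormalContraction.abs abs_zero (ofBdd f)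
  have hg : ∀ x, (G.neumann m).incl g x = |f.1 x| := ncontr_apply _ _ _
  have hgB : ∃ B : ℝ, ∀ x, |(G.neumann m).incl g x| ≤ B :=
    ⟨B, fun x => by rw [hg, abs_abs]; exact hB x⟩
  have htr : ∀ z, G.trace₀ m (toBdd g hgB) z = |G.trace₀ m f z| := fun z =>
    tendsto_nhds_unique (tendsto_nb (toBdd g hgB) z)
      ((tendsto_nb f z).abs.congr fun x => (hg x).symm)
  have h0 : ∀ x, 0 ≤ (G.neumann m).incl (G.harm m g) x :=
    harm_nonneg (fun x => by rw [hg]; exact abs_nonneg _) hgB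
  have hpos : ∀ x, 0 < w x → (G.neumann m).incl (G.harm m g) x = 0 := by
    intro x hx
    have h1 : ∀ᵐ z ∂(G.harmonicMeasure m x), G.trace₀ m f z = 0 := by
      rw [refMeasure, Measure.ae_sum_iff] at hf
      have h2 := hf x
      rw [ae_iff, Measure.smul_apply, ENNReal.smul_def, smul_eq_mul, mul_eq_zero] at h2
      exact ae_iff.2 (h2.resolve_left (by simpa using hx.ne'))
    refine (harm_eq_integral (toBdd g hgB) x).trans (integral_eq_zero_of_ae ?_)
    filter_upwards [h1] with z hz
    rw [htr, hz, abs_zero]; rfl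
  have hz : G.harm m g = 0 := by
    refine SymmForm.formSpace_ext _ fun x => ?_
    rw [map_zero, DiscreteL2.zero_apply]
    obtain ⟨y, hxy, hy⟩ := hw.exists_pos x
    have hyx : G.Connected y x := hxy.symm
    induction hyx with
    | refl => exact hpos y hy
    | tail _ hb ih => exact eq_zero_of_adj (harm_mem g) h0 (ih (Connected.symm ‹_›)) hb
  refine mem_dspace_of_abs_le ((harm_eq_zero_iff g).1 hz) fun x => ?_
  rw [hg, abs_abs]
  rfl

theorem isTraceMeasure_refMeasure (hw : G.IsAdmissibleWeight m w) :
    IsTraceMeasure (G.refMeasure m w) where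
  bound := exists_refMeasure_bound hw
  mem_dspace := mem_dspace_of_trace₀_ae_eq_zero hw

/-! ## The trace map on the form space -/

variable {μ : Measure (G.Boundary m)}

variable (m) in
/-- The real-valued boundary function of an element of the form space. -/
def traceFun (f : G.NSpace m) (z : G.Boundary m) : ℝ := Real.tan (G.trace₀ m (arctanBdd m f) z)

theorem measurable_traceFun (f : G.NSpace m) : Measurable (traceFun m f) := by
  have h : traceFun m f = fun z => Real.sin (G.trace₀ m (arctanBdd m f) z) /
      Real.cos (G.trace₀ m (arctanBdd m f) z) := funext fun z => Real.tan_eq_sin_div_cos _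
  rw [h]
  have hc := (continuous_trace₀ (arctanBdd m f))
  exact (Real.continuous_sin.comp hc).measurable.div (Real.continuous_cos.comp hc).measurable

/-- Truncations in the form space. -/
def clampBdd (n : ℕ) (f : G.NSpace m) : G.BoundedNeumann m :=
  toBdd (nclamp m n n.cast_nonneg f) ⟨n, abs_nclamp_le _ f⟩

theorem norm_ofBdd_clampBdd_le (n : ℕ) (f : G.NSpace m) : ‖ofBdd (clampBdd n f)‖ ≤ ‖f‖ :=
  norm_nclamp_le n.cast_nonneg f

theorem tendsto_clampBdd (n : ℕ) (f : G.NSpace m) (z : G.Boundary m) :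
    Tendsto (fun x => NormalContraction.clamp n ((G.neumann m).incl f x)) (nb z)
      (𝓝 (G.trace₀ m (clampBdd n f) z)) :=
  (tendsto_nb (clampBdd n f) z).congr fun _ => nclamp_apply _ _ _

theorem trace₀_clampBdd_of_tendsto (n : ℕ) {f : G.NSpace m} {z : G.Boundary m} {a : ℝ}
    (h : Tendsto (fun x => (G.neumann m).incl f x) (nb z) (𝓝 a)) :
    G.trace₀ m (clampBdd n f) z = NormalContraction.clamp n a :=
  tendsto_nhds_unique (tendsto_clampBdd n f z)
    (((NormalContraction.lipschitz_clamp n).continuous.tendsto a).comp h)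

theorem abs_trace₀_clampBdd {f : G.NSpace m} {z : G.Boundary m}
    (h : |G.trace₀ m (arctanBdd m f) z| = Real.pi / 2) (n : ℕ) :
    |G.trace₀ m (clampBdd n f) z| = n := by
  refine tendsto_nhds_unique (tendsto_clampBdd n f z).abs (tendsto_const_nhds.congr' ?_)
  have h1 := (tendsto_nb (arctanBdd m f) z).abs
  rw [h] at h1
  filter_upwards [h1.eventually (lt_mem_nhds (Real.arctan_lt_pi_div_two n))] with x hx
  rw [arctanBdd_apply] at hx
  by_contra hne
  have h2 : |NormalContraction.clamp n ((G.neumann m).incl f x)| < n :=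
    lt_of_le_of_ne (NormalContraction.abs_clamp_le n.cast_nonneg _) (Ne.symm hne)
  rw [NormalContraction.eq_clamp_of_abs_clamp_lt h2] at h2
  obtain ⟨h3, h4⟩ := abs_lt.1 h2
  have h5 := Real.arctan_strictMono h3
  have h6 := Real.arctan_strictMono h4
  rw [Real.arctan_neg] at h5
  exact absurd hx (not_lt.2 (abs_lt.2 ⟨h5, h6⟩).le)

open Classical in
theorem tendsto_trace₀_clampBdd_sq (f : G.NSpace m) (z : G.Boundary m) :
    Tendsto (fun n => ENNReal.ofReal (G.trace₀ m (clampBdd n f) z ^ 2)) atTop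
      (𝓝 (if |G.trace₀ m (arctanBdd m f) z| < Real.pi / 2
        then ENNReal.ofReal (traceFun m f z ^ 2) else ∞)) := by
  split_ifs with h
  · refine tendsto_const_nhds.congr' ?_
    filter_upwards [tendsto_natCast_atTop_atTop.eventually (eventually_ge_atTop |traceFun m f z|)]
      with n hn
    rw [trace₀_clampBdd_of_tendsto n (tendsto_of_abs_trace₀_lt f h)]
    change _ = ENNReal.ofReal (NormalContraction.clamp n (traceFun m f z) ^ 2)
    rw [NormalContraction.clamp_eq_self hn]
  · have h1 := abs_trace₀_clampBdd (le_antisymm (abs_trace₀_arctan_le f z) (not_lt.1 h))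
    refine ENNReal.tendsto_ofReal_nhds_top.2 ?_
    refine ((tendsto_pow_atTop two_ne_zero).comp (tendsto_natCast_atTop_atTop (R := ℝ))).congr
      fun n => ?_
    rw [Function.comp, ← h1 n, sq_abs]

section

variable [IsTraceMeasure μ]

variable (μ) in
/-- A constant bounding the trace map. -/
def traceConst : ℝ≥0 := (IsTraceMeasure.bound (μ := μ)).choose

-- Fatou's lemma for the truncations of `f`, whose form norms are at most `‖f‖`. The value `∞` of
-- the integrand where `γ f` is infinite yields almost everywhere finiteness together with the `L²`
-- bound.
open Classical in
theorem lintegral_traceFun_aux (f : G.NSpace m) :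
    ∫⁻ z, (if |G.trace₀ m (arctanBdd m f) z| < Real.pi / 2
        then ENNReal.ofReal (traceFun m f z ^ 2) else ∞) ∂μ ≤
      ENNReal.ofReal (traceConst μ * ‖f‖ ^ 2) := by
  simp only [← fun z => (tendsto_trace₀_clampBdd_sq f z).liminf_eq]
  refine (lintegral_liminf_le fun n =>
    (((continuous_trace₀ (clampBdd n f)).pow 2).measurable.ennreal_ofReal)).trans ?_
  refine liminf_le_of_frequently_le' (Frequently.of_forall fun n => ?_)
  refine ((IsTraceMeasure.bound (μ := μ)).choose_spec (clampBdd n f)).trans ?_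
  refine ENNReal.ofReal_le_ofReal (mul_le_mul_of_nonneg_left ?_ (NNReal.coe_nonneg _))
  exact pow_le_pow_left₀ (norm_nonneg _) (norm_ofBdd_clampBdd_le n f) 2

variable (μ) in
theorem ae_abs_trace₀_lt (f : G.NSpace m) :
    ∀ᵐ z ∂μ, |G.trace₀ m (arctanBdd m f) z| < Real.pi / 2 := by
  classical
  have h := lintegral_traceFun_aux (μ := μ) f
  have hm : Measurable fun z => (if |G.trace₀ m (arctanBdd m f) z| < Real.pi / 2
        then ENNReal.ofReal (traceFun m f z ^ 2) else ∞) :=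
    Measurable.ite (measurableSet_lt (continuous_trace₀ _).abs.measurable measurable_const)
      ((measurable_traceFun f).pow_const 2).ennreal_ofReal measurable_const
  filter_upwards [ae_lt_top hm (h.trans_lt ENNReal.ofReal_lt_top).ne] with z hz
  by_contra hn
  rw [if_neg hn] at hz
  exact lt_irrefl _ hz

theorem lintegral_traceFun_le (f : G.NSpace m) :
    ∫⁻ z, ENNReal.ofReal (traceFun m f z ^ 2) ∂μ ≤ ENNReal.ofReal (traceConst μ * ‖f‖ ^ 2) := by
  classical
  refine (lintegral_mono fun z => ?_).trans (lintegral_traceFun_aux f)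
  split_ifs
  · exact le_rfl
  · exact le_top

variable (μ) in
theorem memLp_traceFun (f : G.NSpace m) : MemLp (traceFun m f) 2 μ := by
  refine (memLp_two_iff_integrable_sq (measurable_traceFun f).aestronglyMeasurable).2
    ⟨((measurable_traceFun f).pow_const 2).aestronglyMeasurable, ?_⟩
  rw [hasFiniteIntegral_iff_ofReal (Eventually.of_forall fun z => sq_nonneg _)]
  exact (lintegral_traceFun_le f).trans_lt ENNReal.ofReal_lt_top

theorem hasTrace_toLp (f : G.NSpace m) :
    HasTrace ((G.neumann m).incl f) ((memLp_traceFun μ f).toLp) := by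
  filter_upwards [(memLp_traceFun μ f).coeFn_toLp, ae_abs_trace₀_lt μ f] with z h1 h2
  rw [h1]
  exact trace_eq_of_tendsto (tendsto_of_abs_trace₀_lt f h2)

theorem norm_toLp_sq_le (f : G.NSpace m) :
    ‖(memLp_traceFun μ f).toLp‖ ^ 2 ≤ traceConst μ * ‖f‖ ^ 2 := by
  have h1 : ‖(memLp_traceFun μ f).toLp‖ ^ 2 = ∫ z, traceFun m f z ^ 2 ∂μ := by
    rw [← real_inner_self_eq_norm_sq, L2.inner_def]
    refine integral_congr_ae ?_
    filter_upwards [(memLp_traceFun μ f).coeFn_toLp] with z h1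
    rw [h1, real_inner_self_eq_norm_sq, Real.norm_eq_abs, sq_abs]
  rw [h1, integral_eq_lintegral_of_nonneg_ae (Eventually.of_forall fun z => sq_nonneg _)
    ((measurable_traceFun f).pow_const 2).aestronglyMeasurable]
  refine ENNReal.toReal_le_of_le_ofReal (by positivity) (lintegral_traceFun_le f)

end

theorem HasTrace.unique {f : Lp ℝ 2 m} {φ ψ : Lp ℝ 2 μ} (h : HasTrace f φ) (h' : HasTrace f ψ) :
    φ = ψ := by
  refine Lp.ext ?_
  filter_upwards [h, h'] with z h1 h2
  exact EReal.coe_injective (h1.symm.trans h2)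

theorem hasTrace_iff {f : G.NSpace m} {φ : Lp ℝ 2 μ} : HasTrace ((G.neumann m).incl f) φ ↔
    ∀ᵐ z ∂μ, Tendsto (fun x => (G.neumann m).incl f x) (nb z) (𝓝 (φ z)) := by
  refine eventually_congr (Eventually.of_forall fun z => trace_eq_coe_iff f z _)

variable [IsTraceMeasure μ]

variable (μ) in
/-- The trace map from the form space to `L²` of the boundary. -/
def tr : G.NSpace m →L[ℝ] Lp ℝ 2 μ :=
  LinearMap.mkContinuous
    { toFun := fun f => (memLp_traceFun μ f).toLp
      map_add' := fun f g => by
        refine (hasTrace_toLp (f + g)).unique (hasTrace_iff.2 ?_)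
        filter_upwards [hasTrace_iff.1 (hasTrace_toLp (μ := μ) f),
          hasTrace_iff.1 (hasTrace_toLp (μ := μ) g), Lp.coeFn_add (memLp_traceFun μ f).toLp
          (memLp_traceFun μ g).toLp] with z h1 h2 h3
        rw [h3]
        refine (h1.add h2).congr fun x => ?_
        rw [map_add, DiscreteL2.add_apply]
      map_smul' := fun c f => by
        refine (hasTrace_toLp (c • f)).unique (hasTrace_iff.2 ?_)
        filter_upwards [hasTrace_iff.1 (hasTrace_toLp (μ := μ) f),
          Lp.coeFn_smul c (memLp_traceFun μ f).toLp] with z h1 h3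
        rw [RingHom.id_apply, h3]
        refine (h1.const_mul c).congr fun x => ?_
        rw [map_smul, DiscreteL2.smul_apply] }
    (Real.sqrt (traceConst μ)) fun f => by
      refine le_of_sq_le_sq ?_ (by positivity)
      rw [mul_pow, Real.sq_sqrt (NNReal.coe_nonneg _)]
      exact norm_toLp_sq_le f

theorem hasTrace_tr (f : G.NSpace m) : HasTrace ((G.neumann m).incl f) (tr μ f) := hasTrace_toLp f

theorem hasTrace_iff_tr_eq {f : G.NSpace m} {φ : Lp ℝ 2 μ} :
    HasTrace ((G.neumann m).incl f) φ ↔ tr μ f = φ :=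
  ⟨fun h => (hasTrace_tr f).unique h, fun h => h ▸ hasTrace_tr f⟩

theorem hasTrace_iff_of_mem {f : Lp ℝ 2 m} (hf : f ∈ (G.neumann m).dom) {φ : Lp ℝ 2 μ} :
    HasTrace f φ ↔ tr μ ((G.neumann m).ofMem hf) = φ :=
  hasTrace_iff_tr_eq (f := (G.neumann m).ofMem hf)

theorem tr_ncontr {C : ℝ → ℝ} (hC : LipschitzWith 1 C) (h0 : C 0 = 0) (f : G.NSpace m) :
    tr μ (G.ncontr m hC h0 f) = hC.compLp h0 (tr μ f) := by
  refine hasTrace_iff_tr_eq.1 (hasTrace_iff.2 ?_)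
  filter_upwards [hasTrace_iff.1 (hasTrace_tr (μ := μ) f), hC.coeFn_compLp h0 (tr μ f)] with z h1 h2
  rw [h2]
  exact ((hC.continuous.tendsto _).comp h1).congr fun x => (ncontr_apply hC h0 f x).symm

/-- The kernel of the trace map is the domain of the Dirichlet form. -/
theorem tr_eq_zero_iff (f : G.NSpace m) : tr μ f = 0 ↔ f ∈ G.dspace m := by
  constructor
  · intro h
    have h1 : ∀ᵐ z ∂μ, Tendsto (fun x => (G.neumann m).incl f x) (nb z) (𝓝 0) := by
      filter_upwards [hasTrace_iff.1 (hasTrace_iff_tr_eq.2 h), Lp.coeFn_zero ℝ 2 μ] with z h1 h2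
      rwa [h2] at h1
    -- The truncations of `f` are bounded with vanishing trace, hence in `D(Q^(D))`, and approximate
    -- `f` pointwise with bounded norm.
    refine SymmForm.mem_of_pointwise (l := atTop) (u := fun n : ℕ => ofBdd (clampBdd n f))
      isClosed_dspace (fun n => norm_ofBdd_clampBdd_le n f)
      (fun n => IsTraceMeasure.mem_dspace (μ := μ) _ ?_) fun x => ?_
    · filter_upwards [h1] with z hz
      rw [trace₀_clampBdd_of_tendsto n hz, NormalContraction.clamp_zero n.cast_nonneg]
    · refine tendsto_const_nhds.congr' ?_
      filter_upwards [tendsto_natCast_atTop_atTop.eventually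
        (eventually_ge_atTop |(G.neumann m).incl f x|)] with n hn
      exact ((nclamp_apply n.cast_nonneg f x).trans (NormalContraction.clamp_eq_self hn)).symm
  · intro h
    refine hasTrace_iff_tr_eq.1 (hasTrace_iff.2 ?_)
    filter_upwards [Lp.coeFn_zero ℝ 2 μ] with z h2
    rw [h2]
    exact tendsto_zero_of_mem_dspace h z

theorem tr_harm (f : G.NSpace m) : tr μ (G.harm m f) = tr μ f := by
  rw [← sub_eq_zero, ← neg_eq_zero, neg_sub, ← map_sub]
  exact (tr_eq_zero_iff _).2 (sub_harm_mem f)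

theorem harm_eq_of_tr_eq {f g : G.NSpace m} (h : tr μ f = tr μ g) : G.harm m f = G.harm m g := by
  rw [← sub_eq_zero, ← map_sub, harm_eq_zero_iff, ← tr_eq_zero_iff (μ := μ), map_sub, h, sub_self]

/-- Any harmonic function with the trace of `f` differs from `f` by an element of `D(Q^(D))`, so the
choice in `harmonicExtension` must be the orthogonal projection. -/
theorem harmonicExtension_tr (f : G.NSpace m) :
    harmonicExtension (tr μ f) = (G.neumann m).incl (G.harm m f) := by
  have hex : ∃ h, h ∈ (G.neumann m).dom ∧ G.IsOneHarmonic m h ∧ HasTrace h (tr μ f) :=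
    ⟨_, (G.neumann m).incl_mem (G.harm m f), (isOneHarmonic_iff _).2 (harm_mem f),
      hasTrace_iff_tr_eq.2 (tr_harm f)⟩
  rw [harmonicExtension, dif_pos hex]
  obtain ⟨h1, h2, h3⟩ := hex.choose_spec
  have h4 := (isOneHarmonic_iff ((G.neumann m).ofMem h1)).1 h2
  have h5 : tr μ ((G.neumann m).ofMem h1) = tr μ f := (hasTrace_iff_of_mem h1).1 h3
  have h6 : (G.neumann m).ofMem h1 = G.harm m f := by
    refine eq_harm h4 ?_
    rw [← tr_eq_zero_iff (μ := μ), map_sub, h5, sub_self]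
  exact congrArg (G.neumann m).incl h6

theorem dnVal_tr (f : G.NSpace m) : dnVal (tr μ f) = ENNReal.ofReal (‖G.harm m f‖ ^ 2) := by
  rw [dnVal, traceVal, if_pos ⟨_, (G.neumann m).incl_mem f, hasTrace_tr f⟩, harmonicExtension_tr,
    SymmForm.val₁_incl]

theorem exists_tr_eq_of_dnVal_ne_top {φ : Lp ℝ 2 μ} (h : dnVal φ ≠ ∞) : ∃ f, tr μ f = φ := by
  rw [dnVal, traceVal] at h
  split_ifs at h with h1
  · obtain ⟨f, hf, hφ⟩ := h1
    exact ⟨_, (hasTrace_iff_of_mem hf).1 hφ⟩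
  · exact absurd rfl h

end WGraph

namespace SymmForm

variable {H : Type*} [NormedAddCommGroup H] [InnerProductSpace ℝ H] {Q N : SymmForm H}

theorem norm_mapLE_le (hle : N ≤ Q) (hd : Q.dom ≤ N.dom) (f : Q.FormSpace) :
    ‖mapLE hd f‖ ≤ ‖f‖ := by
  obtain ⟨_, h⟩ := le_iff.1 hle
  refine le_of_sq_le_sq ?_ (norm_nonneg _)
  rw [norm_sq_eq, norm_sq_eq, incl_mapLE]
  exact add_le_add (h f) le_rfl

/-- A form space is complete if it is a bounded linear retract of a complete space. -/
theorem completeSpace_of_rightInverse {E : Type*} [NormedAddCommGroup E] [NormedSpace ℝ E]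
    [CompleteSpace E] {F : Type*} [NormedAddCommGroup F] [NormedSpace ℝ F] (T : E →L[ℝ] F)
    (K : F →L[ℝ] E) (h : ∀ φ, T (K φ) = φ) : CompleteSpace F := by
  refine Metric.complete_of_cauchySeq_tendsto fun u hu => ?_
  obtain ⟨k, hk⟩ := cauchySeq_tendsto_of_complete (K.uniformContinuous.comp_cauchySeq hu)
  refine ⟨T k, ((T.continuous.tendsto k).comp hk).congr fun n => h (u n)⟩

end SymmForm

namespace WGraph

open DiscreteL2 SymmForm

variable {X : Type*} [MeasurableSpace X] {m : Measure X} [IsDiscreteMeasure m] {G : WGraph X}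
  [Countable X] [DiscreteMeasurableSpace X] {Q : SymmForm (Lp ℝ 2 m)}

/-! ## The trace form of a form between the Neumann and the Dirichlet form -/

theorem dom_le_neumann (hQ : Q ∈ G.intermediateForms m) : Q.dom ≤ (G.neumann m).dom :=
  (le_iff.1 hQ.2.1).1

theorem incl_mem_of_mem_dspace (hQ : Q ∈ G.intermediateForms m) {f : G.NSpace m}
    (hf : f ∈ G.dspace m) : (G.neumann m).incl f ∈ Q.dom :=
  dirichlet_le_dom hQ.2.2 ((mem_dspace_iff f).1 hf)

theorem incl_harm_mem (hQ : Q ∈ G.intermediateForms m) (f : Q.FormSpace) :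
    (G.neumann m).incl (G.harm m (mapLE (dom_le_neumann hQ) f)) ∈ Q.dom := by
  have h := Q.dom.sub_mem (Q.incl_mem f) (incl_mem_of_mem_dspace hQ
    (sub_harm_mem (mapLE (dom_le_neumann hQ) f)))
  rwa [map_sub, incl_mapLE, sub_sub_cancel] at h

/-- The harmonic part of an element of the form space of a form between the Neumann and the
Dirichlet form. -/
def harmPart (hQ : Q ∈ G.intermediateForms m) : Q.FormSpace →ₗ[ℝ] Q.FormSpace where
  toFun f := Q.ofMem (incl_harm_mem hQ f)
  map_add' f g := Q.incl_injective (by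
    rw [map_add Q.incl]
    change (G.neumann m).incl (G.harm m (mapLE _ (f + g))) = (G.neumann m).incl (G.harm m (mapLE _ f)) +
      (G.neumann m).incl (G.harm m (mapLE _ g))
    rw [map_add, map_add, map_add])
  map_smul' c f := Q.incl_injective (by
    rw [RingHom.id_apply, map_smul Q.incl]
    change (G.neumann m).incl (G.harm m (mapLE _ (c • f))) =
      c • (G.neumann m).incl (G.harm m (mapLE _ f))
    rw [map_smul, map_smul, map_smul])

theorem mapLE_harmPart (hQ : Q ∈ G.intermediateForms m) (f : Q.FormSpace) :
    mapLE (dom_le_neumann hQ) (harmPart hQ f) = G.harm m (mapLE (dom_le_neumann hQ) f) :=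
  (G.neumann m).incl_injective rfl

/-- The first argument lies in `D(Q^(D))`, where `Q` and `Q^(N)` have the same bilinear values. -/
theorem inner_sub_harmPart (hQ : Q ∈ G.intermediateForms m) (f g : Q.FormSpace) :
    inner ℝ (f - harmPart hQ f) g = inner ℝ (mapLE (dom_le_neumann hQ) f -
      G.harm m (mapLE (dom_le_neumann hQ) f)) (mapLE (dom_le_neumann hQ) g) := by
  rw [← mapLE_harmPart, ← map_sub, inner_eq, inner_eq, incl_mapLE, incl_mapLE,
    fm_eq_of_mem_dirichlet hQ.2.1 hQ.2.2 (dom_le_neumann hQ)]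
  rw [← incl_mapLE (dom_le_neumann hQ), ← mem_dspace_iff, map_sub, mapLE_harmPart]
  exact sub_harm_mem _

/-- The splitting into harmonic and `D(Q^(D))` parts stays orthogonal for `Q₁`, and the latter part
keeps its Neumann norm. -/
theorem norm_sq_eq_harmPart (hQ : Q ∈ G.intermediateForms m) (f : Q.FormSpace) :
    ‖f‖ ^ 2 = ‖harmPart hQ f‖ ^ 2 + ‖mapLE (dom_le_neumann hQ) f -
      G.harm m (mapLE (dom_le_neumann hQ) f)‖ ^ 2 := by
  have h1 : inner ℝ (f - harmPart hQ f) (harmPart hQ f) = 0 := by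
    rw [inner_sub_harmPart, mapLE_harmPart]
    exact inner_dspace_harm (sub_harm_mem _) (harm_mem _)
  have h2 : ‖f - harmPart hQ f‖ ^ 2 = ‖mapLE (dom_le_neumann hQ) f -
      G.harm m (mapLE (dom_le_neumann hQ) f)‖ ^ 2 := by
    rw [← real_inner_self_eq_norm_sq, inner_sub_harmPart, map_sub, mapLE_harmPart,
      real_inner_self_eq_norm_sq]
  have h3 := norm_add_sq_real (f - harmPart hQ f) (harmPart hQ f)
  rw [sub_add_cancel, h1, h2] at h3
  linarith

theorem norm_harmPart_le (hQ : Q ∈ G.intermediateForms m) (f : Q.FormSpace) :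
    ‖harmPart hQ f‖ ≤ ‖f‖ := by
  refine le_of_sq_le_sq ?_ (norm_nonneg _)
  rw [norm_sq_eq_harmPart hQ f]
  exact le_add_of_nonneg_right (sq_nonneg _)

/-- The difference to the Neumann form only depends on the harmonic part. -/
theorem fm_sub_fm_eq (hQ : Q ∈ G.intermediateForms m) (f : Q.FormSpace) :
    Q.fm f f - (G.neumann m).fm (mapLE (dom_le_neumann hQ) f) (mapLE (dom_le_neumann hQ) f) =
      ‖harmPart hQ f‖ ^ 2 - ‖G.harm m (mapLE (dom_le_neumann hQ) f)‖ ^ 2 := by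
  have h1 := norm_sq_eq_harmPart hQ f
  have h2 := norm_sq_eq_harm (mapLE (dom_le_neumann hQ) f)
  rw [norm_sq_eq] at h1 h2
  rw [incl_mapLE] at h2
  linarith

variable {μ : Measure (G.Boundary m)} [IsTraceMeasure μ]

variable (μ) in
/-- The trace map on the form space of a form between the Neumann and the Dirichlet form. -/
def trDom (hQ : Q ∈ G.intermediateForms m) : Q.FormSpace →L[ℝ] Lp ℝ 2 μ :=
  tr μ ∘L LinearMap.mkContinuous (mapLE (dom_le_neumann hQ)) 1 fun f => by
    rw [one_mul]; exact norm_mapLE_le hQ.2.1 _ f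

theorem trDom_apply (hQ : Q ∈ G.intermediateForms m) (f : Q.FormSpace) :
    trDom μ hQ f = tr μ (mapLE (dom_le_neumann hQ) f) := rfl

theorem trDom_harmPart (hQ : Q ∈ G.intermediateForms m) (f : Q.FormSpace) :
    trDom μ hQ (harmPart hQ f) = trDom μ hQ f := by
  rw [trDom_apply, trDom_apply, mapLE_harmPart, tr_harm]

theorem harmPart_eq_of_trDom_eq (hQ : Q ∈ G.intermediateForms m) {f g : Q.FormSpace}
    (h : trDom μ hQ f = trDom μ hQ g) : harmPart hQ f = harmPart hQ g :=
  Q.incl_injective (congrArg (G.neumann m).incl (harm_eq_of_tr_eq h))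

/-- Functions in `D(Q)` have a trace, and the trace determines membership in `D(Q)`. -/
theorem exists_hasTrace_iff (hQ : Q ∈ G.intermediateForms m) (f : G.NSpace m) :
    (∃ g ∈ Q.dom, HasTrace g (tr μ f)) ↔ (G.neumann m).incl f ∈ Q.dom := by
  constructor
  · rintro ⟨g, hg, ht⟩
    have h1 := (hasTrace_iff_of_mem (dom_le_neumann hQ hg)).1 ht
    have h2 : f - (G.neumann m).ofMem (dom_le_neumann hQ hg) ∈ G.dspace m := by
      rw [← tr_eq_zero_iff (μ := μ), map_sub, h1, sub_self]
    have h3 := Q.dom.add_mem (incl_mem_of_mem_dspace hQ h2) hg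
    rwa [map_sub, incl_ofMem, sub_add_cancel] at h3
  · exact fun h => ⟨_, h, hasTrace_tr f⟩

theorem traceVal_trDom (hQ : Q ∈ G.intermediateForms m) (f : Q.FormSpace) :
    traceVal Q (trDom μ hQ f) = ENNReal.ofReal (‖harmPart hQ f‖ ^ 2) := by
  rw [traceVal, trDom_apply, if_pos ((exists_hasTrace_iff hQ _).2 (Q.incl_mem f)),
    harmonicExtension_tr, ← val₁_incl]
  rfl

theorem exists_trDom_of_traceVal_ne_top (hQ : Q ∈ G.intermediateForms m) {φ : Lp ℝ 2 μ}
    (h : traceVal Q φ ≠ ∞) : ∃ f, trDom μ hQ f = φ := by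
  rw [traceVal] at h
  split_ifs at h with h1
  · obtain ⟨f, hf, hφ⟩ := h1
    exact ⟨Q.ofMem hf, (hasTrace_iff_of_mem (dom_le_neumann hQ hf)).1 hφ⟩
  · exact absurd rfl h

theorem dnVal_trDom (hQ : Q ∈ G.intermediateForms m) (f : Q.FormSpace) :
    dnVal (trDom μ hQ f) = ENNReal.ofReal (‖G.harm m (mapLE (dom_le_neumann hQ) f)‖ ^ 2) :=
  dnVal_tr _

/-- `Q = Q^(N) + Tr Q ∘ γ - q^DN ∘ γ`. -/
theorem val_add_dnVal (hQ : Q ∈ G.intermediateForms m) (f : G.NSpace m) :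
    Q.val ((G.neumann m).incl f) + dnVal (tr μ f) =
      (G.neumann m).val ((G.neumann m).incl f) + traceVal Q (tr μ f) := by
  by_cases hf : (G.neumann m).incl f ∈ Q.dom
  · have e : mapLE (dom_le_neumann hQ) (Q.ofMem hf) = f := (G.neumann m).incl_injective rfl
    have h1 := fm_sub_fm_eq hQ (Q.ofMem hf)
    have h2 := traceVal_trDom (μ := μ) hQ (Q.ofMem hf)
    have h3 := Q.val_incl (Q.ofMem hf)
    rw [trDom_apply, e] at h2
    rw [e] at h1
    rw [incl_ofMem] at h3
    rw [h2, h3, val_incl, dnVal_tr, ← ENNReal.ofReal_add (Q.fm_nonneg _) (sq_nonneg _),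
      ← ENNReal.ofReal_add (fm_nonneg _ _) (sq_nonneg _)]
    congr 1
    linarith
  · rw [traceVal, if_neg ((exists_hasTrace_iff hQ f).not.2 hf), add_top, val, dif_neg hf, top_add]

/-- Injectivity for a fixed graph: in `val_add_dnVal` the finite term `q^DN(γ f)` cancels, so `Tr Q`
determines `Q`. -/
theorem eq_of_traceVal_eq {Q' : SymmForm (Lp ℝ 2 m)} (hQ : Q ∈ G.intermediateForms m)
    (hQ' : Q' ∈ G.intermediateForms m) (h : ∀ φ : Lp ℝ 2 μ, traceVal Q φ = traceVal Q' φ) :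
    Q = Q' := by
  refine ext_val fun f => ?_
  by_cases hf : f ∈ (G.neumann m).dom
  · have h1 := val_add_dnVal (μ := μ) hQ ((G.neumann m).ofMem hf)
    have h2 := val_add_dnVal (μ := μ) hQ' ((G.neumann m).ofMem hf)
    rw [h, ← h2, dnVal_tr] at h1
    exact (ENNReal.add_left_inj ENNReal.ofReal_ne_top).1 h1
  · rw [val, dif_neg fun h => hf (dom_le_neumann hQ h), val,
      dif_neg fun h => hf (dom_le_neumann hQ' h)]

/-- The harmonic extension, with values in the form space of `Q`. -/
def harmExt (hQ : Q ∈ G.intermediateForms m) :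
    LinearMap.range (trDom μ hQ).toLinearMap →ₗ[ℝ] Q.FormSpace where
  -- Any preimage will do: the harmonic part depends only on the trace, which also gives linearity.
  toFun φ := harmPart hQ φ.2.choose
  map_add' φ ψ := by
    rw [← map_add]
    refine harmPart_eq_of_trDom_eq (μ := μ) hQ ?_
    rw [map_add]
    exact (φ + ψ).2.choose_spec.trans (congrArg₂ (· + ·) φ.2.choose_spec.symm ψ.2.choose_spec.symm)
  map_smul' c φ := by
    rw [← map_smul]
    refine harmPart_eq_of_trDom_eq (μ := μ) hQ ?_
    rw [map_smul]
    exact (c • φ).2.choose_spec.trans (congrArg (c • ·) φ.2.choose_spec.symm)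

theorem harmExt_trDom (hQ : Q ∈ G.intermediateForms m) (f : Q.FormSpace)
    (h : trDom μ hQ f ∈ LinearMap.range (trDom μ hQ).toLinearMap) :
    harmExt hQ ⟨trDom μ hQ f, h⟩ = harmPart hQ f :=
  harmPart_eq_of_trDom_eq (μ := μ) hQ h.choose_spec

variable (μ) in
/-- The trace form `Tr Q`. -/
def traceForm (hQ : Q ∈ G.intermediateForms m) : SymmForm (Lp ℝ 2 μ) where
  dom := LinearMap.range (trDom μ hQ).toLinearMap
  form := (innerₗ Q.FormSpace).compl₁₂ (harmExt hQ) (harmExt hQ)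
  symm φ ψ := (real_inner_comm _ _ : inner ℝ (harmExt hQ φ) (harmExt hQ ψ) = inner ℝ (harmExt hQ ψ) (harmExt hQ φ))
  nonneg φ := (real_inner_self_nonneg : 0 ≤ inner ℝ (harmExt hQ φ) (harmExt hQ φ))

theorem trDom_mem (hQ : Q ∈ G.intermediateForms m) (f : Q.FormSpace) :
    trDom μ hQ f ∈ (traceForm μ hQ).dom := ⟨f, rfl⟩

theorem fm_traceForm (hQ : Q ∈ G.intermediateForms m) (f : Q.FormSpace) :
    (traceForm μ hQ).fm ((traceForm μ hQ).ofMem (trDom_mem hQ f))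
      ((traceForm μ hQ).ofMem (trDom_mem hQ f)) = ‖harmPart hQ f‖ ^ 2 := by
  have h := harmExt_trDom (μ := μ) hQ f ⟨f, rfl⟩
  exact (congrArg₂ (inner ℝ) h h).trans (real_inner_self_eq_norm_sq _)

theorem val_traceForm_trDom (hQ : Q ∈ G.intermediateForms m) (f : Q.FormSpace) :
    (traceForm μ hQ).val (trDom μ hQ f) = ENNReal.ofReal (‖harmPart hQ f‖ ^ 2) := by
  rw [← fm_traceForm (μ := μ), ← val_incl]
  rfl

theorem val_traceForm (hQ : Q ∈ G.intermediateForms m) (φ : Lp ℝ 2 μ) :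
    (traceForm μ hQ).val φ = traceVal Q φ := by
  by_cases h : φ ∈ (traceForm μ hQ).dom
  · obtain ⟨f, rfl⟩ := h
    exact (val_traceForm_trDom hQ f).trans (traceVal_trDom hQ f).symm
  · rw [val, dif_neg h]
    by_contra hne
    exact h (exists_trDom_of_traceVal_ne_top hQ (Ne.symm hne))

theorem isTraceForm_traceForm (hQ : Q ∈ G.intermediateForms m) :
    IsTraceForm Q (traceForm μ hQ) := ⟨hQ, val_traceForm hQ⟩

/-- The trace `T` and the harmonic extension `K` are bounded with `T ∘ K = id`, so completeness is
inherited from the form space of `Q`. -/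
theorem completeSpace_traceForm (hQ : Q ∈ G.intermediateForms m) :
    CompleteSpace (traceForm μ hQ).FormSpace := by
  have := Q.completeSpace_of_isClosedForm hQ.1.closed
  let T : Q.FormSpace →L[ℝ] (traceForm μ hQ).FormSpace := LinearMap.mkContinuous
    ((traceForm μ hQ).toDom.symm.toLinearMap ∘ₗ (trDom μ hQ).toLinearMap.rangeRestrict)
    (1 + ‖trDom μ hQ‖) fun f => by
      change ‖(traceForm μ hQ).ofMem (trDom_mem hQ f)‖ ≤ _
      refine le_of_sq_le_sq ?_ (by positivity)
      rw [norm_sq_eq, fm_traceForm, incl_ofMem]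
      have h1 := (trDom μ hQ).le_opNorm f
      have h2 := norm_harmPart_le hQ f
      have h3 := pow_le_pow_left₀ (norm_nonneg _) h1 2
      have h4 := pow_le_pow_left₀ (norm_nonneg _) h2 2
      have h5 : 0 ≤ ‖trDom μ hQ‖ * ‖f‖ * ‖f‖ := by positivity
      nlinarith
  let K : (traceForm μ hQ).FormSpace →L[ℝ] Q.FormSpace := LinearMap.mkContinuous
    (harmExt hQ ∘ₗ (traceForm μ hQ).toDom.toLinearMap) 1 fun φ => by
      rw [one_mul]
      refine le_of_sq_le_sq ?_ (norm_nonneg _)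
      have h1 : (traceForm μ hQ).fm φ φ = ‖harmExt hQ ((traceForm μ hQ).toDom φ)‖ ^ 2 :=
        real_inner_self_eq_norm_sq (harmExt hQ ((traceForm μ hQ).toDom φ))
      rw [(traceForm μ hQ).norm_sq_eq φ, h1]
      exact le_add_of_nonneg_right (sq_nonneg _)
  refine completeSpace_of_rightInverse T K fun φ => (traceForm μ hQ).incl_injective ?_
  obtain ⟨⟨_, f, rfl⟩, rfl⟩ := (traceForm μ hQ).toDom.symm.surjective φ
  exact (congrArg (trDom μ hQ) (harmExt_trDom hQ f ⟨f, rfl⟩)).trans (trDom_harmPart hQ f)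

theorem mapLE_contr (hQ : Q ∈ G.intermediateForms m) {C : ℝ → ℝ} (hC : LipschitzWith 1 C)
    (h0 : C 0 = 0) (f : Q.FormSpace) :
    mapLE (dom_le_neumann hQ) (contr hQ.1.markovian hC h0 f) =
      G.ncontr m hC h0 (mapLE (dom_le_neumann hQ) f) :=
  (G.neumann m).incl_injective rfl

theorem trDom_contr (hQ : Q ∈ G.intermediateForms m) {C : ℝ → ℝ} (hC : LipschitzWith 1 C)
    (h0 : C 0 = 0) (f : Q.FormSpace) :
    trDom μ hQ (contr hQ.1.markovian hC h0 f) = hC.compLp h0 (trDom μ hQ f) := by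
  rw [trDom_apply, mapLE_contr hQ, tr_ncontr, trDom_apply]

/-- Markov property: `H(C ∘ φ)` is the harmonic part of `C ∘ Hφ`, and neither the contraction nor
the projection increases `Q₁`. -/
theorem isWideDirichletForm_traceForm (hQ : Q ∈ G.intermediateForms m) :
    IsWideDirichletForm (traceForm μ hQ) where
  closed := by
    have := completeSpace_traceForm (μ := μ) hQ
    exact isClosedForm_of_completeSpace _
  markovian := by
    rintro C hC h0 φ ⟨f, hf⟩
    replace hf : trDom μ hQ f = φ := hf
    rw [← hf, ← trDom_harmPart, ← trDom_contr]
    refine ⟨trDom_mem hQ _, ?_⟩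
    beta_reduce
    rw [val_traceForm_trDom, val_traceForm_trDom, ENNReal.toReal_ofReal (sq_nonneg _),
      ENNReal.toReal_ofReal (sq_nonneg _)]
    refine pow_le_pow_left₀ (norm_nonneg _) ?_ 2
    refine (norm_harmPart_le hQ _).trans ((norm_contr_le _ hC h0 _).trans (le_of_eq ?_))
    rw [harmPart_eq_of_trDom_eq (μ := μ) hQ (trDom_harmPart hQ f)]

theorem dnVal_le_traceVal (hQ : Q ∈ G.intermediateForms m) (φ : Lp ℝ 2 μ) :
    dnVal φ ≤ traceVal Q φ := by
  by_cases h : traceVal Q φ = ∞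
  · rw [h]; exact le_top
  · obtain ⟨f, rfl⟩ := exists_trDom_of_traceVal_ne_top hQ h
    rw [dnVal_trDom, traceVal_trDom hQ, ← mapLE_harmPart hQ]
    exact ENNReal.ofReal_le_ofReal
      (pow_le_pow_left₀ (norm_nonneg _) (norm_mapLE_le hQ.2.1 _ _) 2)

/-- At `γ f` the difference `Tr Q - q^DN` equals `Q(f) - Q^(N)(f)`, whose Markov property is
`sub_neumann_contr_le`; the trace commutes with contractions. -/
theorem traceForm_mem (hQ : Q ∈ G.intermediateForms m) (hD : Q ∈ dirichletForms m) :
    traceForm μ hQ ∈ traceForms μ := by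
  have key : ∀ f : Q.FormSpace, ((traceForm μ hQ).val (trDom μ hQ f)).toReal -
      (dnVal (trDom μ hQ f)).toReal = Q.fm f f -
        (G.neumann m).fm (mapLE (dom_le_neumann hQ) f) (mapLE (dom_le_neumann hQ) f) := by
    intro f
    rw [fm_sub_fm_eq hQ f, val_traceForm_trDom, dnVal_trDom, ENNReal.toReal_ofReal (sq_nonneg _),
      ENNReal.toReal_ofReal (sq_nonneg _)]
  refine ⟨isWideDirichletForm_traceForm hQ, fun φ => ?_, ?_⟩
  · rw [val_traceForm]; exact dnVal_le_traceVal hQ φ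
  · rintro C hC h0 φ ⟨f, hf⟩
    replace hf : trDom μ hQ f = φ := hf
    rw [← hf, ← trDom_contr]
    refine ⟨trDom_mem hQ _, ?_⟩
    beta_reduce
    have := Q.completeSpace_of_isClosedForm hQ.1.closed
    rw [key, key]
    exact sub_neumann_contr_le hD ((generatorIsRestriction_iff_intermediate hD).2 hQ) _ hC h0 f

theorem isRepresentedBy_traceForm (hQ : Q ∈ G.intermediateForms m) :
    IsRepresentedBy Q (traceForm μ hQ) := by
  refine ⟨dom_le_neumann hQ, fun f hf => ⟨trDom μ hQ (Q.ofMem hf), trDom_mem hQ (Q.ofMem hf),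
    hasTrace_tr (mapLE (dom_le_neumann hQ) (Q.ofMem hf)), ?_⟩⟩
  have h := fm_sub_fm_eq hQ (Q.ofMem hf)
  have h2 := (G.neumann m).toReal_val_incl (mapLE (dom_le_neumann hQ) (Q.ofMem hf))
  rw [incl_mapLE, incl_ofMem] at h2
  rw [val_traceForm_trDom, dnVal_trDom, ENNReal.toReal_ofReal (sq_nonneg _),
    ENNReal.toReal_ofReal (sq_nonneg _), Q.toReal_val hf, h2]
  linarith

/-- Forms given by the Neumann form plus a boundary term lie between the Neumann and the Dirichlet
form. -/
theorem mem_intermediateForms_of_isRepresentedBy (hD : Q ∈ dirichletForms m)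
    {q : SymmForm (Lp ℝ 2 μ)} (hq : q ∈ traceForms μ) (h : IsRepresentedBy Q q) :
    Q ∈ G.intermediateForms m := by
  have := Q.completeSpace_of_isClosedForm hD.1.closed
  obtain ⟨hd, h⟩ := h
  refine ⟨hD.1, le_iff.2 ⟨hd, fun f => ?_⟩, le_dirichlet_of_eqOn_finSupp hD.2 fun f g hfg hfs => ?_⟩
  · obtain ⟨φ, hφ, -, e⟩ := h _ (Q.incl_mem f)
    have h1 : (dnVal φ).toReal ≤ (q.val φ).toReal :=
      ENNReal.toReal_mono ((q.val_ne_top_iff φ).2 hφ) (hq.2.1 φ)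
    rw [← toReal_val_incl, ← toReal_val_incl, incl_mapLE, e]
    linarith
  · obtain ⟨φ, hφ, ht, e⟩ := h _ (Q.incl_mem f)
    -- Finitely supported functions have zero trace, so the boundary term disappears.
    have hg : g ∈ G.dspace m := mem_dspace_of_finSupp (hfg ▸ hfs)
    rw [hfg, hasTrace_iff_tr_eq, (tr_eq_zero_iff g).2 hg] at ht
    subst ht
    have h1 : q.val 0 = 0 := by
      have h2 := q.val_incl 0
      rwa [map_zero, fm, map_zero, map_zero, ENNReal.ofReal_zero] at h2
    have h2 : dnVal (0 : Lp ℝ 2 μ) = 0 := le_antisymm ((hq.2.1 0).trans h1.le) zero_le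
    rw [h1, h2, ENNReal.toReal_zero, add_zero, sub_zero, toReal_val_incl, hfg, toReal_val_incl] at e
    exact e

end WGraph

namespace WGraph

open DiscreteL2 SymmForm

variable {X : Type*} [MeasurableSpace X] {m : Measure X} [IsDiscreteMeasure m] {G : WGraph X}
  [Countable X] [DiscreteMeasurableSpace X] {μ : Measure (G.Boundary m)} [IsTraceMeasure μ]

/-! ## The form given by a boundary term -/

variable (m) in
/-- The domain `{f ∈ D(Q^(N)) : γ f ∈ D(q)}`. -/
def extDom (q : SymmForm (Lp ℝ 2 μ)) : Submodule ℝ (Lp ℝ 2 m) :=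
  (q.dom.comap (tr μ).toLinearMap).map (G.neumann m).incl.toLinearMap

variable {q : SymmForm (Lp ℝ 2 μ)}

theorem extDom_le : extDom m q ≤ (G.neumann m).dom := by
  rintro _ ⟨f, -, rfl⟩
  exact (G.neumann m).incl_mem f

theorem incl_mem_extDom (f : G.NSpace m) : (G.neumann m).incl f ∈ extDom m q ↔ tr μ f ∈ q.dom := by
  constructor
  · rintro ⟨g, hg, e⟩
    rwa [← (G.neumann m).incl_injective e]
  · exact fun h => ⟨f, h, rfl⟩

/-- The inclusion of the domain into the form space of the Neumann form. -/
def extIncl : extDom m q →ₗ[ℝ] G.NSpace m :=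
  (G.neumann m).toDom.symm.toLinearMap ∘ₗ Submodule.inclusion extDom_le

theorem tr_extIncl_mem (f : extDom m q) : tr μ (extIncl f) ∈ q.dom :=
  (incl_mem_extDom (extIncl f)).1 f.2

/-- The trace map on the domain. -/
def extTr : extDom m q →ₗ[ℝ] q.FormSpace :=
  q.toDom.symm.toLinearMap ∘ₗ ((tr μ).toLinearMap ∘ₗ extIncl).codRestrict q.dom tr_extIncl_mem

theorem incl_extTr (f : extDom m q) : q.incl (extTr f) = tr μ (extIncl f) := rfl

theorem norm_harm_sq_le (hq : q ∈ traceForms μ) {f : G.NSpace m} {φ : q.FormSpace}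
    (h : q.incl φ = tr μ f) : ‖G.harm m f‖ ^ 2 ≤ q.fm φ φ := by
  have h1 := hq.2.1 (tr μ f)
  rw [dnVal_tr, ← h, val_incl] at h1
  exact (ENNReal.ofReal_le_ofReal_iff (q.fm_nonneg φ)).1 h1

/-- The form `Q^(N) + q ∘ γ - q^DN ∘ γ`. -/
def extForm (hq : q ∈ traceForms μ) : SymmForm (Lp ℝ 2 m) where
  dom := extDom m q
  -- The first two terms give `Q^(N)` as form inner product minus `ℓ²` inner product; the last is
  -- `q^DN ∘ γ`, the inner product of the harmonic parts.
  form := (innerₗ (G.NSpace m)).compl₁₂ extIncl extIncl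
    - (innerₗ (Lp ℝ 2 m)).compl₁₂ (extDom m q).subtype (extDom m q).subtype
    + q.form.compl₁₂ (q.toDom.toLinearMap ∘ₗ extTr) (q.toDom.toLinearMap ∘ₗ extTr)
    - (innerₗ (G.NSpace m)).compl₁₂ ((G.harm m).toLinearMap ∘ₗ extIncl)
      ((G.harm m).toLinearMap ∘ₗ extIncl)
  symm f g := by
    change inner ℝ (extIncl f) (extIncl g) - inner ℝ f.1 g.1 + q.fm (extTr f) (extTr g)
      - inner ℝ (G.harm m (extIncl f)) (G.harm m (extIncl g)) =
      inner ℝ (extIncl g) (extIncl f) - inner ℝ g.1 f.1 + q.fm (extTr g) (extTr f)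
      - inner ℝ (G.harm m (extIncl g)) (G.harm m (extIncl f))
    rw [real_inner_comm, real_inner_comm g.1, fm_comm,
      real_inner_comm (G.harm m (extIncl g))]
  nonneg f := by
    change 0 ≤ inner ℝ (extIncl f) (extIncl f) - inner ℝ f.1 f.1 + q.fm (extTr f) (extTr f)
      - inner ℝ (G.harm m (extIncl f)) (G.harm m (extIncl f))
    have h1 := norm_harm_sq_le hq (incl_extTr f)
    have h2 := (G.neumann m).norm_incl_le (extIncl f)
    have h3 := pow_le_pow_left₀ (norm_nonneg _) h2 2
    have h4 : ‖(G.neumann m).incl (extIncl f)‖ = ‖f.1‖ := rfl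
    rw [real_inner_self_eq_norm_sq, real_inner_self_eq_norm_sq, real_inner_self_eq_norm_sq]
    rw [h4] at h3
    linarith

theorem dom_extForm (hq : q ∈ traceForms μ) : (extForm hq).dom ≤ (G.neumann m).dom := extDom_le

/-- The trace map on the form space. -/
def trExt (hq : q ∈ traceForms μ) : (extForm hq).FormSpace →ₗ[ℝ] q.FormSpace :=
  extTr ∘ₗ (extForm hq).toDom.toLinearMap

theorem incl_trExt (hq : q ∈ traceForms μ) (f : (extForm hq).FormSpace) :
    q.incl (trExt hq f) = tr μ (mapLE (dom_extForm hq) f) := rfl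

theorem fm_extForm (hq : q ∈ traceForms μ) (f : (extForm hq).FormSpace) :
    (extForm hq).fm f f = (G.neumann m).fm (mapLE (dom_extForm hq) f) (mapLE (dom_extForm hq) f) +
      q.fm (trExt hq f) (trExt hq f) - ‖G.harm m (mapLE (dom_extForm hq) f)‖ ^ 2 := by
  have h1 : (extForm hq).fm f f = inner ℝ (mapLE (dom_extForm hq) f) (mapLE (dom_extForm hq) f) -
      inner ℝ ((extForm hq).incl f) ((extForm hq).incl f) + q.fm (trExt hq f) (trExt hq f) -
      inner ℝ (G.harm m (mapLE (dom_extForm hq) f)) (G.harm m (mapLE (dom_extForm hq) f)) := rfl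
  rw [h1, inner_eq, incl_mapLE, real_inner_self_eq_norm_sq (G.harm m _), add_sub_cancel_right]

/-- Subtracting `q^DN(γ f)` removes exactly the harmonic part of the Neumann norm, and `q(γ f)`
takes its place. -/
theorem norm_sq_extForm (hq : q ∈ traceForms μ) (f : (extForm hq).FormSpace) :
    ‖f‖ ^ 2 = ‖mapLE (dom_extForm hq) f - G.harm m (mapLE (dom_extForm hq) f)‖ ^ 2 +
      q.fm (trExt hq f) (trExt hq f) := by
  have h := norm_sq_eq_harm (mapLE (dom_extForm hq) f)
  rw [norm_sq_eq (f := mapLE _ f), incl_mapLE] at h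
  rw [norm_sq_eq, fm_extForm]
  linarith

/-- The representation of the values of the form. -/
theorem val_extForm_add (hq : q ∈ traceForms μ) (f : G.NSpace m) :
    (extForm hq).val ((G.neumann m).incl f) + dnVal (tr μ f) =
      (G.neumann m).val ((G.neumann m).incl f) + q.val (tr μ f) := by
  by_cases hf : (G.neumann m).incl f ∈ (extForm hq).dom
  · have e : mapLE (dom_extForm hq) ((extForm hq).ofMem hf) = f := (G.neumann m).incl_injective rfl
    have h1 := fm_extForm hq ((extForm hq).ofMem hf)
    have h2 := (extForm hq).val_incl ((extForm hq).ofMem hf)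
    have h3 := q.val_incl (trExt hq ((extForm hq).ofMem hf))
    rw [incl_trExt, e] at h3
    rw [e] at h1
    rw [incl_ofMem] at h2
    rw [h2, h3, val_incl, dnVal_tr, ← ENNReal.ofReal_add (fm_nonneg _ _) (sq_nonneg _),
      ← ENNReal.ofReal_add (fm_nonneg _ _) (fm_nonneg _ _)]
    congr 1
    linarith
  · have h1 : tr μ f ∉ q.dom := fun h => hf ((incl_mem_extDom f).2 h)
    rw [val, dif_neg hf, val, val, dif_neg h1, top_add, add_top]

/-- The form norm is controlled from both sides by the Neumann norm of `f` and the `q`-form norm of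
`γ f`. Limits in these two complete spaces match because the trace is continuous. -/
theorem completeSpace_extForm (hq : q ∈ traceForms μ) : CompleteSpace (extForm hq).FormSpace := by
  have := q.completeSpace_of_isClosedForm hq.1.closed
  have b1 : ∀ f : (extForm hq).FormSpace, ‖mapLE (dom_extForm hq) f‖ ≤ ‖f‖ := fun f => by
    refine le_of_sq_le_sq ?_ (norm_nonneg _)
    rw [norm_sq_eq_harm, norm_sq_extForm]
    linarith [norm_harm_sq_le hq (incl_trExt hq f)]
  let A : (extForm hq).FormSpace →L[ℝ] G.NSpace m := LinearMap.mkContinuous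
    (mapLE (dom_extForm hq)) 1 fun f => by rw [one_mul]; exact b1 f
  let B : (extForm hq).FormSpace →L[ℝ] q.FormSpace := LinearMap.mkContinuous
    (trExt hq) (1 + ‖tr μ (G := G) (m := m)‖) fun f => by
      refine le_of_sq_le_sq ?_ (by positivity)
      rw [norm_sq_eq, incl_trExt]
      have h1 := (tr μ).le_opNorm (mapLE (dom_extForm hq) f)
      have h2 : q.fm (trExt hq f) (trExt hq f) ≤ ‖f‖ ^ 2 := by
        rw [norm_sq_extForm]
        exact le_add_of_nonneg_left (sq_nonneg _)
      have h3 := h1.trans (mul_le_mul_of_nonneg_left (b1 f) (norm_nonneg _))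
      have h4 := pow_le_pow_left₀ (norm_nonneg _) h3 2
      have h5 : 0 ≤ ‖tr μ (G := G) (m := m)‖ * ‖f‖ * ‖f‖ := by positivity
      nlinarith
  refine Metric.complete_of_cauchySeq_tendsto fun u hu => ?_
  obtain ⟨F, hF⟩ := cauchySeq_tendsto_of_complete (A.uniformContinuous.comp_cauchySeq hu)
  obtain ⟨φ, hφ⟩ := cauchySeq_tendsto_of_complete (B.uniformContinuous.comp_cauchySeq hu)
  have hφF : q.incl φ = tr μ F :=
    tendsto_nhds_unique ((q.incl.continuous.tendsto φ).comp hφ) (((tr μ).continuous.tendsto F).comp hF)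
  have hmem : (G.neumann m).incl F ∈ (extForm hq).dom :=
    (incl_mem_extDom F).2 (hφF ▸ q.incl_mem φ)
  set f := (extForm hq).ofMem hmem
  have e1 : A f = F := (G.neumann m).incl_injective rfl
  have e2 : B f = φ := q.incl_injective hφF.symm
  refine ⟨f, tendsto_iff_norm_sub_tendsto_zero.2 ?_⟩
  have hF' := tendsto_iff_norm_sub_tendsto_zero.1 hF
  have hφ' := tendsto_iff_norm_sub_tendsto_zero.1 hφ
  have h3 := (hF'.pow 2).add (hφ'.pow 2)
  have h4 : Tendsto (fun n => Real.sqrt (‖A (u n) - F‖ ^ 2 + ‖B (u n) - φ‖ ^ 2)) atTop (𝓝 0) := by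
    have := (Real.continuous_sqrt.tendsto _).comp h3
    simpa [Function.comp_def] using this
  refine squeeze_zero (fun n => norm_nonneg _) (fun n => Real.le_sqrt_of_sq_le ?_) h4
  rw [← e1, ← e2, ← map_sub, ← map_sub]
  change _ ≤ ‖mapLE (dom_extForm hq) (u n - f)‖ ^ 2 + ‖trExt hq (u n - f)‖ ^ 2
  rw [norm_sq_extForm, norm_sq_eq_harm (mapLE (dom_extForm hq) (u n - f)),
    norm_sq_eq (f := trExt hq (u n - f))]
  linarith [sq_nonneg ‖q.incl (trExt hq (u n - f))‖,
    sq_nonneg ‖G.harm m (mapLE (dom_extForm hq) (u n - f))‖]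

theorem tr_eq_of_mem_extForm (hq : q ∈ traceForms μ) {f : Lp ℝ 2 m} (hf : f ∈ (extForm hq).dom) :
    ∃ F : G.NSpace m, (G.neumann m).incl F = f ∧ tr μ F ∈ q.dom :=
  ⟨(G.neumann m).ofMem (dom_extForm hq hf), rfl, (incl_mem_extDom _).1 hf⟩

theorem toReal_val_extForm (hq : q ∈ traceForms μ) {F : G.NSpace m} (hF : tr μ F ∈ q.dom) :
    ((extForm hq).val ((G.neumann m).incl F)).toReal =
      (G.neumann m).fm F F + ((q.val (tr μ F)).toReal - (dnVal (tr μ F)).toReal) := by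
  have h := congrArg ENNReal.toReal (val_extForm_add hq F)
  have h1 : (extForm hq).val ((G.neumann m).incl F) ≠ ∞ :=
    (val_ne_top_iff _ _).2 ((incl_mem_extDom F).2 hF)
  have h2 : q.val (tr μ F) ≠ ∞ := (val_ne_top_iff _ _).2 hF
  have h3 : dnVal (tr μ F) ≠ ∞ := by rw [dnVal_tr]; exact ENNReal.ofReal_ne_top
  have h4 : (G.neumann m).val ((G.neumann m).incl F) ≠ ∞ :=
    (val_ne_top_iff _ _).2 ((G.neumann m).incl_mem F)
  rw [ENNReal.toReal_add h1 h3, ENNReal.toReal_add h4 h2, toReal_val_incl] at h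
  linarith

/-- The form is the Markovian `Q^(N)` plus the Markovian `q - q^DN` composed with the trace, which
commutes with contractions. -/
theorem markovianOn_extForm (hq : q ∈ traceForms μ) :
    MarkovianOn (extForm hq).dom fun f => ((extForm hq).val f).toReal := by
  intro C hC h0 f hf
  obtain ⟨F, rfl, hF⟩ := tr_eq_of_mem_extForm hq hf
  have h1 := hq.2.2 C hC h0 _ hF
  rw [← tr_ncontr] at h1
  have e : hC.compLp h0 ((G.neumann m).incl F) = (G.neumann m).incl (G.ncontr m hC h0 F) := rfl
  rw [e]
  refine ⟨(incl_mem_extDom _).2 h1.1, ?_⟩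
  beta_reduce
  rw [toReal_val_extForm hq h1.1, toReal_val_extForm hq hF]
  exact add_le_add (fm_contr_le _ hC h0 F) h1.2

theorem val_zero_eq (Q : SymmForm (Lp ℝ 2 μ)) : Q.val 0 = 0 := by
  have h2 := Q.val_incl 0
  rwa [map_zero, fm, map_zero, map_zero, ENNReal.ofReal_zero] at h2

theorem extForm_mem (hq : q ∈ traceForms μ) : extForm hq ∈ G.intermediateForms m := by
  have := completeSpace_extForm hq
  have hd : ∀ F ∈ G.dspace m, (G.neumann m).incl F ∈ (extForm hq).dom := fun F hF =>
    (incl_mem_extDom F).2 (by rw [(tr_eq_zero_iff F).2 hF]; exact q.dom.zero_mem)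
  have hf : finSupp m ≤ (extForm hq).dom := fun f hf =>
    hd ((G.neumann m).ofMem (finSupp_le_neumann hf)) (mem_dspace_of_finSupp hf)
  refine ⟨⟨⟨isClosedForm_of_completeSpace _, markovianOn_extForm hq⟩,
    (dense_finSupp (m := m)).mono hf⟩, le_iff.2 ⟨dom_extForm hq, fun f => ?_⟩, ?_⟩
  · rw [fm_extForm]
    linarith [norm_harm_sq_le hq (incl_trExt hq f)]
  · refine le_dirichlet_of_eqOn_finSupp hf fun f g hfg hfs => ?_
    have hg : tr μ g = 0 := (tr_eq_zero_iff g).2 (mem_dspace_of_finSupp (hfg ▸ hfs))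
    have h1 := toReal_val_extForm hq (F := g) (by rw [hg]; exact q.dom.zero_mem)
    have h2 : dnVal (0 : Lp ℝ 2 μ) = 0 := le_antisymm ((hq.2.1 0).trans (val_zero_eq q).le) zero_le
    rw [hg, h2, val_zero_eq, ← hfg, toReal_val_incl] at h1
    simpa using h1

theorem finSupp_le_dom {Q : SymmForm (Lp ℝ 2 m)} (hQ : Q ∈ G.intermediateForms m) :
    finSupp m ≤ Q.dom := finSupp_le_dirichlet.trans (dirichlet_le_dom hQ.2.2)

/-- Surjectivity for a fixed graph: comparing `val_add_dnVal` with the construction of the form and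
cancelling the finite Neumann energy leaves `q`. Where `q^DN` is infinite, so are both sides. -/
theorem traceVal_extForm (hq : q ∈ traceForms μ) (φ : Lp ℝ 2 μ) :
    traceVal (extForm hq) φ = q.val φ := by
  by_cases h : dnVal φ = ∞
  · have h1 := dnVal_le_traceVal (extForm_mem hq) φ
    have h2 := hq.2.1 φ
    rw [h, top_le_iff] at h1 h2
    rw [h1, h2]
  · obtain ⟨F, rfl⟩ := exists_tr_eq_of_dnVal_ne_top h
    have h1 := val_add_dnVal (μ := μ) (extForm_mem hq) F
    rw [val_extForm_add, val_incl] at h1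
    exact ((ENNReal.add_right_inj ENNReal.ofReal_ne_top).1 h1).symm

end WGraph

/-! ### Assembly of the main theorem -/

open WGraph in
theorem mainTheorem3 {X : Type*} [Countable X] [MeasurableSpace X] [DiscreteMeasurableSpace X]
    (m : Measure X) [IsDiscreteMeasure m]
    (w : WGraph X → X → ℝ≥0) (hw : ∀ G : WGraph X, G.IsAdmissibleWeight m (w G)) :
    (∀ Q ∈ dirichletForms m,
      ((∃ G : WGraph X, G.GeneratorIsRestriction m Q) ↔
        ∃ G : WGraph X, G.HasBoundaryRepresentation m (w G) Q) ∧
      (∀ G G' : WGraph X,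
        G.GeneratorIsRestriction m Q ∨ G.HasBoundaryRepresentation m (w G) Q →
        G'.GeneratorIsRestriction m Q ∨ G'.HasBoundaryRepresentation m (w G') Q → G = G') ∧
      (∀ G : WGraph X, G.GeneratorIsRestriction m Q →
        ∃ q ∈ WGraph.traceForms (G.refMeasure m (w G)),
          WGraph.IsTraceForm Q q ∧ WGraph.IsRepresentedBy Q q)) ∧
    ∃ Φ : {Q : SymmForm (Lp ℝ 2 m) //
          Q ∈ dirichletForms m ∧ ∃ G : WGraph X, G.GeneratorIsRestriction m Q} →
        (Σ G : WGraph X, {q : SymmForm (Lp ℝ 2 (G.refMeasure m (w G))) //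
          q ∈ WGraph.traceForms (G.refMeasure m (w G))}),
      (∀ Q, (Φ Q).1.GeneratorIsRestriction m Q.1 ∧ WGraph.IsTraceForm Q.1 (Φ Q).2.1) ∧
      Function.Bijective Φ := by
  have hμ : ∀ G : WGraph X, IsTraceMeasure (G.refMeasure m (w G)) := fun G =>
    isTraceMeasure_refMeasure (hw G)
  have hrep : ∀ Q ∈ dirichletForms m, ∀ G : WGraph X, G.GeneratorIsRestriction m Q →
      ∃ q ∈ traceForms (G.refMeasure m (w G)), IsTraceForm Q q ∧ IsRepresentedBy Q q := by
    intro Q hQ G hG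
    have h := (generatorIsRestriction_iff_intermediate hQ).1 hG
    exact ⟨traceForm _ h, traceForm_mem h hQ, isTraceForm_traceForm h, isRepresentedBy_traceForm h⟩
  have hint : ∀ Q ∈ dirichletForms m, ∀ G : WGraph X,
      G.GeneratorIsRestriction m Q ∨ G.HasBoundaryRepresentation m (w G) Q →
      Q ∈ G.intermediateForms m := by
    rintro Q hQ G (hG | ⟨q, hq, hG⟩)
    · exact (generatorIsRestriction_iff_intermediate hQ).1 hG
    · exact mem_intermediateForms_of_isRepresentedBy hQ hq hG
  have huniq : ∀ Q ∈ dirichletForms m, ∀ G G' : WGraph X,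
      G.GeneratorIsRestriction m Q ∨ G.HasBoundaryRepresentation m (w G) Q →
      G'.GeneratorIsRestriction m Q ∨ G'.HasBoundaryRepresentation m (w G') Q → G = G' := by
    intro Q hQ G G' h h'
    have h1 := hint Q hQ G h
    have h2 := hint Q hQ G' h'
    exact eq_of_intermediate h1.2.1 h1.2.2 h2.2.1 h2.2.2
  refine ⟨fun Q hQ => ⟨⟨?_, ?_⟩, huniq Q hQ, hrep Q hQ⟩, ?_⟩
  · rintro ⟨G, hG⟩
    obtain ⟨q, hq, -, h⟩ := hrep Q hQ G hG
    exact ⟨G, q, hq, h⟩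
  · rintro ⟨G, hG⟩
    exact ⟨G, (generatorIsRestriction_iff_intermediate hQ).2 (hint Q hQ G (Or.inr hG))⟩
  choose g hg using fun Q : {Q : SymmForm (Lp ℝ 2 m) //
      Q ∈ dirichletForms m ∧ ∃ G : WGraph X, G.GeneratorIsRestriction m Q} => Q.2.2
  choose q hq hqt _ using fun Q : {Q : SymmForm (Lp ℝ 2 m) //
      Q ∈ dirichletForms m ∧ ∃ G : WGraph X, G.GeneratorIsRestriction m Q} =>
    hrep Q.1 Q.2.1 (g Q) (hg Q)
  refine ⟨fun Q => ⟨g Q, q Q, hq Q⟩, fun Q => ⟨hg Q, hqt Q⟩, ?_, ?_⟩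
  · have key : ∀ (G G' : WGraph X) (p : {q : SymmForm (Lp ℝ 2 (G.refMeasure m (w G))) //
          q ∈ traceForms (G.refMeasure m (w G))})
        (p' : {q : SymmForm (Lp ℝ 2 (G'.refMeasure m (w G'))) //
          q ∈ traceForms (G'.refMeasure m (w G'))}) (Q Q' : SymmForm (Lp ℝ 2 m)),
        IsTraceForm Q p.1 → IsTraceForm Q' p'.1 →
        (⟨G, p⟩ : Σ G : WGraph X, {q : SymmForm (Lp ℝ 2 (G.refMeasure m (w G))) //
          q ∈ traceForms (G.refMeasure m (w G))}) = ⟨G', p'⟩ → Q = Q' := by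
      rintro G _ p _ Q Q' h h' ⟨⟩
      exact eq_of_traceVal_eq h.mem h'.mem fun φ => (h.val_eq φ).symm.trans (h'.val_eq φ)
    intro Q Q' h
    exact Subtype.ext (key _ _ _ _ _ _ (hqt Q) (hqt Q') h)
  -- The boundary space depends on the graph, so the graphs are kept as variables until their
  -- equality can be substituted; then both forms are traces of the same `Q`.
  · have key : ∀ (G G' : WGraph X) (p : {q : SymmForm (Lp ℝ 2 (G.refMeasure m (w G))) //
          q ∈ traceForms (G.refMeasure m (w G))})
        (p' : {q : SymmForm (Lp ℝ 2 (G'.refMeasure m (w G'))) //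
          q ∈ traceForms (G'.refMeasure m (w G'))}) (Q : SymmForm (Lp ℝ 2 m)),
        G = G' → IsTraceForm Q p.1 → IsTraceForm Q p'.1 →
        (⟨G, p⟩ : Σ G : WGraph X, {q : SymmForm (Lp ℝ 2 (G.refMeasure m (w G))) //
          q ∈ traceForms (G.refMeasure m (w G))}) = ⟨G', p'⟩ := by
      rintro G _ p p' Q rfl h h'
      have e : p = p' := Subtype.ext
        (SymmForm.ext_val fun φ => (h.val_eq φ).trans (h'.val_eq φ).symm)
      rw [e]
    rintro ⟨G, p⟩
    have hQ := extForm_mem p.2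
    have hD : extForm p.2 ∈ dirichletForms m := ⟨hQ.1, finSupp_le_dom hQ⟩
    have hG := (generatorIsRestriction_iff_intermediate hD).2 hQ
    refine ⟨⟨extForm p.2, hD, G, hG⟩, key _ _ _ _ (extForm p.2) ?_ (hqt ⟨extForm p.2, hD, G, hG⟩)
      ⟨hQ, fun φ => (traceVal_extForm p.2 φ).symm⟩⟩
    exact huniq _ hD _ _ (Or.inl (hg _)) (Or.inl hG)

end
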